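/- All $C^*$-algebras are complex. A \emph{quasitrace} on a $C^*$-algebra $A$ is a function $\tau:A\to\mathbb{C}$ such that $\tau(x^*x)=\tau(xx^*)\ge 0$ for all $x\in A$, $\tau$ is linear on every commutative $C^*$-subalgebra of $A$, and $\tau(a+ib)=\tau(a)+i\tau(b)$ for all self-adjoint $a,b\in A$. It is a \emph{2-quasitrace} if there is a quasitrace $\tau_2$ on $M_2(A)$ with $\tau_2(x\otimes e_{11})=\tau(x)$ for all $x\in A$. For unital $A$, let $QT(A)$ be the set of 2-quasitraces $\tau$ on $A$ with $\tau(1_A)=1$ (equivalently $\|\tau\|=\tau(1_A)=1$). A \emph{trace} is a positive linear functional $\tau$ with $\tau(xy)=\tau(yx)$ for all $x,y$. Let $\mathcal{T}$ be the class of unital $C^*$-algebras $B$ such that every 2-quasitrace on $B$ is a trace. For $\mathcal{F}\subset A$ and $\eta>0$, a map $\alpha:A\to B$ of $C^*$-algebras is an \emph{$(\mathcal{F},\eta)$-approximate embedding} if $\|\alpha(xy)-\alpha(x)\alpha(y)\|<\eta$ and $\big|\|\alpha(x)\|-\|x\|\big|<\eta$ for all $x,y\in\mathcal{F}$. For $a,b\in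 A$ positive, $a\lesssim_A b$ means that there are $x_i\in A$ with $\lim_{i\to\infty}\|a-x_i^*bx_i\|=0$. The abbreviation c.p.c. stands for completely positive contractive (and linear). \textbf{Theorem.} Let $A$ be a unital separable $C^*$-algebra. Suppose that for every $\varepsilon>0$, every $\eta>0$ and every finite subset $\mathcal{F}\subset A$ there exist a unital $C^*$-algebra $B$ in $\mathcal{T}$ and c.p.c. maps $\alpha:A\to B$, $\beta_n:B\to A$ and $\gamma_n:A\to A$ ($n\in\mathbb{N}$) such that (1) $\|x-(\gamma_n(x)+\beta_n(\alpha(x)))\|<\eta$ for all $x\in\mathcal{F}$ and all $n\in\mathbb{N}$; (2) $\alpha$ is an $(\mathcal{F},\eta)$-approximate embedding; (3) $\lim_{n\to\infty}\|\beta_n(b_1b_2)-\beta_n(b_1)\beta_n(b_2)\|=0$ and $\lim_{n\to\infty}\|\beta_n(b_1)\|=\|b_1\|$ for all $b_1,b_2\in B$; (4) $\sup\{\tau(\gamma_n(1_A)):\tau\in QT(A)\}<\varepsilon$ for all $n\in\mathbb{N}$ (a condition that holds by convention if $QT(A)=\emptyset$). Then $A\in\mathcal{T}$. In particular, if $A$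 is a unital separable simple $C^*$-algebra that is \emph{asymptotically tracially in $\mathcal{T}$}, then $A\in\mathcal{T}$. Here $A$ is asymptotically tracially in $\mathcal{T}$ if for every finite subset $\mathcal{F}\subset A$, every $\varepsilon>0$ and every nonzero positive $a\in A$ there exist $B\in\mathcal{T}$ and c.p.c. maps $\alpha:A\to B$, $\beta_n:B\to A$ and $\gamma_n:A\to A$ ($n\in\mathbb{N}$) satisfying (1) and (2) with $\eta=\varepsilon$, satisfying (3), and such that $\gamma_n(1_A)\lesssim_A a$ for all $n\in\mathbb{N}$. -/

import Mathlib

open Filter Topology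
open scoped ComplexOrder CStarAlgebra

universe u v

section Quasitraces

/-- A quasitrace on a C⋆-algebra `A`: a function `τ : A → ℂ` with `τ (x⋆x) = τ (xx⋆) ≥ 0`,
which is linear on every commutative C⋆-subalgebra and satisfies `τ (a + ib) = τ a + i τ b` for
self-adjoint `a`, `b`. (Only the star-algebra structure and the topology of `A` enter.) -/
structure IsQuasitrace {A : Type u} [NonUnitalRing A] [StarRing A] [Module ℂ A]
    [TopologicalSpace A] (τ : A → ℂ) : Prop where
  nonneg : ∀ x : A, 0 ≤ τ (star x * x)
  star_mul_comm : ∀ x : A, τ (star x * x) = τ (x * star x)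
  map_add_of_comm : ∀ S : NonUnitalStarSubalgebra ℂ A, IsClosed (S : Set A) →
    (∀ x ∈ S, ∀ y ∈ S, x * y = y * x) → ∀ x ∈ S, ∀ y ∈ S, τ (x + y) = τ x + τ y
  map_smul_of_comm : ∀ S : NonUnitalStarSubalgebra ℂ A, IsClosed (S : Set A) →
    (∀ x ∈ S, ∀ y ∈ S, x * y = y * x) → ∀ (c : ℂ), ∀ x ∈ S, τ (c • x) = c * τ x
  map_add_I_smul : ∀ a b : A, IsSelfAdjoint a → IsSelfAdjoint b →
    τ (a + Complex.I • b) = τ a + Complex.I * τ b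

variable {A : Type u} [CStarAlgebra A]

/-- A 2-quasitrace: a quasitrace on `A` that extends to a quasitrace on `M₂(A)`, where `A` is
identified with the upper left corner of `M₂(A)`. -/
def IsTwoQuasitrace (τ : A → ℂ) : Prop :=
  IsQuasitrace τ ∧ ∃ τ₂ : CStarMatrix (Fin 2) (Fin 2) A → ℂ, IsQuasitrace τ₂ ∧
    ∀ x : A, τ₂ (CStarMatrix.ofMatrix (Matrix.single 0 0 x)) = τ x

/-- A (finite, positive) trace: a positive linear functional `τ` with `τ (xy) = τ (yx)`. -/
structure IsTrace (τ : A → ℂ) : Prop where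
  isLinear : IsLinearMap ℂ τ
  nonneg : ∀ x : A, 0 ≤ τ (star x * x)
  mul_comm : ∀ x y : A, τ (x * y) = τ (y * x)

variable (A) in
/-- `QT(A)`: the normalized 2-quasitraces (the norm of a 2-quasitrace `τ` is `τ 1`). -/
def QT : Set (A → ℂ) := {τ | IsTwoQuasitrace τ ∧ τ 1 = 1}

end Quasitraces

/-- The class `𝒯` of unital C⋆-algebras all of whose 2-quasitraces are traces. -/
def InT (B : Type u) [CStarAlgebra B] : Prop :=
  ∀ τ : B → ℂ, IsTwoQuasitrace τ → IsTrace τ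

/-- A C⋆-algebra is simple if `0` and `A` are its only closed two-sided ideals. -/
def IsSimpleCStarAlgebra (A : Type u) [CStarAlgebra A] : Prop :=
  ∀ I : TwoSidedIdeal A, IsClosed (I : Set A) → I = ⊥ ∨ I = ⊤

/-- Cuntz subequivalence `a ≲ b` of elements of `A`. -/
def CuntzLE {A : Type u} [CStarAlgebra A] (a b : A) : Prop :=
  ∃ x : ℕ → A, Tendsto (fun i => ‖a - star (x i) * b * x i‖) atTop (𝓝 0)

/-- `φ` is an `(F, ε)`-approximate embedding: it is `ε`-multiplicative and `ε`-isometric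
on `F`. -/
def IsApproxEmbedding {A : Type u} {B : Type v} [CStarAlgebra A] [CStarAlgebra B]
    (F : Set A) (ε : ℝ) (φ : A → B) : Prop :=
  (∀ x ∈ F, ∀ y ∈ F, ‖φ (x * y) - φ x * φ y‖ < ε) ∧ ∀ x ∈ F, |‖φ x‖ - ‖x‖| < ε

section TracialApproximation

variable {A : Type u} {B : Type v} [CStarAlgebra A] [PartialOrder A] [StarOrderedRing A]
  [CStarAlgebra B] [PartialOrder B] [StarOrderedRing B]

/-- The completely positive maps `α : A → B`, `βₙ : B → A`, `γₙ : A → A` are contractive and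
satisfy the conditions common to the two notions of tracial approximation below:
`x ≈ γₙ(x) + βₙ(α(x))` up to `η` on `F` for all `n`, `α` is an `(F, η)`-approximate embedding,
and `(βₙ)` is asymptotically multiplicative and asymptotically isometric on `B`. -/
structure IsApproxDecomposition (F : Set A) (η : ℝ) (α : A →CP B) (β : ℕ → B →CP A)
    (γ : ℕ → A →CP A) : Prop where
  contractive_α : ∀ x : A, ‖α x‖ ≤ ‖x‖
  contractive_β : ∀ (n : ℕ) (y : B), ‖β n y‖ ≤ ‖y‖
  contractive_γ : ∀ (n : ℕ) (x : A), ‖γ n x‖ ≤ ‖x‖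
  approx : ∀ x ∈ F, ∀ n : ℕ, ‖x - (γ n x + β n (α x))‖ < η
  approxEmbedding : IsApproxEmbedding F η α
  tendsto_mul : ∀ x y : B, Tendsto (fun n => ‖β n (x * y) - β n x * β n y‖) atTop (𝓝 0)
  tendsto_norm : ∀ x : B, Tendsto (fun n => ‖β n x‖) atTop (𝓝 ‖x‖)

end TracialApproximation

/-- `A` (unital, and simple where this is used) is asymptotically tracially in the class `P` of
unital C⋆-algebras. The order on `B` is the C⋆-algebra order, which `StarOrderedRing` pins
down. -/
def AsymptoticallyTraciallyIn (P : ∀ (B : Type v) [CStarAlgebra B], Prop)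
    (A : Type u) [CStarAlgebra A] [PartialOrder A] [StarOrderedRing A] : Prop :=
  ∀ (F : Finset A) (ε : ℝ), 0 < ε → ∀ a : A, 0 ≤ a → a ≠ 0 →
    ∃ (B : Type v) (_ : CStarAlgebra B) (_ : PartialOrder B) (_ : StarOrderedRing B)
      (α : A →CP B) (β : ℕ → B →CP A) (γ : ℕ → A →CP A),
      P B ∧ IsApproxDecomposition (F : Set A) ε α β γ ∧ ∀ n, CuntzLE (γ n 1) a

/-- `A` admits tracial approximations by unital C⋆-algebras in the class `P` with remainders that
are uniformly small in all normalized 2-quasitraces. The supremum is over real numbers bounded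
by `1`; it is `0` if `QT(A)` is empty, in which case the condition holds. -/
def ApproximatedInQuasitraces (P : ∀ (B : Type v) [CStarAlgebra B], Prop)
    (A : Type u) [CStarAlgebra A] [PartialOrder A] [StarOrderedRing A] : Prop :=
  ∀ ε : ℝ, 0 < ε → ∀ η : ℝ, 0 < η → ∀ F : Finset A,
    ∃ (B : Type v) (_ : CStarAlgebra B) (_ : PartialOrder B) (_ : StarOrderedRing B)
      (α : A →CP B) (β : ℕ → B →CP A) (γ : ℕ → A →CP A),
      P B ∧ IsApproxDecomposition (F : Set A) η α β γ ∧
        ∀ n, sSup ((fun τ : A → ℂ => (τ (γ n 1)).re) '' QT A) < ε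

set_option linter.unusedSectionVars false

/-! By rescaling it suffices to treat a 2-quasitrace τ with τ(1) = 1, and τ is a trace once it is
additive on positive elements. Given positive x and y, approximate {x, y, x + y} through some B in
𝒯. Along a free ultrafilter the functionals τ ∘ βₙ converge on self-adjoint elements to a
2-quasitrace σ on B (`IsTwoQuasitrace.exists_limit`), and σ is linear because B is in 𝒯. Since z ≈
γₙ(z) + βₙ(α(z)) and τ(γₙ(z)) ≤ ‖z‖ τ(γₙ(1)) is small, τ(z) ≈ σ(α(z)) for z = x, y, x + y, so the
additivity of σ passes to τ (`IsTwoQuasitrace.isTrace_of_hasSmallRemainders`).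

Two analytic facts support this. First, quasitraces are monotone (`IsRealQuasitrace.mono`), hence
Lipschitz: if a ≤ b, each spectral slice of a is dominated in trace by the slice of b two levels
lower, and scaling removes the resulting bounded defect. Monotonicity on M₂(A) gives Haagerup's
inequality τ(a + b) ≤ (1 + s) τ(a) + (1 + 1/s) τ(b), by which small remainders are negligible.

Second, σ must be additive on commuting pairs, although βₙ sends such pairs only to almost commuting
ones. What survives the limit directly is additivity on algebras generated by one element. Together
with monotonicity and a quasi-triangle inequality this suffices
(`IsLocalQuasitrace.add_of_commute`): both elements are nearly diagonal over products of spectral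
bumps, these products are orthogonal, orthogonal positive elements lie in a singly generated
algebra, and pigeonhole makes the gaps between bumps small.

In the simple case, suppose first that there are nonzero positive a with a unit g of arbitrarily
small trace; then γₙ(1) ≲ a makes the remainders small. Otherwise orthogonal families have bounded
size, self-adjoint elements are diagonalized by minimal projections, all of these have the same
trace, and τ is a multiple of a sum of diagonal coefficients. -/

/-- The real form of a quasitrace: a functional on the self-adjoint part (its values elsewhere are
irrelevant) which is additive on commuting self-adjoint elements. -/
structure IsRealQuasitrace {A : Type u} [CStarAlgebra A] [PartialOrder A] (t : A → ℝ) :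
    Prop where
  add_of_commute : ∀ x y : A, IsSelfAdjoint x → IsSelfAdjoint y → Commute x y →
    t (x + y) = t x + t y
  smul : ∀ (r : ℝ) (x : A), IsSelfAdjoint x → t (r • x) = r * t x
  nonneg : ∀ x : A, 0 ≤ x → 0 ≤ t x
  star_mul_comm : ∀ x : A, t (star x * x) = t (x * star x)

/-! ### Complex quasitraces and their real parts on self-adjoint elements -/

section Basic

variable {A : Type u} [CStarAlgebra A]

/-- The bicommutant of `{x, y}` works: the pair lies in its own commutant, so the bicommutant is
contained in the commutant and is therefore commutative. Centralizers are closed. -/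
lemma exists_commutative_subalgebra {x y : A} (hx : IsSelfAdjoint x) (hy : IsSelfAdjoint y)
    (h : Commute x y) : ∃ S : NonUnitalStarSubalgebra ℂ A, IsClosed (S : Set A) ∧
      (∀ a ∈ S, ∀ b ∈ S, a * b = b * a) ∧ x ∈ S ∧ y ∈ S := by
  set C := NonUnitalStarSubalgebra.centralizer ℂ ({x, y} : Set A) with hC
  have hxC : x ∈ C := by
    rw [hC, NonUnitalStarSubalgebra.mem_centralizer_iff]
    rintro g (rfl | rfl)
    · simp [hx.star_eq]
    · simp [hy.star_eq, h.eq]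
  have hyC : y ∈ C := by
    rw [hC, NonUnitalStarSubalgebra.mem_centralizer_iff]
    rintro g (rfl | rfl)
    · simp [hx.star_eq, h.eq]
    · simp [hy.star_eq]
  have hS : ∀ a ∈ NonUnitalStarSubalgebra.centralizer ℂ (C : Set A), a ∈ C := by
    intro a ha
    rw [NonUnitalStarSubalgebra.mem_centralizer_iff] at ha
    rw [hC, NonUnitalStarSubalgebra.mem_centralizer_iff]
    rintro g (rfl | rfl)
    · exact ha _ hxC
    · exact ha _ hyC
  refine ⟨NonUnitalStarSubalgebra.centralizer ℂ (C : Set A), ?_, ?_, ?_, ?_⟩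
  · rw [NonUnitalStarSubalgebra.coe_centralizer]
    exact Set.isClosed_centralizer _
  · intro a ha b hb
    rw [NonUnitalStarSubalgebra.mem_centralizer_iff] at hb
    exact (hb a (hS a ha)).1
  · rw [NonUnitalStarSubalgebra.mem_centralizer_iff]
    intro g hg
    rw [hC, SetLike.mem_coe, NonUnitalStarSubalgebra.mem_centralizer_iff] at hg
    have := hg x (by simp)
    refine ⟨this.1.symm, ?_⟩
    have h2 := congrArg star this.1
    simpa [hx.star_eq] using h2
  · rw [NonUnitalStarSubalgebra.mem_centralizer_iff]
    intro g hg
    rw [hC, SetLike.mem_coe, NonUnitalStarSubalgebra.mem_centralizer_iff] at hg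
    have := hg y (by simp)
    refine ⟨this.1.symm, ?_⟩
    have h2 := congrArg star this.1
    simpa [hy.star_eq] using h2

lemma IsQuasitrace.add_of_commute {τ : A → ℂ} (hτ : IsQuasitrace τ) {x y : A}
    (hx : IsSelfAdjoint x) (hy : IsSelfAdjoint y) (h : Commute x y) :
    τ (x + y) = τ x + τ y := by
  obtain ⟨S, hS, hc, hxS, hyS⟩ := exists_commutative_subalgebra hx hy h
  exact hτ.map_add_of_comm S hS hc x hxS y hyS

lemma IsQuasitrace.smul_of_isSelfAdjoint {τ : A → ℂ} (hτ : IsQuasitrace τ) (c : ℂ) {x : A}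
    (hx : IsSelfAdjoint x) : τ (c • x) = c * τ x := by
  obtain ⟨S, hS, hc, hxS, -⟩ := exists_commutative_subalgebra hx hx (Commute.refl x)
  exact hτ.map_smul_of_comm S hS hc c x hxS

variable [PartialOrder A] [StarOrderedRing A]

lemma IsQuasitrace.nonneg_of_nonneg {τ : A → ℂ} (hτ : IsQuasitrace τ) {x : A} (hx : 0 ≤ x) :
    0 ≤ τ x := by
  obtain ⟨b, rfl⟩ := CStarAlgebra.nonneg_iff_eq_star_mul_self.mp hx
  exact hτ.nonneg b

lemma IsQuasitrace.isRealQuasitrace {τ : A → ℂ} (hτ : IsQuasitrace τ) :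
    IsRealQuasitrace (fun x => (τ x).re) where
  add_of_commute x y hx hy h := by simp [hτ.add_of_commute hx hy h]
  smul r x hx := by
    have := hτ.smul_of_isSelfAdjoint (r : ℂ) hx
    rw [Complex.coe_smul] at this
    simp [this]
  nonneg x hx := (Complex.le_def.mp (hτ.nonneg_of_nonneg hx)).1
  star_mul_comm x := by rw [hτ.star_mul_comm]

lemma IsQuasitrace.im_eq_zero {τ : A → ℂ} (hτ : IsQuasitrace τ) {x : A} (hx : IsSelfAdjoint x) :
    (τ x).im = 0 := by
  have h1 : 0 ≤ x + algebraMap ℝ A ‖x‖ := by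
    have := hx.neg_algebraMap_norm_le_self
    rwa [neg_le_iff_add_nonneg] at this
  have h2 : 0 ≤ algebraMap ℝ A ‖x‖ := algebraMap_nonneg A (norm_nonneg x)
  have h3 := hτ.add_of_commute hx (.of_nonneg h2) (Algebra.commutes _ _).symm
  have h4 := (Complex.le_def.mp (hτ.nonneg_of_nonneg h1)).2
  have h5 := (Complex.le_def.mp (hτ.nonneg_of_nonneg h2)).2
  rw [h3] at h4
  simp at h4 h5
  linarith

lemma IsQuasitrace.eq_re {τ : A → ℂ} (hτ : IsQuasitrace τ) {x : A} (hx : IsSelfAdjoint x) :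
    τ x = ((τ x).re : ℂ) := by
  apply Complex.ext <;> simp [hτ.im_eq_zero hx]

lemma IsQuasitrace.eq_realPart_add {τ : A → ℂ} (hτ : IsQuasitrace τ) (x : A) :
    τ x = ((τ (realPart x : A)).re : ℂ) + Complex.I * ((τ (imaginaryPart x : A)).re : ℂ) := by
  conv_lhs => rw [← realPart_add_I_smul_imaginaryPart x]
  rw [hτ.map_add_I_smul _ _ (realPart x).2 (imaginaryPart x).2, ← hτ.eq_re (realPart x).2,
    ← hτ.eq_re (imaginaryPart x).2]

end Basic

/-! ### Elementary consequences of additivity on commuting elements -/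

namespace IsRealQuasitrace

variable {A : Type u} [CStarAlgebra A] [PartialOrder A] [StarOrderedRing A] {t : A → ℝ}

lemma map_zero (ht : IsRealQuasitrace t) : t 0 = 0 := by
  simpa using ht.smul 0 0 (.zero A)

lemma map_neg (ht : IsRealQuasitrace t) {x : A} (hx : IsSelfAdjoint x) : t (-x) = -t x := by
  simpa using ht.smul (-1) x hx

lemma sub_of_commute (ht : IsRealQuasitrace t) {x y : A} (hx : IsSelfAdjoint x)
    (hy : IsSelfAdjoint y) (h : Commute x y) : t (x - y) = t x - t y := by
  rw [sub_eq_add_neg, ht.add_of_commute _ _ hx hy.neg h.neg_right, ht.map_neg hy, sub_eq_add_neg]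

lemma map_algebraMap (ht : IsRealQuasitrace t) (r : ℝ) : t (algebraMap ℝ A r) = r * t 1 := by
  rw [Algebra.algebraMap_eq_smul_one, ht.smul _ _ (.one A)]

lemma one_nonneg (ht : IsRealQuasitrace t) : 0 ≤ t 1 := ht.nonneg 1 zero_le_one

lemma add_algebraMap (ht : IsRealQuasitrace t) {x : A} (hx : IsSelfAdjoint x) (r : ℝ) :
    t (x + algebraMap ℝ A r) = t x + r * t 1 := by
  rw [ht.add_of_commute _ _ hx (.algebraMap A (IsSelfAdjoint.all r)) (Algebra.commutes _ _).symm,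
    ht.map_algebraMap]

lemma mono_of_commute (ht : IsRealQuasitrace t) {x y : A} (hx : IsSelfAdjoint x)
    (hy : IsSelfAdjoint y) (h : Commute x y) (hxy : x ≤ y) : t x ≤ t y := by
  have := ht.nonneg _ (sub_nonneg.mpr hxy)
  rw [ht.sub_of_commute hy hx h.symm] at this
  linarith

lemma sum_of_commute (ht : IsRealQuasitrace t) {ι : Type*} (s : Finset ι) (f : ι → A)
    (hf : ∀ i ∈ s, IsSelfAdjoint (f i)) (hc : ∀ i ∈ s, ∀ j ∈ s, Commute (f i) (f j)) :
    t (∑ i ∈ s, f i) = ∑ i ∈ s, t (f i) := by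
  classical
  induction s using Finset.induction_on with
  | empty => simp [ht.map_zero]
  | insert a s ha ih =>
    rw [Finset.sum_insert ha, Finset.sum_insert ha, ht.add_of_commute, ih]
    · exact fun i hi => hf i (Finset.mem_insert_of_mem hi)
    · exact fun i hi j hj => hc i (Finset.mem_insert_of_mem hi) j (Finset.mem_insert_of_mem hj)
    · exact hf a (Finset.mem_insert_self a s)
    · exact isSelfAdjoint_sum s fun i hi => hf i (Finset.mem_insert_of_mem hi)
    · exact Commute.sum_right _ _ _ fun i hi =>
        hc a (Finset.mem_insert_self a s) i (Finset.mem_insert_of_mem hi)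

/-- If `g` is a unit for the positive element `c` and `0 ≤ g ≤ 1`, then `t c ≤ ‖c‖ t g`. -/
lemma le_norm_mul_of_mul_eq (ht : IsRealQuasitrace t) {c g : A} (hc : 0 ≤ c) (hg : 0 ≤ g)
    (hg1 : g ≤ 1) (h : g * c = c) : t c ≤ ‖c‖ * t g := by
  have hc' := IsSelfAdjoint.of_nonneg hc
  have hg' := IsSelfAdjoint.of_nonneg hg
  have h' : c * g = c := by simpa [hc'.star_eq, hg'.star_eq] using congrArg star h
  rw [← ht.smul _ _ hg']
  have hcomm : Commute c g := h'.trans h.symm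
  refine ht.mono_of_commute hc' ((IsSelfAdjoint.all _).smul hg') (hcomm.smul_right _) ?_
  have h1 : star g * c * g ≤ ‖c‖ • (star g * g) := CStarAlgebra.star_left_conjugate_le_norm_smul
  rw [hg'.star_eq, h, h'] at h1
  refine h1.trans (smul_le_smul_of_nonneg_left ?_ (norm_nonneg c))
  have h2 : 0 ≤ g * (1 - g) :=
    Commute.mul_nonneg hg (sub_nonneg.mpr hg1) ((Commute.one_right g).sub_right (Commute.refl g))
  rw [mul_sub, mul_one] at h2
  exact sub_nonneg.mp h2

end IsRealQuasitrace

/-- Build a quasitrace from its real form. -/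
lemma IsRealQuasitrace.isQuasitrace {A : Type u} [CStarAlgebra A] [PartialOrder A]
    [StarOrderedRing A] {t : A → ℝ} (ht : IsRealQuasitrace t) {τ : A → ℂ}
    (hτ : ∀ x, τ x = (t (realPart x : A) : ℂ) + Complex.I * (t (imaginaryPart x : A) : ℂ)) :
    IsQuasitrace τ := by
  have hsa : ∀ x : A, IsSelfAdjoint x → τ x = t x := fun x hx => by
    rw [hτ, hx.imaginaryPart, hx.coe_realPart]
    simp [ht.map_zero]
  have hre : ∀ S : NonUnitalStarSubalgebra ℂ A, ∀ x ∈ S, (realPart x : A) ∈ S := by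
    intro S x hx
    rw [realPart_apply_coe, ← Complex.coe_smul]
    exact SMulMemClass.smul_mem _ (add_mem hx (star_mem hx))
  have him : ∀ S : NonUnitalStarSubalgebra ℂ A, ∀ x ∈ S, (imaginaryPart x : A) ∈ S := by
    intro S x hx
    rw [imaginaryPart_apply_coe, ← Complex.coe_smul]
    exact SMulMemClass.smul_mem (-Complex.I)
      (SMulMemClass.smul_mem _ (sub_mem hx (star_mem hx)))
  have hadd : ∀ S : NonUnitalStarSubalgebra ℂ A, IsClosed (S : Set A) →
      (∀ x ∈ S, ∀ y ∈ S, x * y = y * x) → ∀ x ∈ S, ∀ y ∈ S, τ (x + y) = τ x + τ y := by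
    intro S _ hc x hx y hy
    rw [hτ, hτ x, hτ y, map_add, map_add, AddSubgroup.coe_add, AddSubgroup.coe_add,
      ht.add_of_commute _ _ (realPart x).2 (realPart y).2 (hc _ (hre S x hx) _ (hre S y hy)),
      ht.add_of_commute _ _ (imaginaryPart x).2 (imaginaryPart y).2
        (hc _ (him S x hx) _ (him S y hy))]
    push_cast
    ring
  have hI : ∀ a b : A, IsSelfAdjoint a → IsSelfAdjoint b →
      τ (a + Complex.I • b) = τ a + Complex.I * τ b := by
    intro a b ha hb
    rw [hτ, hsa a ha, hsa b hb]
    have h1 : realPart (a + Complex.I • b) = realPart a := by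
      rw [map_add, realPart_I_smul, hb.imaginaryPart]; simp
    have h2 : imaginaryPart (a + Complex.I • b) = realPart b := by
      rw [map_add, imaginaryPart_I_smul, ha.imaginaryPart]; simp
    rw [h1, h2, ha.coe_realPart, hb.coe_realPart]
  refine ⟨fun x => ?_, fun x => ?_, hadd, ?_, hI⟩
  · rw [hsa _ (.star_mul_self x)]
    exact_mod_cast ht.nonneg _ (star_mul_self_nonneg x)
  · rw [hsa _ (.star_mul_self x), hsa _ (.mul_star_self x), ht.star_mul_comm]
  · intro S hS hc c x hx
    have hr : ∀ (r : ℝ) (y : A), IsSelfAdjoint y → τ ((r : ℂ) • y) = r * τ y := by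
      intro r y hy
      rw [Complex.coe_smul, hsa _ ((IsSelfAdjoint.all r).smul hy), hsa y hy, ht.smul r y hy]
      push_cast; rfl
    obtain ⟨a, ha⟩ : ∃ a : A, a = (realPart x : A) := ⟨_, rfl⟩
    obtain ⟨b, hb⟩ : ∃ b : A, b = (imaginaryPart x : A) := ⟨_, rfl⟩
    have haS : a ∈ S := ha ▸ hre S x hx
    have hbS : b ∈ S := hb ▸ him S x hx
    have hasa : IsSelfAdjoint a := ha ▸ (realPart x).2
    have hbsa : IsSelfAdjoint b := hb ▸ (imaginaryPart x).2
    have e1 : c • x = (((c.re : ℂ) • a + (((-c.im : ℝ)) : ℂ) • b) +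
        Complex.I • ((c.re : ℂ) • b + (c.im : ℂ) • a)) := by
      conv_lhs => rw [← realPart_add_I_smul_imaginaryPart x, ← ha, ← hb]
      conv_lhs => rw [← Complex.re_add_im c]
      simp only [smul_add, add_smul, smul_smul]
      have : (c.im : ℂ) * Complex.I * Complex.I = ((-c.im : ℝ) : ℂ) := by
        rw [mul_assoc, Complex.I_mul_I]; simp
      rw [add_mul, this, mul_comm Complex.I, mul_comm Complex.I, add_smul]
      abel
    have sa : ∀ (r : ℝ) (y : A), IsSelfAdjoint y → IsSelfAdjoint ((r : ℂ) • y) := fun r y hy => by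
      rw [Complex.coe_smul]; exact (IsSelfAdjoint.all r).smul hy
    rw [e1, hI _ _ ((sa _ _ hasa).add (sa _ _ hbsa)) ((sa _ _ hbsa).add (sa _ _ hasa)),
      hadd S hS hc _ (S.smul_mem _ haS) _ (S.smul_mem _ hbS),
      hadd S hS hc _ (S.smul_mem _ hbS) _ (S.smul_mem _ haS), hr _ _ hasa, hr _ _ hbsa,
      hr _ _ hasa, hr _ _ hbsa, hτ x, ← ha, ← hb, hsa a hasa, hsa b hbsa]
    conv_rhs => rw [← Complex.re_add_im c]
    push_cast
    linear_combination (-(c.im : ℂ) * (t b : ℂ)) * Complex.I_mul_I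

/-! ### Factorizing elements dominated by y⋆y -/

section Factorization

variable {A : Type u} [CStarAlgebra A] [PartialOrder A] [StarOrderedRing A]

lemma IsSelfAdjoint.cfc_real (f : ℝ → ℝ) (a : A) : IsSelfAdjoint (cfc f a) := cfc_predicate f a

lemma abs_le_norm_of_mem_spectrum {a : A} {s : ℝ} (hs : s ∈ spectrum ℝ a) : |s| ≤ ‖a‖ := by
  cases subsingleton_or_nontrivial A
  · simp [spectrum.of_subsingleton] at hs
  · exact spectrum.norm_le_norm_of_mem hs

lemma cfc_mul_self_mul_cfc {w : A} (hw : IsSelfAdjoint w) {g : ℝ → ℝ} (hg : Continuous g) :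
    cfc g w * w * cfc g w = cfc (fun s => g s * s * g s) w := by
  rw [cfc_mul (fun s => g s * s) g w (by fun_prop) (by fun_prop),
    cfc_mul g (fun s => s) w (by fun_prop) (by fun_prop), cfc_id' ℝ w]

/-- By the C⋆-identity both `(v√c)⋆(v√c)` and `(v√c)(v√c)⋆ = vcv` have the same norm, and in the
second form `c` can be replaced by `w`. This turns estimates involving `c` into functional calculus
of `w` alone. -/
lemma norm_sqrt_mul_sq_mul_sqrt_le {c w v : A} (hc : 0 ≤ c) (hcw : c ≤ w)
    (hv : IsSelfAdjoint v) :
    ‖CFC.sqrt c * (v * v) * CFC.sqrt c‖ ≤ ‖v * w * v‖ := by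
  have hs : IsSelfAdjoint (CFC.sqrt c) := .of_nonneg (CFC.sqrt_nonneg c)
  have h1 : CFC.sqrt c * (v * v) * CFC.sqrt c = star (v * CFC.sqrt c) * (v * CFC.sqrt c) := by
    rw [star_mul, hs.star_eq, hv.star_eq]; simp only [mul_assoc]
  have h2 : (v * CFC.sqrt c) * star (v * CFC.sqrt c) = v * c * v := by
    rw [star_mul, hs.star_eq, hv.star_eq]
    calc _ = v * (CFC.sqrt c * CFC.sqrt c) * v := by simp only [mul_assoc]
      _ = _ := by rw [CFC.sqrt_mul_sqrt_self c hc]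
  rw [h1, CStarRing.norm_star_mul_self, ← CStarRing.norm_self_mul_star, h2]
  have h3 := star_left_conjugate_le_conjugate hcw v
  have h4 := star_left_conjugate_nonneg hc v
  rw [hv.star_eq] at h3 h4
  exact CStarAlgebra.norm_le_norm_of_nonneg_of_le h4 h3

lemma continuous_inv_sqrt_max_add {ε : ℝ} (hε : 0 < ε) :
    Continuous fun s : ℝ => (√(max s 0 + ε))⁻¹ := by
  refine Continuous.inv₀ (by fun_prop) fun s => ?_
  have : 0 < max s 0 + ε := by positivity
  positivity

lemma abs_mul_inv_sqrt_sub_sqrt_le {s ε : ℝ} (hs : 0 ≤ s) (hε : 0 < ε) :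
    |s * (√(max s 0 + ε))⁻¹ - √s| ≤ √ε := by
  rw [max_eq_left hs]
  have h1 : 0 < √(s + ε) := Real.sqrt_pos.mpr (by positivity)
  have h2 : √s ≤ √(s + ε) := Real.sqrt_le_sqrt (by linarith)
  have h3 : √(s + ε) ≤ √s + √ε := by
    rw [Real.sqrt_le_left (by positivity)]
    nlinarith [Real.sq_sqrt hs, Real.sq_sqrt hε.le, mul_nonneg (Real.sqrt_nonneg s) (Real.sqrt_nonneg ε)]
  have h0 := Real.sqrt_nonneg s
  have h4 : s * (√(s + ε))⁻¹ = √s * (√s / √(s + ε)) := by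
    rw [div_eq_mul_inv, ← mul_assoc, Real.mul_self_sqrt hs]
  have h5 : √s / √(s + ε) ≤ 1 := (div_le_one h1).mpr h2
  have h6 : √s - √s * (√s / √(s + ε)) = (√s / √(s + ε)) * (√(s + ε) - √s) := by
    field_simp
  have h7 : 0 ≤ √s / √(s + ε) := by positivity
  rw [h4, abs_sub_comm, h6, abs_of_nonneg (mul_nonneg h7 (by linarith))]
  calc _ ≤ 1 * (√(s + ε) - √s) := mul_le_mul_of_nonneg_right h5 (by linarith)
    _ ≤ √ε := by linarith

/-- If `0 ≤ c ≤ y⋆y`, then `c = x⋆x` for some `x` in the closure of `yA`. -/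
lemma exists_star_mul_self_eq_of_le {c y : A} (hc : 0 ≤ c) (hcy : c ≤ star y * y) :
    ∃ x : A, star x * x = c ∧ ∀ g : A, g * y = y → g * x = x := by
  set w := star y * y with hw
  have hw0 : 0 ≤ w := star_mul_self_nonneg y
  have hwsa : IsSelfAdjoint w := .of_nonneg hw0
  have hspec : ∀ s ∈ spectrum ℝ w, 0 ≤ s := fun s hs => spectrum_nonneg_of_nonneg hw0 hs
  have hs : IsSelfAdjoint (CFC.sqrt c) := .of_nonneg (CFC.sqrt_nonneg c)
  let e : ℕ → ℝ := fun n => 1 / ((n : ℝ) + 1)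
  have he : ∀ n, 0 < e n := fun n => Nat.one_div_pos_of_nat
  have hlim : Tendsto e atTop (𝓝 0) := tendsto_one_div_add_atTop_nhds_zero_nat
  let ρ : ℕ → ℝ → ℝ := fun n s => (√(max s 0 + e n))⁻¹
  have hρ : ∀ n, Continuous (ρ n) := fun n => continuous_inv_sqrt_max_add (he n)
  -- A regularization of `y w^(-1/2) c^(1/2)`, with `(w + e n)^(-1/2)` replacing the singular
  -- factor. The sequence is Cauchy because `s * ρ n s` is within `√(e n)` of `√s`.
  let X : ℕ → A := fun n => y * cfc (ρ n) w * CFC.sqrt c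
  have hcauchy : ∀ n m, ‖X n - X m‖ ≤ √(e n) + √(e m) := by
    intro n m
    have hr : IsSelfAdjoint (cfc (ρ n) w - cfc (ρ m) w) :=
      (IsSelfAdjoint.cfc_real _ _).sub (IsSelfAdjoint.cfc_real _ _)
    let v := cfc (fun s => (ρ n s - ρ m s) * √s) w
    have hvv : (cfc (ρ n) w - cfc (ρ m) w) * w * (cfc (ρ n) w - cfc (ρ m) w) = v * v := by
      rw [← cfc_sub (ρ n) (ρ m) w (hρ n).continuousOn (hρ m).continuousOn]
      have c1 : Continuous (fun s => (ρ n s - ρ m s) * √s) :=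
        ((hρ n).sub (hρ m)).mul Real.continuous_sqrt
      rw [cfc_mul_self_mul_cfc hwsa (g := fun s => ρ n s - ρ m s) ((hρ n).sub (hρ m)),
        ← cfc_mul _ _ w c1.continuousOn c1.continuousOn]
      refine cfc_congr fun s h => ?_
      have := Real.mul_self_sqrt (hspec s h)
      linear_combination (-(ρ n s - ρ m s) ^ 2) * this
    have h1 : star (X n - X m) * (X n - X m) = CFC.sqrt c * (v * v) * CFC.sqrt c := by
      have : X n - X m = y * (cfc (ρ n) w - cfc (ρ m) w) * CFC.sqrt c := by
        simp only [X]; noncomm_ring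
      rw [this, ← hvv, star_mul, star_mul, hs.star_eq, hr.star_eq]
      simp only [mul_assoc]
      rw [← mul_assoc (star y), ← hw]
    have h2 := norm_sqrt_mul_sq_mul_sqrt_le hc hcy
      (IsSelfAdjoint.cfc_real (fun s => (ρ n s - ρ m s) * √s) w)
    have h3 : ‖v * w * v‖ ≤ (√(e n) + √(e m)) ^ 2 := by
      have c1 : Continuous (fun s => (ρ n s - ρ m s) * √s) :=
        ((hρ n).sub (hρ m)).mul Real.continuous_sqrt
      rw [cfc_mul_self_mul_cfc hwsa c1]
      refine norm_cfc_le (by positivity) fun s h => ?_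
      have hs0 := hspec s h
      have e1 : (ρ n s - ρ m s) * √s * s * ((ρ n s - ρ m s) * √s) =
          ((s * ρ n s - √s) - (s * ρ m s - √s)) ^ 2 := by
        linear_combination ((ρ n s - ρ m s) ^ 2 * s) * Real.mul_self_sqrt hs0
      rw [e1, norm_pow, Real.norm_eq_abs]
      refine pow_le_pow_left₀ (abs_nonneg _) ((abs_sub _ _).trans ?_) 2
      exact add_le_add (abs_mul_inv_sqrt_sub_sqrt_le hs0 (he n))
        (abs_mul_inv_sqrt_sub_sqrt_le hs0 (he m))
    have h4 : ‖X n - X m‖ * ‖X n - X m‖ ≤ (√(e n) + √(e m)) ^ 2 := by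
      rw [← CStarRing.norm_star_mul_self, h1]
      exact h2.trans h3
    exact abs_le_of_sq_le_sq' (by nlinarith) (by positivity) |>.2
  have hlim2 : Tendsto (fun n => √(e n)) atTop (𝓝 0) := by
    simpa [Function.comp_def] using (Real.continuous_sqrt.tendsto 0).comp hlim
  have hC : CauchySeq X := by
    rw [cauchySeq_iff_tendsto_dist_atTop_0]
    refine squeeze_zero (fun _ => dist_nonneg)
      (fun p => (dist_eq_norm _ _).le.trans (hcauchy p.1 p.2)) ?_
    rw [← prod_atTop_atTop_eq]
    simpa using (hlim2.comp tendsto_fst).add (hlim2.comp tendsto_snd)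
  obtain ⟨x, hx⟩ := cauchySeq_tendsto_of_complete hC
  refine ⟨x, ?_, fun g hg => ?_⟩
  · have l1 : Tendsto (fun n => star (X n) * X n) atTop (𝓝 (star x * x)) :=
      hx.star.mul hx
    refine tendsto_nhds_unique l1 (tendsto_iff_norm_sub_tendsto_zero.mpr ?_)
    refine squeeze_zero (fun _ => norm_nonneg _) (fun n => ?_) hlim
    let u := cfc (fun s => √(e n) * ρ n s) w
    have hu : Continuous (fun s => √(e n) * ρ n s) := (hρ n).const_mul _
    -- Here `u²` is `e n * (w + e n)⁻¹`, so trading `c` for `w` bounds the defect by the supremum of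
    -- `e n * s / (s + e n)`, which is at most `e n`.
    have key : CFC.sqrt c * (u * u) * CFC.sqrt c = c - star (X n) * X n := by
      have e1 : u * u = 1 - cfc (ρ n) w * w * cfc (ρ n) w := by
        have hρ2 : Continuous fun s => ρ n s * s * ρ n s := ((hρ n).mul continuous_id).mul (hρ n)
        rw [cfc_mul_self_mul_cfc hwsa (hρ n), ← cfc_one ℝ w,
          ← cfc_mul _ _ w hu.continuousOn hu.continuousOn,
          ← cfc_sub _ _ w (by fun_prop) hρ2.continuousOn]
        refine cfc_congr fun s h => ?_
        have hs0 := hspec s h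
        have p : 0 < max s 0 + e n := by have := he n; positivity
        have q : ρ n s * ρ n s * (s + e n) = 1 := by
          simp only [ρ]
          rw [← mul_inv, Real.mul_self_sqrt p.le, max_eq_left hs0]
          rw [max_eq_left hs0] at p
          exact inv_mul_cancel₀ p.ne'
        simp only [Pi.one_apply]
        linear_combination (ρ n s) ^ 2 * Real.mul_self_sqrt (he n).le + q
      rw [e1, mul_sub, sub_mul, mul_one, CFC.sqrt_mul_sqrt_self c hc]
      congr 1
      simp only [X]
      rw [star_mul, star_mul, hs.star_eq, (IsSelfAdjoint.cfc_real (ρ n) w).star_eq]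
      simp only [mul_assoc]
      rw [← mul_assoc (star y), ← hw]
    rw [norm_sub_rev, ← key]
    refine (norm_sqrt_mul_sq_mul_sqrt_le hc hcy (IsSelfAdjoint.cfc_real _ _)).trans ?_
    rw [cfc_mul_self_mul_cfc hwsa hu]
    refine norm_cfc_le (he n).le fun s h => ?_
    have hs0 := hspec s h
    have p : 0 < s + e n := by have := he n; positivity
    have q : ρ n s * ρ n s = (s + e n)⁻¹ := by
      simp only [ρ]
      rw [← mul_inv, max_eq_left hs0, Real.mul_self_sqrt p.le]
    have e2 : √(e n) * ρ n s * s * (√(e n) * ρ n s) = e n * (s / (s + e n)) := by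
      rw [div_eq_mul_inv, ← q]
      linear_combination (ρ n s * ρ n s * s) * Real.mul_self_sqrt (he n).le
    have h5 : s / (s + e n) ≤ 1 := (div_le_one p).mpr (by linarith [he n])
    have h6 : 0 ≤ s / (s + e n) := by positivity
    rw [e2, Real.norm_of_nonneg (mul_nonneg (he n).le h6)]
    calc _ ≤ e n * 1 := mul_le_mul_of_nonneg_left h5 (he n).le
      _ = _ := mul_one _
  · refine tendsto_nhds_unique (hx.const_mul g) (hx.congr fun n => ?_)
    simp only [X]
    rw [← mul_assoc, ← mul_assoc, hg]

end Factorization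

/-! ### Monotonicity and Lipschitz continuity of quasitraces -/

namespace IsRealQuasitrace

variable {A : Type u} [CStarAlgebra A] [PartialOrder A] [StarOrderedRing A] {t : A → ℝ}

/-- If `0 ≤ c ≤ y⋆y`, `‖c‖ ≤ 1` and `0 ≤ g ≤ 1` is a left unit for `y`, then `t c ≤ t g`. -/
lemma le_of_le_star_mul_self (ht : IsRealQuasitrace t) {c y g : A} (hc : 0 ≤ c) (hc1 : ‖c‖ ≤ 1)
    (hcy : c ≤ star y * y) (hg : 0 ≤ g) (hg1 : g ≤ 1) (hgy : g * y = y) : t c ≤ t g := by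
  obtain ⟨x, rfl, hx⟩ := exists_star_mul_self_eq_of_le hc hcy
  rw [ht.star_mul_comm]
  have h1 : g * (x * star x) = x * star x := by rw [← mul_assoc, hx g hgy]
  refine (ht.le_norm_mul_of_mul_eq (mul_star_self_nonneg x) hg hg1 h1).trans ?_
  rw [CStarRing.norm_self_mul_star, ← CStarRing.norm_star_mul_self]
  exact mul_le_of_le_one_left (ht.nonneg _ hg) hc1

/-- The middle slice `f(a)`, from level k + 1 to k + 2, links the two sides. The upper slice of `a`
is at most `f(a)(a - (k+1))f(a)`, hence at most `f(a)(b - (k+1))₊f(a) = y⋆y`. The slice of `b` on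
the right equals 1 above level k + 1, so it is a left unit for `y`, and `le_of_le_star_mul_self`
applies. -/
lemma cfc_clip_le (ht : IsRealQuasitrace t) {a b : A} (ha : IsSelfAdjoint a)
    (hb : IsSelfAdjoint b) (hab : a ≤ b) (k : ℝ) :
    t (cfc (fun s : ℝ => min s (k + 3) - min s (k + 2)) a) ≤
      t (cfc (fun s : ℝ => min s (k + 1) - min s k) b) := by
  let f : ℝ → ℝ := fun s => min s (k + 2) - min s (k + 1)
  let y := cfc (fun s : ℝ => √(max (s - (k + 1)) 0)) b * cfc f a
  have hfc : Continuous f := by fun_prop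
  have hf := IsSelfAdjoint.cfc_real f a
  have hr := IsSelfAdjoint.cfc_real (fun s : ℝ => √(max (s - (k + 1)) 0)) b
  have hyy : star y * y = cfc f a * cfc (fun s : ℝ => max (s - (k + 1)) 0) b * cfc f a := by
    have : cfc (fun s : ℝ => √(max (s - (k + 1)) 0)) b *
        cfc (fun s : ℝ => √(max (s - (k + 1)) 0)) b =
        cfc (fun s : ℝ => max (s - (k + 1)) 0) b := by
      rw [← cfc_mul _ _ b (by fun_prop) (by fun_prop)]
      exact cfc_congr fun s _ => Real.mul_self_sqrt (le_max_right _ _)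
    rw [star_mul, hr.star_eq, hf.star_eq, ← this]
    simp only [y, mul_assoc]
  refine ht.le_of_le_star_mul_self (y := y) (cfc_nonneg fun s _ => ?_) (norm_cfc_le zero_le_one
    fun s _ => ?_) ?_ (cfc_nonneg fun s _ => ?_) (cfc_le_one _ _ fun s _ => ?_) ?_
  · exact sub_nonneg.mpr (min_le_min_left _ (by linarith))
  · rw [Real.norm_eq_abs, abs_le]
    constructor <;> rcases le_total s (k + 3) with h | h <;>
      rcases le_total s (k + 2) with h' | h' <;> simp [h, h'] <;> linarith
  · have h1 : cfc (fun s : ℝ => min s (k + 3) - min s (k + 2)) a ≤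
        cfc f a * (a - algebraMap ℝ A (k + 1)) * cfc f a := by
      have e1 : a - algebraMap ℝ A (k + 1) = cfc (fun s : ℝ => s - (k + 1)) a := by
        rw [cfc_sub _ _ a (by fun_prop) (by fun_prop), cfc_id' ℝ a, cfc_const (k + 1) a]
      rw [e1, ← cfc_mul _ _ a (by fun_prop) (by fun_prop),
        ← cfc_mul _ _ a (by fun_prop) (by fun_prop)]
      refine cfc_mono fun s _ => ?_
      simp only [f]
      rcases le_total s (k + 1) with h | h
      · rw [min_eq_left (by linarith), min_eq_left (by linarith : s ≤ k + 2), min_eq_left h]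
        simp
      · rcases le_total s (k + 2) with h' | h'
        · rw [min_eq_left (by linarith), min_eq_left h', min_eq_right h]
          have : 0 ≤ s - (k + 1) := by linarith
          rw [sub_self]; positivity
        · rw [min_eq_right h', min_eq_right h]
          have := min_le_left s (k + 3)
          linarith
    have h2 : b - algebraMap ℝ A (k + 1) ≤ cfc (fun s : ℝ => max (s - (k + 1)) 0) b := by
      have e1 : b - algebraMap ℝ A (k + 1) = cfc (fun s : ℝ => s - (k + 1)) b := by
        rw [cfc_sub _ _ b (by fun_prop) (by fun_prop), cfc_id' ℝ b, cfc_const (k + 1) b]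
      rw [e1]
      exact cfc_mono fun s _ => le_max_left _ _
    have h3 := star_left_conjugate_le_conjugate
      ((sub_le_sub_right hab (algebraMap ℝ A (k + 1))).trans h2) (cfc f a)
    rw [hf.star_eq] at h3
    rw [hyy]
    exact h1.trans h3
  · exact sub_nonneg.mpr (min_le_min_left _ (by linarith))
  · rcases le_total s (k + 1) with h | h <;> rcases le_total s k with h' | h' <;>
      simp [h, h'] <;> linarith
  · simp only [y]
    rw [← mul_assoc, ← cfc_mul _ _ b (by fun_prop) (by fun_prop)]
    congr 1
    refine cfc_congr fun s _ => ?_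
    rcases le_total s (k + 1) with h | h
    · have : max (s - (k + 1)) 0 = 0 := max_eq_right (by linarith)
      simp [this]
    · simp only [min_eq_right h, min_eq_right (by linarith : k ≤ s)]
      ring

lemma map_cfc_clip_le (ht : IsRealQuasitrace t) (a : A) (k : ℝ) :
    t (cfc (fun s : ℝ => min s (k + 1) - min s k) a) ≤ t 1 := by
  refine ht.mono_of_commute (IsSelfAdjoint.cfc_real _ _) (.one A) (Commute.one_right _)
    (cfc_le_one _ _ fun s _ => ?_)
  rcases le_total s (k + 1) with h | h <;> rcases le_total s k with h' | h' <;>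
      simp [h, h'] <;> linarith

lemma map_eq_sum_cfc_clip (ht : IsRealQuasitrace t) {a : A} (ha : 0 ≤ a) {m : ℕ}
    (hm : ‖a‖ ≤ m) :
    t a = ∑ k ∈ Finset.range m, t (cfc (fun s : ℝ => min s ((k : ℝ) + 1) - min s k) a) := by
  rw [← ht.sum_of_commute _ _ (fun i _ => IsSelfAdjoint.cfc_real _ _)
    (fun i _ j _ => cfc_commute_cfc _ _ _), ← cfc_sum _ _ _ (fun i _ => by fun_prop)]
  congr 1
  have hasa := IsSelfAdjoint.of_nonneg ha
  conv_lhs => rw [← cfc_id' ℝ a]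
  refine cfc_congr fun s hs => ?_
  have h0 : 0 ≤ s := spectrum_nonneg_of_nonneg ha hs
  have h1 : s ≤ m := ((le_abs_self s).trans (abs_le_norm_of_mem_spectrum hs)).trans hm
  simp only [Finset.sum_apply]
  have := Finset.sum_range_sub (fun k : ℕ => min s (k : ℝ)) m
  push_cast at this
  rw [this, min_eq_left h1, min_eq_right h0, sub_zero]

/-- Cutting `a` and `b` into unit slices, the slices of `a` from level 2 on are matched with slices
of `b` two levels lower; the two unmatched bottom slices of `a` cost at most `t 1` each. -/
lemma le_add_of_nonneg_of_le (ht : IsRealQuasitrace t) {a b : A} (ha : 0 ≤ a) (hab : a ≤ b) :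
    t a ≤ t b + 2 * t 1 := by
  obtain ⟨m, hm⟩ := exists_nat_ge (max ‖a‖ ‖b‖)
  have hma : ‖a‖ ≤ ((m + 2 : ℕ) : ℝ) := by
    push_cast; linarith [le_max_left ‖a‖ ‖b‖]
  have hb := ha.trans hab
  rw [ht.map_eq_sum_cfc_clip ha hma, ht.map_eq_sum_cfc_clip hb ((le_max_right _ _).trans hm),
    Finset.sum_range_succ', Finset.sum_range_succ', add_assoc]
  refine add_le_add (Finset.sum_le_sum fun k _ => ?_) ?_
  · have := ht.cfc_clip_le (.of_nonneg ha) (.of_nonneg hb) hab k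
    have e : ((k + 1 + 1 : ℕ) : ℝ) = (k : ℝ) + 2 := by push_cast; ring
    rw [e, show (k : ℝ) + 2 + 1 = k + 3 by ring]
    exact this
  · have h1 := ht.map_cfc_clip_le a ((0 + 1 : ℕ) : ℝ)
    have h2 := ht.map_cfc_clip_le a ((0 : ℕ) : ℝ)
    linarith

/-- Quasitraces are order preserving. -/
lemma mono (ht : IsRealQuasitrace t) {a b : A} (ha : IsSelfAdjoint a) (hb : IsSelfAdjoint b)
    (hab : a ≤ b) : t a ≤ t b := by
  have key : ∀ a b : A, 0 ≤ a → a ≤ b → t a ≤ t b := by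
    intro a b ha hab
    have hb := ha.trans hab
    -- Scaling by `n` multiplies the difference but leaves the defect `2 * t 1` unchanged.
    have h : ∀ n : ℕ, n * (t a - t b) ≤ 2 * t 1 := by
      intro n
      have := ht.le_add_of_nonneg_of_le (a := (n : ℝ) • a) (b := (n : ℝ) • b)
        (smul_nonneg n.cast_nonneg ha) (smul_le_smul_of_nonneg_left hab n.cast_nonneg)
      rw [ht.smul _ _ (.of_nonneg ha), ht.smul _ _ (.of_nonneg hb)] at this
      linarith
    by_contra! hlt
    obtain ⟨n, hn⟩ := exists_nat_gt (2 * t 1 / (t a - t b))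
    rw [div_lt_iff₀ (by linarith)] at hn
    linarith [h n]
  have h1 : 0 ≤ a + algebraMap ℝ A ‖a‖ := by
    have := ha.neg_algebraMap_norm_le_self
    rwa [neg_le_iff_add_nonneg] at this
  have := key _ (b + algebraMap ℝ A ‖a‖) h1 (by gcongr)
  rw [ht.add_algebraMap ha, ht.add_algebraMap hb] at this
  linarith

lemma le_norm_mul (ht : IsRealQuasitrace t) {a : A} (ha : IsSelfAdjoint a) :
    t a ≤ ‖a‖ * t 1 := by
  rw [← ht.map_algebraMap]
  exact ht.mono ha (.algebraMap A (IsSelfAdjoint.all _)) ha.le_algebraMap_norm_self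

lemma abs_sub_le (ht : IsRealQuasitrace t) {a b : A} (ha : IsSelfAdjoint a)
    (hb : IsSelfAdjoint b) : |t a - t b| ≤ ‖a - b‖ * t 1 := by
  have key : ∀ a b : A, IsSelfAdjoint a → IsSelfAdjoint b → t a - t b ≤ ‖a - b‖ * t 1 := by
    intro a b ha hb
    have h := (ha.sub hb).le_algebraMap_norm_self
    rw [sub_le_iff_le_add'] at h
    have := ht.mono ha (hb.add (.algebraMap A (IsSelfAdjoint.all _))) h
    rw [ht.add_algebraMap hb] at this
    linarith
  rw [abs_sub_le_iff]
  exact ⟨key a b ha hb, by rw [norm_sub_rev]; exact key b a hb ha⟩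

lemma abs_le (ht : IsRealQuasitrace t) {a : A} (ha : IsSelfAdjoint a) : |t a| ≤ ‖a‖ * t 1 := by
  simpa [ht.map_zero] using ht.abs_sub_le ha (.zero A)

end IsRealQuasitrace

lemma exists_eq_star_mul_self_of_nonneg {A : Type u} [CStarAlgebra A] [PartialOrder A]
    [StarOrderedRing A] {x : A} (hx : 0 ≤ x) : ∃ b : A, x = star b * b :=
  CStarAlgebra.nonneg_iff_eq_star_mul_self.mp hx

lemma exists_isSelfAdjoint_mul_self_eq {A : Type u} [CStarAlgebra A] [PartialOrder A]
    [StarOrderedRing A] {x : A} (hx : 0 ≤ x) : ∃ b : A, star b = b ∧ b * b = x :=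
  ⟨CFC.sqrt x, (IsSelfAdjoint.of_nonneg (CFC.sqrt_nonneg x)).star_eq, CFC.sqrt_mul_sqrt_self x hx⟩

/-! ### Quasitraces on 2 × 2 matrices and Haagerup's inequality -/

section TwoByTwo

variable {A : Type u} [CStarAlgebra A]

/-- The `2 × 2` matrix with rows `(a, b)` and `(c, d)`. -/
def mat2 (a b c d : A) : CStarMatrix (Fin 2) (Fin 2) A := CStarMatrix.ofMatrix !![a, b; c, d]

lemma mat2_ext {M N : CStarMatrix (Fin 2) (Fin 2) A} (h00 : M 0 0 = N 0 0) (h01 : M 0 1 = N 0 1)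
    (h10 : M 1 0 = N 1 0) (h11 : M 1 1 = N 1 1) : M = N := by
  ext i j
  fin_cases i <;> fin_cases j <;> assumption

lemma mat2_apply00 (a b c d : A) : mat2 a b c d 0 0 = a := rfl
lemma mat2_apply11 (a b c d : A) : mat2 a b c d 1 1 = d := rfl

lemma eq_mat2 (M : CStarMatrix (Fin 2) (Fin 2) A) : M = mat2 (M 0 0) (M 0 1) (M 1 0) (M 1 1) :=
  mat2_ext rfl rfl rfl rfl

lemma ofMatrix_single_eq_mat2 (x : A) :
    CStarMatrix.ofMatrix (Matrix.single (0 : Fin 2) (0 : Fin 2) x) = mat2 x 0 0 0 :=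
  mat2_ext (by simp [mat2]) (by simp [mat2]) (by simp [mat2]) (by simp [mat2])

lemma mat2_mul (a b c d a' b' c' d' : A) : mat2 a b c d * mat2 a' b' c' d' =
    mat2 (a * a' + b * c') (a * b' + b * d') (c * a' + d * c') (c * b' + d * d') := by
  apply mat2_ext <;> simp [mat2, CStarMatrix.mul_apply, Fin.sum_univ_two]

lemma mat2_add (a b c d a' b' c' d' : A) : mat2 a b c d + mat2 a' b' c' d' =
    mat2 (a + a') (b + b') (c + c') (d + d') := by
  apply mat2_ext <;> simp [mat2]

lemma mat2_sub (a b c d a' b' c' d' : A) : mat2 a b c d - mat2 a' b' c' d' =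
    mat2 (a - a') (b - b') (c - c') (d - d') := by
  apply mat2_ext <;> simp [mat2]

lemma mat2_star (a b c d : A) : star (mat2 a b c d) = mat2 (star a) (star c) (star b) (star d) := by
  apply mat2_ext <;> simp [mat2, CStarMatrix.star_apply]

variable [PartialOrder A] [StarOrderedRing A]

lemma mat2_diag_nonneg {a d : A} (ha : 0 ≤ a) (hd : 0 ≤ d) : 0 ≤ mat2 a 0 0 d := by
  obtain ⟨x, rfl⟩ := CStarAlgebra.nonneg_iff_eq_star_mul_self.mp ha
  obtain ⟨y, rfl⟩ := CStarAlgebra.nonneg_iff_eq_star_mul_self.mp hd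
  have : mat2 (star x * x) 0 0 (star y * y) = star (mat2 x 0 0 y) * mat2 x 0 0 y := by
    simp [mat2_star, mat2_mul]
  rw [this]
  exact star_mul_self_nonneg _

lemma apply_zero_zero_nonneg {M : CStarMatrix (Fin 2) (Fin 2) A} (hM : 0 ≤ M) : 0 ≤ M 0 0 := by
  obtain ⟨X, rfl⟩ := exists_eq_star_mul_self_of_nonneg hM
  rw [CStarMatrix.mul_apply, Fin.sum_univ_two]
  exact add_nonneg (star_mul_self_nonneg (X 0 0)) (star_mul_self_nonneg (X 1 0))

lemma apply_one_one_nonneg {M : CStarMatrix (Fin 2) (Fin 2) A} (hM : 0 ≤ M) : 0 ≤ M 1 1 := by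
  obtain ⟨X, rfl⟩ := exists_eq_star_mul_self_of_nonneg hM
  rw [CStarMatrix.mul_apply, Fin.sum_univ_two]
  exact add_nonneg (star_mul_self_nonneg (X 0 1)) (star_mul_self_nonneg (X 1 1))

namespace IsRealQuasitrace

variable {t : A → ℝ} {t₂ : CStarMatrix (Fin 2) (Fin 2) A → ℝ}

/-- An off-diagonal factorization of `b = y⋆y` moves it to `yy⋆` in the upper corner; a second
exchange there restores `y⋆y`. -/
lemma mat2_lower (ht₂ : IsRealQuasitrace t₂) (h : ∀ x, t₂ (mat2 x 0 0 0) = t x) {b : A}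
    (hb : 0 ≤ b) : t₂ (mat2 0 0 0 b) = t b := by
  obtain ⟨y, rfl⟩ := CStarAlgebra.nonneg_iff_eq_star_mul_self.mp hb
  have h1 : mat2 0 0 0 (star y * y) = star (mat2 0 0 0 y) * mat2 0 0 0 y := by
    simp [mat2_star, mat2_mul]
  have h2 : mat2 0 0 0 (star y * y) = star (mat2 0 y 0 0) * mat2 0 y 0 0 := by
    simp [mat2_star, mat2_mul]
  have h3 : mat2 0 y 0 0 * star (mat2 0 y 0 0) = star (mat2 (star y) 0 0 0) * mat2 (star y) 0 0 0 := by
    simp [mat2_star, mat2_mul]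
  have h4 : mat2 (star y) 0 0 0 * star (mat2 (star y) 0 0 0) = mat2 (star y * y) 0 0 0 := by
    simp [mat2_star, mat2_mul]
  rw [h2, ht₂.star_mul_comm, h3, ht₂.star_mul_comm, h4, h]

lemma mat2_diag (ht₂ : IsRealQuasitrace t₂) (h : ∀ x, t₂ (mat2 x 0 0 0) = t x) {a b : A}
    (ha : 0 ≤ a) (hb : 0 ≤ b) : t₂ (mat2 a 0 0 b) = t a + t b := by
  have h1 : mat2 a 0 0 b = mat2 a 0 0 0 + mat2 0 0 0 b := by simp [mat2_add]
  rw [h1, ht₂.add_of_commute _ _ (.of_nonneg (mat2_diag_nonneg ha le_rfl))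
    (.of_nonneg (mat2_diag_nonneg le_rfl hb)) (by simp [Commute, SemiconjBy, mat2_mul]), h,
    ht₂.mat2_lower h hb]

/-- Haagerup's inequality for 2-quasitraces. -/
lemma add_le_of_extension (ht : IsRealQuasitrace t) (ht₂ : IsRealQuasitrace t₂)
    (h : ∀ x, t₂ (mat2 x 0 0 0) = t x) {a b : A} (ha : 0 ≤ a) (hb : 0 ≤ b) {s : ℝ}
    (hs : 0 < s) : t (a + b) ≤ (1 + s) * t a + (1 + s⁻¹) * t b := by
  set p := CFC.sqrt a with hp
  set q := CFC.sqrt b with hq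
  have hp' : star p = p := (IsSelfAdjoint.of_nonneg (CFC.sqrt_nonneg a)).star_eq
  have hq' : star q = q := (IsSelfAdjoint.of_nonneg (CFC.sqrt_nonneg b)).star_eq
  have hpp : p * p = a := CFC.sqrt_mul_sqrt_self a ha
  have hqq : q * q = b := CFC.sqrt_mul_sqrt_self b hb
  -- For the column with entries `√a`, `√b`, the product `x⋆x` is `a + b` in the corner, whereas
  -- `xx⋆` has diagonal `a`, `b`.
  set x := mat2 p 0 q 0
  have h1 : star x * x = mat2 (a + b) 0 0 0 := by
    simp [x, mat2_star, mat2_mul, hp', hq', hpp, hqq]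
  have h2 : x * star x = mat2 a (p * q) (q * p) b := by
    simp [x, mat2_star, mat2_mul, hp', hq', hpp, hqq]
  have ha1 : 0 ≤ (1 + s) • a := smul_nonneg (by positivity) ha
  have hb1 : 0 ≤ (1 + s⁻¹) • b := smul_nonneg (by positivity) hb
  have h3 : x * star x ≤ mat2 ((1 + s) • a) 0 0 ((1 + s⁻¹) • b) := by
    rw [← sub_nonneg]
    set r := √s
    have hr : r * r = s := Real.mul_self_sqrt hs.le
    have hr0 : r ≠ 0 := (Real.sqrt_pos.mpr hs).ne'
    -- The weights `√s` and `-1/√s` have product -1, so `zz⋆` cancels the off-diagonal entries and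
    -- leaves the factors `1 + s` and `1 + s⁻¹`.
    set z := mat2 (r • p) 0 (-(r⁻¹ • q)) 0
    have : mat2 ((1 + s) • a) 0 0 ((1 + s⁻¹) • b) - x * star x = z * star z := by
      simp [h2, z, mat2_star, mat2_mul, mat2_sub, hp', hq', hr0, hpp, hqq, add_smul]
      rw [smul_smul, smul_smul, ← mul_inv, hr]
    rw [this]
    exact mul_star_self_nonneg z
  rw [← h, ← h1, ht₂.star_mul_comm]
  refine (ht₂.mono (.mul_star_self x) (.of_nonneg (mat2_diag_nonneg ha1 hb1)) h3).trans ?_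
  rw [ht₂.mat2_diag h ha1 hb1, ht.smul _ _ (.of_nonneg ha), ht.smul _ _ (.of_nonneg hb)]

/-- With `M = R²`, the corner `pMp` is `(Rp)⋆(Rp)`, and the exchanged product `RpR` is at most `R² =
M`. -/
lemma apply_zero_zero_le (ht₂ : IsRealQuasitrace t₂) (h : ∀ x, t₂ (mat2 x 0 0 0) = t x)
    {M : CStarMatrix (Fin 2) (Fin 2) A} (hM : 0 ≤ M) : t (M 0 0) ≤ t₂ M := by
  set p : CStarMatrix (Fin 2) (Fin 2) A := mat2 1 0 0 0
  obtain ⟨R, hR, hRR⟩ := exists_isSelfAdjoint_mul_self_eq hM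
  have hp : star p = p := by simp [p, mat2_star]
  have hpp : p * p = p := by simp [p, mat2_mul]
  have h1 : star (R * p) * (R * p) = mat2 (M 0 0) 0 0 0 := by
    rw [star_mul, hp, hR, show p * R * (R * p) = p * (R * R) * p by simp only [mul_assoc], hRR]
    rw [eq_mat2 M]
    simp [p, mat2_mul, mat2_apply00]
  have hp1 : p ≤ 1 := by
    rw [← sub_nonneg]
    have : (1 : CStarMatrix (Fin 2) (Fin 2) A) - p = mat2 0 0 0 1 := by
      have h1 : (1 : CStarMatrix (Fin 2) (Fin 2) A) = mat2 1 0 0 1 :=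
        mat2_ext (by simp [mat2]) (by simp [mat2]) (by simp [mat2]) (by simp [mat2])
      rw [h1]
      simp [p, mat2_sub]
    rw [this]
    exact mat2_diag_nonneg le_rfl zero_le_one
  have h2 : (R * p) * star (R * p) ≤ M := by
    rw [star_mul, hp, hR, show R * p * (p * R) = R * (p * p) * R by simp only [mul_assoc], hpp]
    have := star_left_conjugate_le_conjugate hp1 R
    rwa [hR, mul_one, hRR] at this
  rw [← h, ← h1, ht₂.star_mul_comm]
  exact ht₂.mono (.mul_star_self _) (.of_nonneg hM) h2

/-- The flip unitary `v` exchanges the two corners, and `t₂` is unchanged under conjugation by `v`.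
-/
lemma apply_one_one_le (ht₂ : IsRealQuasitrace t₂) (h : ∀ x, t₂ (mat2 x 0 0 0) = t x)
    {M : CStarMatrix (Fin 2) (Fin 2) A} (hM : 0 ≤ M) : t (M 1 1) ≤ t₂ M := by
  obtain ⟨X, rfl⟩ := exists_eq_star_mul_self_of_nonneg hM
  set v : CStarMatrix (Fin 2) (Fin 2) A := mat2 0 1 1 0
  have hv : star v = v := by simp [v, mat2_star]
  have hvv : v * v = 1 := by
    have h1 : (1 : CStarMatrix (Fin 2) (Fin 2) A) = mat2 1 0 0 1 :=
        mat2_ext (by simp [mat2]) (by simp [mat2]) (by simp [mat2]) (by simp [mat2])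
    rw [h1]
    simp [v, mat2_mul]
  have h1 := ht₂.apply_zero_zero_le h (star_mul_self_nonneg (X * v))
  have h2 : (star (X * v) * (X * v)) 0 0 = (star X * X) 1 1 := by
    rw [star_mul, hv, show v * star X * (X * v) = v * (star X * X) * v by simp only [mul_assoc],
      eq_mat2 (star X * X)]
    simp [v, mat2_mul, mat2_apply00, mat2_apply11]
  rw [h2, ht₂.star_mul_comm, star_mul, hv,
    show X * v * (v * star X) = X * (v * v) * star X by simp only [mul_assoc], hvv, mul_one,
    ← ht₂.star_mul_comm] at h1
  exact h1

/-- A quasitrace on `M₂(A)` is subadditive on positive elements up to the constant `8`. -/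
lemma extension_add_le (ht : IsRealQuasitrace t) (ht₂ : IsRealQuasitrace t₂)
    (h : ∀ x, t₂ (mat2 x 0 0 0) = t x) {M N : CStarMatrix (Fin 2) (Fin 2) A}
    (hM : 0 ≤ M) (hN : 0 ≤ N) : t₂ (M + N) ≤ 8 * (t₂ M + t₂ N) := by
  have hMN := add_nonneg hM hN
  set P := M + N
  have h00 := apply_zero_zero_nonneg hMN
  have h11 := apply_one_one_nonneg hMN
  -- Twice the diagonal of `P` is `P + vPv` with `v = diag(1, -1)`. The constant 8 is this factor 2,
  -- times 2 from Haagerup's inequality at `s = 1`, times 2 for the two corners.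
  have h1 : P ≤ mat2 (P 0 0) 0 0 (P 1 1) + mat2 (P 0 0) 0 0 (P 1 1) := by
    rw [← sub_nonneg]
    set v : CStarMatrix (Fin 2) (Fin 2) A := mat2 1 0 0 (-1)
    have : mat2 (P 0 0) 0 0 (P 1 1) + mat2 (P 0 0) 0 0 (P 1 1) - P = star v * P * v := by
      conv_lhs => enter [2]; rw [eq_mat2 P]
      conv_rhs => rw [eq_mat2 P]
      simp [v, mat2_star, mat2_mul, mat2_sub, mat2_add]
    rw [this]
    exact star_left_conjugate_nonneg hMN v
  have hd := mat2_diag_nonneg h00 h11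
  have h2 := ht₂.mono (.of_nonneg hMN) (.of_nonneg (add_nonneg hd hd)) h1
  rw [ht₂.add_of_commute _ _ (.of_nonneg hd) (.of_nonneg hd) (Commute.refl _), ht₂.mat2_diag h h00 h11] at h2
  have e0 : P 0 0 = M 0 0 + N 0 0 := rfl
  have e1 : P 1 1 = M 1 1 + N 1 1 := rfl
  have h3 := ht.add_le_of_extension ht₂ h (apply_zero_zero_nonneg hM) (apply_zero_zero_nonneg hN)
    one_pos
  have h4 := ht.add_le_of_extension ht₂ h (apply_one_one_nonneg hM) (apply_one_one_nonneg hN)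
    one_pos
  rw [e0, e1] at h2
  have h5 := ht₂.apply_zero_zero_le h hM
  have h6 := ht₂.apply_zero_zero_le h hN
  have h7 := ht₂.apply_one_one_le h hM
  have h8 := ht₂.apply_one_one_le h hN
  rw [inv_one] at h3 h4
  linarith

end IsRealQuasitrace

lemma IsTwoQuasitrace.exists_extension {τ : A → ℂ} (hτ : IsTwoQuasitrace τ) :
    ∃ t₂ : CStarMatrix (Fin 2) (Fin 2) A → ℝ, IsRealQuasitrace t₂ ∧
      ∀ x, t₂ (mat2 x 0 0 0) = (τ x).re := by
  obtain ⟨-, τ₂, hτ₂, h⟩ := hτ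
  refine ⟨fun x => (τ₂ x).re, hτ₂.isRealQuasitrace, fun x => ?_⟩
  rw [← h x, ofMatrix_single_eq_mat2]

end TwoByTwo

/-! ### Functionals that are additive on singly generated subalgebras -/

/-- A monotone functional on the self-adjoint part which is additive on singly generated commutative
subalgebras and subadditive on positive elements up to the constant `K`. -/
structure IsLocalQuasitrace {A : Type u} [CStarAlgebra A] [PartialOrder A] (t : A → ℝ) (K : ℝ) :
    Prop where
  const_nonneg : 0 ≤ K
  mono : ∀ x y : A, IsSelfAdjoint x → IsSelfAdjoint y → x ≤ y → t x ≤ t y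
  smul : ∀ (r : ℝ) (x : A), IsSelfAdjoint x → t (r • x) = r * t x
  cfc_add : ∀ (f g : ℝ → ℝ) (x : A), Continuous f → Continuous g → IsSelfAdjoint x →
    t (cfc f x + cfc g x) = t (cfc f x) + t (cfc g x)
  add_le : ∀ x y : A, 0 ≤ x → 0 ≤ y → t (x + y) ≤ K * (t x + t y)

/-! ### Tent functions on [0, 1], grouped into blocks separated by gaps -/

section Tents

/-- The `k`-th tent function of width `2 / M`. -/
noncomputable def tent (M k : ℕ) (s : ℝ) : ℝ :=
  min 1 (max 0 (M * s - k + 1)) - min 1 (max 0 (M * s - k))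

lemma continuous_tent (M k : ℕ) : Continuous (tent M k) := by unfold tent; fun_prop

lemma tent_nonneg (M k : ℕ) (s : ℝ) : 0 ≤ tent M k s :=
  sub_nonneg.mpr (min_le_min_left _ (max_le_max_left _ (by linarith)))

lemma abs_sub_lt_of_tent_ne_zero {M k : ℕ} {s : ℝ} (h : tent M k s ≠ 0) : |M * s - k| < 1 := by
  contrapose! h
  unfold tent
  rcases le_abs.mp h with h | h
  · rw [min_eq_left (le_max_of_le_right h), min_eq_left (le_max_of_le_right (by linarith)), sub_self]
  · rw [max_eq_left (by linarith), max_eq_left (by linarith), sub_self]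

lemma sum_tent {M : ℕ} {s : ℝ} (hs : s ∈ Set.Icc (0 : ℝ) 1) :
    ∑ k ∈ Finset.range (M + 1), tent M k s = 1 := by
  have h := Finset.sum_range_sub' (fun k : ℕ => min 1 (max 0 (M * s - k + 1))) (M + 1)
  have h2 : ∀ k : ℕ, (M * s - ((k + 1 : ℕ) : ℝ) + 1) = M * s - k := fun k => by push_cast; ring
  simp only [h2] at h
  unfold tent
  have h3 : (0 : ℝ) ≤ M * s := mul_nonneg M.cast_nonneg hs.1
  have h4 : (M : ℝ) * s ≤ M := mul_le_of_le_one_right M.cast_nonneg hs.2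
  rw [h, max_eq_left (by linarith : (M : ℝ) * s - M ≤ 0), min_eq_left, min_eq_right zero_le_one,
    sub_zero]
  exact le_max_of_le_right (by push_cast; linarith)

/-- The sum of the tent functions with index in the `r`-th block, the blocks being separated by the
indices congruent to `-c` modulo `m`. -/
noncomputable def tentBlock (m c r : ℕ) (s : ℝ) : ℝ :=
  ∑ k ∈ Finset.range (m ^ 2 + 1) with ¬ m ∣ k + c ∧ (k + c) / m = r, tent (m ^ 2) k s

lemma continuous_tentBlock (m c r : ℕ) : Continuous (tentBlock m c r) :=
  continuous_finsetSum _ fun _ _ => continuous_tent _ _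

lemma tentBlock_nonneg (m c r : ℕ) (s : ℝ) : 0 ≤ tentBlock m c r s :=
  Finset.sum_nonneg fun _ _ => tent_nonneg _ _ _

/-- Two tents overlap only if their indices differ by at most one. Passing from one block to the
next between consecutive indices would require `m` to divide the larger index plus `c`, and those
indices are omitted. -/
lemma tentBlock_mul_tentBlock {m c r r' : ℕ} (hr : r ≠ r') (s : ℝ) :
    tentBlock m c r s * tentBlock m c r' s = 0 := by
  have key : ∀ r r' : ℕ, r < r' → tentBlock m c r s * tentBlock m c r' s = 0 := by
    intro r r' hr
    unfold tentBlock
    rw [Finset.sum_mul_sum]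
    refine Finset.sum_eq_zero fun k hk => Finset.sum_eq_zero fun l hl => ?_
    simp only [Finset.mem_filter] at hk hl
    by_contra h
    have h1 := abs_lt.mp (abs_sub_lt_of_tent_ne_zero (left_ne_zero_of_mul h))
    have h2 := abs_lt.mp (abs_sub_lt_of_tent_ne_zero (right_ne_zero_of_mul h))
    have h3 : ((l : ℝ)) < k + 2 := by linarith
    have h4 : l < k + 2 := by exact_mod_cast h3
    have h5 : k + c < l + c := by
      by_contra! h5
      have := Nat.div_le_div_right (c := m) h5
      omega
    have h6 : l + c = k + c + 1 := by omega
    have h7 := hl.2.1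
    have h8 := hl.2.2
    rw [h6, Nat.succ_div, if_neg (h6 ▸ h7)] at h8
    omega
  rcases hr.lt_or_gt with h | h
  · exact key r r' h
  · rw [mul_comm]; exact key r' r h

/-- The sum of the omitted tent functions. -/
noncomputable def tentGap (m c : ℕ) (s : ℝ) : ℝ :=
  ∑ k ∈ Finset.range (m ^ 2 + 1) with m ∣ k + c, tent (m ^ 2) k s

lemma continuous_tentGap (m c : ℕ) : Continuous (tentGap m c) :=
  continuous_finsetSum _ fun _ _ => continuous_tent _ _

lemma tentGap_nonneg (m c : ℕ) (s : ℝ) : 0 ≤ tentGap m c s :=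
  Finset.sum_nonneg fun _ _ => tent_nonneg _ _ _

lemma sum_tentBlock {m c : ℕ} {s : ℝ} (hs : s ∈ Set.Icc (0 : ℝ) 1) :
    ∑ r ∈ Finset.range (m ^ 2 + c + 1), tentBlock m c r s = 1 - tentGap m c s := by
  rw [eq_sub_iff_add_eq, ← sum_tent (M := m ^ 2) hs, add_comm]
  rw [← Finset.sum_filter_add_sum_filter_not (Finset.range (m ^ 2 + 1)) (fun k => m ∣ k + c)]
  congr 1
  rw [← Finset.sum_fiberwise_of_maps_to (s := {k ∈ Finset.range (m ^ 2 + 1) | ¬ m ∣ k + c})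
    (g := fun k => (k + c) / m)
    (t := Finset.range (m ^ 2 + c + 1))]
  · refine Finset.sum_congr rfl fun r _ => ?_
    unfold tentBlock
    rw [Finset.filter_filter]
  · intro k hk
    simp only [Finset.mem_filter, Finset.mem_range] at hk ⊢
    exact (Nat.div_le_self _ _).trans_lt (by have := hk.1; omega)

/-- Each index `k` is congruent to `-c` modulo `m` for exactly one `c < m`, so the gaps of the `m`
different offsets partition the tents. -/
lemma sum_tentGap {m : ℕ} (hm : 0 < m) {s : ℝ} (hs : s ∈ Set.Icc (0 : ℝ) 1) :
    ∑ c ∈ Finset.range m, tentGap m c s = 1 := by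
  rw [← sum_tent (M := m ^ 2) hs]
  unfold tentGap
  simp_rw [Finset.sum_filter]
  rw [Finset.sum_comm]
  refine Finset.sum_congr rfl fun k _ => ?_
  have h1 : k % m < m := Nat.mod_lt _ hm
  have hdm := Nat.div_add_mod k m
  by_cases h0 : k % m = 0
  · rw [Finset.sum_eq_single 0]
    · rw [if_pos (by simpa using Nat.dvd_of_mod_eq_zero h0)]
    · intro c hc hc0
      refine if_neg fun h => ?_
      have h2 := (Nat.dvd_add_right (Nat.dvd_of_mod_eq_zero h0)).mp h
      exact absurd (Nat.le_of_dvd (Nat.pos_of_ne_zero hc0) h2) (by simpa using hc)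
    · intro h; simp [hm] at h
  · rw [Finset.sum_eq_single (m - k % m)]
    · rw [if_pos]
      refine ⟨k / m + 1, ?_⟩
      rw [mul_add, mul_one]
      omega
    · intro c hc hc0
      refine if_neg fun h => ?_
      rw [Finset.mem_range] at hc
      have h2 : m ∣ k % m + c := by
        have := (Nat.dvd_add_right (Dvd.intro (k / m) rfl : m ∣ m * (k / m))).mp
          (by rw [← add_assoc, hdm]; exact h)
        exact this
      obtain ⟨q, hq⟩ := h2
      have hq2 : q < 2 := by
        by_contra! h3
        have := Nat.mul_le_mul_left m h3
        omega
      interval_cases q <;> omega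
    · intro h
      simp only [Finset.mem_range, not_lt] at h
      omega

/-- A point of `[0, 1]` near the support of `tentBlock m c r`. -/
noncomputable def tentPoint (m c r : ℕ) : ℝ := max 0 (min 1 (((r : ℝ) * m - c) / (m : ℝ) ^ 2))

lemma tentPoint_mem (m c r : ℕ) : tentPoint m c r ∈ Set.Icc (0 : ℝ) 1 :=
  ⟨le_max_left _ _, max_le zero_le_one (min_le_left _ _)⟩

/-- A block has fewer than `m` indices at mesh `1/m²`, and each tent reaches `1/m²` further, so on
its support `m²s` is within `m + 1 ≤ 2m` of `rm - c`. Clipping the point to [0, 1] does not increase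
the distance to `s`. -/
lemma abs_sub_mul_tentBlock_le {m c r : ℕ} (hm : 0 < m) {s : ℝ} (hs : s ∈ Set.Icc (0 : ℝ) 1) :
    |s - tentPoint m c r| * tentBlock m c r s ≤ 2 / m * tentBlock m c r s := by
  by_cases h0 : tentBlock m c r s = 0
  · simp [h0]
  refine mul_le_mul_of_nonneg_right ?_ (tentBlock_nonneg _ _ _ _)
  obtain ⟨k, hk, hk0⟩ := Finset.exists_ne_zero_of_sum_ne_zero h0
  simp only [Finset.mem_filter] at hk
  have h1 := abs_lt.mp (abs_sub_lt_of_tent_ne_zero hk0)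
  push_cast at h1
  have h2 : r * m ≤ k + c := hk.2.2 ▸ Nat.div_mul_le_self _ _
  have h3 : k + c < r * m + m := by
    have := Nat.lt_div_mul_add (a := k + c) hm
    rwa [hk.2.2] at this
  have h2' : (r : ℝ) * m ≤ k + c := by exact_mod_cast h2
  have h3' : (k : ℝ) + c < r * m + m := by exact_mod_cast h3
  have hm' : (1 : ℝ) ≤ m := by exact_mod_cast hm
  have hm0 : (0 : ℝ) < m := by linarith
  set y := ((r : ℝ) * m - c) / (m : ℝ) ^ 2 with hy
  have hy2 : (m : ℝ) ^ 2 * y = r * m - c := by rw [hy]; field_simp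
  have h4 : |s - y| ≤ 2 / m := by
    have : |(m : ℝ) ^ 2 * (s - y)| ≤ 2 * m := by
      rw [mul_sub, hy2, abs_le]
      constructor <;> linarith
    rw [abs_mul, abs_of_pos (by positivity : (0 : ℝ) < (m : ℝ) ^ 2)] at this
    rw [le_div_iff₀ hm0]
    have h5 : (m : ℝ) * (|s - y| * m) ≤ m * 2 := by linarith
    exact le_of_mul_le_mul_left h5 hm0
  have h5 : tentPoint m c r = max 0 (min 1 y) := rfl
  rw [h5]
  refine le_trans ?_ h4
  calc |s - max 0 (min 1 y)| = |max 0 (min 1 s) - max 0 (min 1 y)| := by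
        rw [min_eq_right hs.2, max_eq_right hs.1]
    _ ≤ |min 1 s - min 1 y| := by
        have := abs_max_sub_max_le_max 0 (min 1 s) 0 (min 1 y)
        simpa using this
    _ ≤ |s - y| := by
        have := abs_min_sub_min_le_max 1 s 1 y
        simpa using this

end Tents

/-! ### From local additivity to additivity on commuting pairs -/

namespace IsLocalQuasitrace

variable {A : Type u} [CStarAlgebra A] [PartialOrder A] [StarOrderedRing A] {t : A → ℝ} {K : ℝ}

lemma map_zero (ht : IsLocalQuasitrace t K) : t 0 = 0 := by
  simpa using ht.smul 0 0 (.zero A)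

lemma nonneg (ht : IsLocalQuasitrace t K) {x : A} (hx : 0 ≤ x) : 0 ≤ t x :=
  ht.map_zero ▸ ht.mono 0 x (.zero A) (.of_nonneg hx) hx

lemma sum_cfc (ht : IsLocalQuasitrace t K) {ι : Type*} (s : Finset ι) (f : ι → ℝ → ℝ)
    (hf : ∀ i, Continuous (f i)) {x : A} (hx : IsSelfAdjoint x) :
    t (∑ i ∈ s, cfc (f i) x) = ∑ i ∈ s, t (cfc (f i) x) := by
  classical
  induction s using Finset.induction_on with
  | empty => simp [ht.map_zero]
  | insert a s ha ih =>
    rw [Finset.sum_insert ha, Finset.sum_insert ha, ← ih,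
      ← _root_.cfc_sum f x s (fun i _ => (hf i).continuousOn), ht.cfc_add _ _ x (hf a) _ hx]
    exact Finset.sum_fn s f ▸ continuous_finsetSum s fun i _ => hf i

lemma add_algebraMap (ht : IsLocalQuasitrace t K) {x : A} (hx : IsSelfAdjoint x) (r : ℝ) :
    t (x + algebraMap ℝ A r) = t x + r * t 1 := by
  have := ht.cfc_add (fun s => s) (fun _ => r) x continuous_id continuous_const hx
  rw [cfc_id' ℝ x, cfc_const r x] at this
  rw [this, Algebra.algebraMap_eq_smul_one, ht.smul r 1 (.one A)]

lemma one_sub (ht : IsLocalQuasitrace t K) {x : A} (hx : IsSelfAdjoint x) :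
    t (1 - x) = t 1 - t x := by
  have h := ht.add_algebraMap hx.neg 1
  have h2 := ht.smul (-1) x hx
  rw [neg_one_smul] at h2
  rw [map_one, h2] at h
  rw [sub_eq_neg_add, h]
  ring

lemma sub_le (ht : IsLocalQuasitrace t K) {x y : A} (hx : IsSelfAdjoint x)
    (hy : IsSelfAdjoint y) {ε : ℝ} (h : ‖x - y‖ ≤ ε) : t x ≤ t y + ε * t 1 := by
  have h1 := (hx.sub hy).le_algebraMap_norm_self
  have h2 : algebraMap ℝ A ‖x - y‖ ≤ algebraMap ℝ A ε := algebraMap_mono A h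
  rw [sub_le_iff_le_add'] at h1
  rw [← ht.add_algebraMap hy]
  exact ht.mono _ _ hx (hy.add (.algebraMap A (IsSelfAdjoint.all _)))
    (h1.trans (add_le_add_right h2 y))

/-- Orthogonal positive elements are the positive and negative parts of their difference, hence
functions of a single element. -/
lemma add_of_mul_eq_zero (ht : IsLocalQuasitrace t K) {x y : A} (hx : 0 ≤ x) (hy : 0 ≤ y)
    (h : x * y = 0) : t (x + y) = t x + t y := by
  have hxy : IsSelfAdjoint (x - y) := (IsSelfAdjoint.of_nonneg hx).sub (.of_nonneg hy)
  obtain ⟨h1, h2⟩ := CFC.posPart_negPart_unique (a := x - y) rfl h hx hy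
  have e1 : x = cfc (fun s : ℝ => s⁺) (x - y) := by
    rw [← cfcₙ_eq_cfc, ← CFC.posPart_def, h1]
  have e2 : y = cfc (fun s : ℝ => s⁻) (x - y) := by
    rw [← cfcₙ_eq_cfc (f := fun s : ℝ => s⁻) (hf0 := negPart_zero), ← CFC.negPart_def, h2]
  have := ht.cfc_add (fun s => s⁺) (fun s => s⁻) (x - y) (by fun_prop) (by fun_prop) hxy
  rwa [← e1, ← e2] at this

lemma sum_of_orthogonal (ht : IsLocalQuasitrace t K) {ι : Type*} (s : Finset ι) (f : ι → A)
    (hf : ∀ i ∈ s, 0 ≤ f i) (ho : ∀ i ∈ s, ∀ j ∈ s, i ≠ j → f i * f j = 0) :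
    t (∑ i ∈ s, f i) = ∑ i ∈ s, t (f i) := by
  classical
  induction s using Finset.induction_on with
  | empty => simp [ht.map_zero]
  | insert a s ha ih =>
    rw [Finset.sum_insert ha, Finset.sum_insert ha, ht.add_of_mul_eq_zero, ih]
    · exact fun i hi => hf i (Finset.mem_insert_of_mem hi)
    · exact fun i hi j hj => ho i (Finset.mem_insert_of_mem hi) j (Finset.mem_insert_of_mem hj)
    · exact hf a (Finset.mem_insert_self a s)
    · exact Finset.sum_nonneg fun i hi => hf i (Finset.mem_insert_of_mem hi)
    · rw [Finset.mul_sum]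
      exact Finset.sum_eq_zero fun i hi => ho a (Finset.mem_insert_self a s) i
        (Finset.mem_insert_of_mem hi) (by rintro rfl; exact ha hi)

/-- Approximation of `t c` when `c` is nearly diagonal with respect to orthogonal positive elements
whose sum is large. -/
lemma abs_sub_sum_le (ht : IsLocalQuasitrace t K) {ι : Type*} (s : Finset ι) (f : ι → A)
    (hf : ∀ i ∈ s, 0 ≤ f i) (ho : ∀ i ∈ s, ∀ j ∈ s, i ≠ j → f i * f j = 0)
    (hf1 : ∑ i ∈ s, f i ≤ 1) {c : A} (hc0 : 0 ≤ c) (hc1 : c ≤ 1)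
    (hcf : ∀ i ∈ s, Commute c (f i)) (ν : ι → ℝ) (hν : ∀ i, ν i ∈ Set.Icc (0 : ℝ) 1) {ε : ℝ}
    (hε : ‖c * ∑ i ∈ s, f i - ∑ i ∈ s, ν i • f i‖ ≤ ε) :
    |t c - ∑ i ∈ s, ν i * t (f i)| ≤ ε * t 1 + t (1 - ∑ i ∈ s, f i) := by
  have hsum : ∀ μ : ι → ℝ, (∀ i, 0 ≤ μ i) →
      t (∑ i ∈ s, μ i • f i) = ∑ i ∈ s, μ i * t (f i) := by
    intro μ hμ
    rw [ht.sum_of_orthogonal s (fun i => μ i • f i) (fun i hi => smul_nonneg (hμ i) (hf i hi))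
      (fun i hi j hj hij => by simp only [smul_mul_smul_comm, ho i hi j hj hij, smul_zero])]
    exact Finset.sum_congr rfl fun i hi => ht.smul _ _ (.of_nonneg (hf i hi))
  set F := ∑ i ∈ s, f i with hF
  have hF0 : 0 ≤ F := Finset.sum_nonneg hf
  have hcF : Commute c F := Commute.sum_right _ _ _ hcf
  have hcF0 : 0 ≤ c * F := hcF.mul_nonneg hc0 hF0
  have hd0 : 0 ≤ ∑ i ∈ s, ν i • f i :=
    Finset.sum_nonneg fun i hi => smul_nonneg (hν i).1 (hf i hi)
  -- Additivity on the pair `cF`, `c(1 - F)` is not available here. The inequalities `cF ≤ c` and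
  -- `(1 - c)F ≤ 1 - c`, with monotonicity, bound `t c` from below and from above, and the two
  -- bounds differ by `t (1 - F)` up to the approximation error.
  have h1 : c * F ≤ c := by
    rw [← sub_nonneg]
    have : c - c * F = c * (1 - F) := by rw [mul_sub, mul_one]
    rw [this]
    exact Commute.mul_nonneg hc0 (sub_nonneg.mpr hf1) ((Commute.one_right c).sub_right hcF)
  have h2 : F - c * F ≤ 1 - c := by
    rw [← sub_nonneg]
    have : 1 - c - (F - c * F) = (1 - c) * (1 - F) := by noncomm_ring
    rw [this]
    exact Commute.mul_nonneg (sub_nonneg.mpr hc1) (sub_nonneg.mpr hf1)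
      ((Commute.one_right _).sub_right ((Commute.one_left F).sub_left hcF))
  have h3 := ht.mono _ _ (.of_nonneg hcF0) (.of_nonneg hc0) h1
  have h4 := ht.mono _ _ ((IsSelfAdjoint.of_nonneg hF0).sub (.of_nonneg hcF0))
    ((IsSelfAdjoint.one A).sub (.of_nonneg hc0)) h2
  rw [ht.one_sub (.of_nonneg hc0)] at h4
  have h5 := ht.sub_le (.of_nonneg hd0) (.of_nonneg hcF0) (ε := ε) (by rwa [norm_sub_rev])
  have h6 := hsum ν fun i => (hν i).1
  have h7 := hsum (fun i => 1 - ν i) fun i => sub_nonneg.mpr (hν i).2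
  have e1 : ∑ i ∈ s, (1 - ν i) • f i = F - ∑ i ∈ s, ν i • f i := by
    simp only [sub_smul, one_smul, Finset.sum_sub_distrib, hF]
  have e2 : ∑ i ∈ s, (1 - ν i) * t (f i) = t F - ∑ i ∈ s, ν i * t (f i) := by
    rw [hF, ht.sum_of_orthogonal s f hf ho]
    simp only [sub_mul, one_mul, Finset.sum_sub_distrib]
  rw [e1, e2] at h7
  have h8 := ht.sub_le (ε := ε) ((IsSelfAdjoint.of_nonneg hF0).sub (.of_nonneg hd0))
    ((IsSelfAdjoint.of_nonneg hF0).sub (.of_nonneg hcF0))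
    (by rwa [sub_sub_sub_cancel_left])
  rw [ht.one_sub (.of_nonneg hF0)]
  have h9 : 0 ≤ t 1 - t F := by
    rw [← ht.one_sub (.of_nonneg hF0)]
    exact ht.nonneg (sub_nonneg.mpr hf1)
  rw [abs_le]
  constructor <;> linarith

/-- Pigeonhole: the `m` gap elements are functions of `a` with sum 1, so one of them has at most the
average trace. -/
lemma exists_tentGap_le (ht : IsLocalQuasitrace t K) {a : A} (ha0 : 0 ≤ a) (ha1 : a ≤ 1) {m : ℕ}
    (hm : 0 < m) : ∃ c : ℕ, t (cfc (tentGap m c) a) ≤ t 1 / m := by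
  have hspec : ∀ s ∈ spectrum ℝ a, s ∈ Set.Icc (0 : ℝ) 1 := fun s hs =>
    ⟨spectrum_nonneg_of_nonneg ha0 hs, (le_abs_self s).trans ((abs_le_norm_of_mem_spectrum hs).trans
      ((CStarAlgebra.norm_le_one_iff_of_nonneg a ha0).mpr ha1))⟩
  have hsa := IsSelfAdjoint.of_nonneg ha0
  have h1 : ∑ c ∈ Finset.range m, t (cfc (tentGap m c) a) = t 1 := by
    rw [← ht.sum_cfc _ _ (continuous_tentGap m) hsa,
      ← _root_.cfc_sum _ _ _ (fun i _ => (continuous_tentGap m i).continuousOn), ← cfc_one ℝ a]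
    congr 1
    refine cfc_congr fun s hs => ?_
    simp only [Finset.sum_apply, Pi.one_apply]
    exact sum_tentGap hm (hspec s hs)
  have h2 : ∑ c ∈ Finset.range m, t (cfc (tentGap m c) a) ≤ ∑ c ∈ Finset.range m, t 1 / m := by
    rw [h1, Finset.sum_const, Finset.card_range, nsmul_eq_mul]
    have : (m : ℝ) ≠ 0 := by positivity
    field_simp
    exact le_rfl
  obtain ⟨c, -, hc⟩ := Finset.exists_le_of_sum_le (by simpa using hm.ne') h2
  exact ⟨c, hc⟩

/-- Products of blocks of `a` and blocks of `b` form one orthogonal family over which `a`, `b` and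
their half-sum are all nearly diagonal. `abs_sub_sum_le` then replaces each trace by a weighted sum,
and these sums are linear in the weights. The half keeps the sum in the unit interval. -/
lemma abs_half_add_sub_le (ht : IsLocalQuasitrace t K) {a b : A} (ha0 : 0 ≤ a) (ha1 : a ≤ 1)
    (hb0 : 0 ≤ b) (hb1 : b ≤ 1) (hab : Commute a b) {m : ℕ} (hm : 0 < m) :
    |t ((2⁻¹ : ℝ) • (a + b)) - 2⁻¹ * (t a + t b)| ≤ 4 * (1 + K) * t 1 / m := by
  have hspec : ∀ x : A, 0 ≤ x → x ≤ 1 → ∀ s ∈ spectrum ℝ x, s ∈ Set.Icc (0 : ℝ) 1 :=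
    fun x h0 h1 s hs => ⟨spectrum_nonneg_of_nonneg h0 hs, (le_abs_self s).trans
      ((abs_le_norm_of_mem_spectrum hs).trans
        ((CStarAlgebra.norm_le_one_iff_of_nonneg x h0).mpr h1))⟩
  have hasa := IsSelfAdjoint.of_nonneg ha0
  have hbsa := IsSelfAdjoint.of_nonneg hb0
  obtain ⟨c, hc⟩ := ht.exists_tentGap_le ha0 ha1 hm
  obtain ⟨d, hd⟩ := ht.exists_tentGap_le hb0 hb1 hm
  have hcomm : ∀ f g : ℝ → ℝ, Commute (cfc f a) (cfc g b) := fun f g =>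
    hasa.commute_cfc (hbsa.commute_cfc hab.symm g).symm f
  have hsumP : ∀ (x : A) (c : ℕ), 0 ≤ x → x ≤ 1 →
      ∑ r ∈ Finset.range (m ^ 2 + c + 1), cfc (tentBlock m c r) x = 1 - cfc (tentGap m c) x := by
    intro x c h0 h1
    have hx := IsSelfAdjoint.of_nonneg h0
    rw [← _root_.cfc_sum _ _ _ (fun i _ => (continuous_tentBlock m c i).continuousOn),
      ← cfc_one ℝ x, ← cfc_sub _ _ x (by fun_prop) (continuous_tentGap m c).continuousOn]
    refine cfc_congr fun s hs => ?_
    simp only [Finset.sum_apply, Pi.one_apply]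
    exact sum_tentBlock (hspec x h0 h1 s hs)
  have hgap0 : ∀ (x : A) (c : ℕ), 0 ≤ cfc (tentGap m c) x := fun x c =>
    cfc_nonneg fun s _ => tentGap_nonneg _ _ _
  have hblock0 : ∀ (x : A) (c r : ℕ), 0 ≤ cfc (tentBlock m c r) x := fun x c r =>
    cfc_nonneg fun s _ => tentBlock_nonneg _ _ _ _
  have horth : ∀ (x : A) (c r r' : ℕ), r ≠ r' →
      cfc (tentBlock m c r) x * cfc (tentBlock m c r') x = 0 := by
    intro x c r r' hr
    rw [← cfc_mul _ _ x (continuous_tentBlock _ _ _).continuousOn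
      (continuous_tentBlock _ _ _).continuousOn]
    simp only [tentBlock_mul_tentBlock hr, cfc_const_zero]
  have happrox : ∀ (x : A) (c : ℕ), 0 ≤ x → x ≤ 1 →
      ‖x * ∑ r ∈ Finset.range (m ^ 2 + c + 1), cfc (tentBlock m c r) x -
        ∑ r ∈ Finset.range (m ^ 2 + c + 1), tentPoint m c r • cfc (tentBlock m c r) x‖ ≤ 2 / m := by
    intro x c h0 h1
    have hx := IsSelfAdjoint.of_nonneg h0
    have hcont := fun r => continuous_tentBlock m c r
    have : x * ∑ r ∈ Finset.range (m ^ 2 + c + 1), cfc (tentBlock m c r) x -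
        ∑ r ∈ Finset.range (m ^ 2 + c + 1), tentPoint m c r • cfc (tentBlock m c r) x =
        cfc (∑ r ∈ Finset.range (m ^ 2 + c + 1),
          fun s => (s - tentPoint m c r) * tentBlock m c r s) x := by
      rw [_root_.cfc_sum _ _ _ (fun i _ => by have := hcont i; fun_prop), Finset.mul_sum,
        ← Finset.sum_sub_distrib]
      refine Finset.sum_congr rfl fun r _ => ?_
      have := hcont r
      rw [cfc_mul _ _ x (by fun_prop) (by fun_prop), cfc_sub _ _ x (by fun_prop) (by fun_prop),
        cfc_id' ℝ x, cfc_const _ x, sub_mul, Algebra.smul_def]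
    rw [this]
    refine norm_cfc_le (by positivity) fun s hs => ?_
    have hs' := hspec x h0 h1 s hs
    rw [Finset.sum_apply]
    refine (norm_sum_le _ _).trans ?_
    calc _ ≤ ∑ r ∈ Finset.range (m ^ 2 + c + 1), 2 / m * tentBlock m c r s := by
          refine Finset.sum_le_sum fun r _ => ?_
          rw [norm_mul, Real.norm_eq_abs, Real.norm_of_nonneg (tentBlock_nonneg _ _ _ _)]
          exact abs_sub_mul_tentBlock_le hm hs'
      _ ≤ 2 / m * 1 := by
          rw [← Finset.mul_sum, sum_tentBlock hs']
          have := tentGap_nonneg m c s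
          exact mul_le_mul_of_nonneg_left (by linarith) (by positivity)
      _ = 2 / m := mul_one _
  have hsum1 : ∀ (x : A) (c : ℕ), 0 ≤ x → x ≤ 1 →
      ‖∑ r ∈ Finset.range (m ^ 2 + c + 1), cfc (tentBlock m c r) x‖ ≤ 1 := by
    intro x c h0 h1
    rw [CStarAlgebra.norm_le_one_iff_of_nonneg _ (Finset.sum_nonneg fun r _ => hblock0 x c r),
      hsumP x c h0 h1]
    exact sub_le_self _ (hgap0 x c)
  let I := Finset.range (m ^ 2 + c + 1) ×ˢ Finset.range (m ^ 2 + d + 1)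
  let f : ℕ × ℕ → A := fun i => cfc (tentBlock m c i.1) a * cfc (tentBlock m d i.2) b
  have hf0 : ∀ i ∈ I, 0 ≤ f i := fun i _ =>
    (hcomm _ _).mul_nonneg (hblock0 a c i.1) (hblock0 b d i.2)
  have hfo : ∀ i ∈ I, ∀ j ∈ I, i ≠ j → f i * f j = 0 := by
    intro i _ j _ hij
    have e : f i * f j = (cfc (tentBlock m c i.1) a * cfc (tentBlock m c j.1) a) *
        (cfc (tentBlock m d i.2) b * cfc (tentBlock m d j.2) b) := by
      simp only [f]
      exact Commute.mul_mul_mul_comm (hcomm _ _).symm _ _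
    rw [e]
    by_cases h1 : i.1 = j.1
    · rw [horth b d i.2 j.2 (fun h2 => hij (Prod.ext h1 h2)), mul_zero]
    · rw [horth a c i.1 j.1 h1, zero_mul]
  set P := ∑ r ∈ Finset.range (m ^ 2 + c + 1), cfc (tentBlock m c r) a with hP
  set Q := ∑ r ∈ Finset.range (m ^ 2 + d + 1), cfc (tentBlock m d r) b with hQ
  have hF : ∑ i ∈ I, f i = P * Q := by
    rw [hP, hQ, Finset.sum_mul_sum, Finset.sum_product]
  have hP1 := hsumP a c ha0 ha1
  have hQ1 := hsumP b d hb0 hb1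
  rw [← hP] at hP1
  rw [← hQ] at hQ1
  have hww : 0 ≤ cfc (tentGap m c) a * cfc (tentGap m d) b :=
    (hcomm _ _).mul_nonneg (hgap0 a c) (hgap0 b d)
  have h1F : 1 - P * Q = cfc (tentGap m c) a + cfc (tentGap m d) b -
      cfc (tentGap m c) a * cfc (tentGap m d) b := by
    rw [hP1, hQ1]; noncomm_ring
  have hPQcomm : Commute P Q :=
    Commute.sum_left _ _ _ fun i _ => Commute.sum_right _ _ _ fun j _ => hcomm _ _
  have hP0 : 0 ≤ P := Finset.sum_nonneg fun r _ => hblock0 a c r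
  have hQ0 : 0 ≤ Q := Finset.sum_nonneg fun r _ => hblock0 b d r
  have hPQ0 : 0 ≤ P * Q := hPQcomm.mul_nonneg hP0 hQ0
  have hPQ1 : P * Q ≤ 1 := by
    rw [← CStarAlgebra.norm_le_one_iff_of_nonneg _ hPQ0]
    exact (norm_mul_le _ _).trans (mul_le_one₀ (hsum1 a c ha0 ha1) (norm_nonneg _)
      (hsum1 b d hb0 hb1))
  -- The complement of the grid is dominated by the sum of the two gaps. They come from different
  -- elements, so quasi-subadditivity is needed, whence the factor `K`.
  have htF : t (1 - P * Q) ≤ 2 * K * t 1 / m := by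
    have h1 : t (1 - P * Q) ≤ t (cfc (tentGap m c) a + cfc (tentGap m d) b) := by
      refine ht.mono _ _ ((IsSelfAdjoint.one A).sub (.of_nonneg hPQ0))
        (.of_nonneg (add_nonneg (hgap0 a c) (hgap0 b d))) ?_
      rw [h1F]
      exact sub_le_self _ hww
    refine h1.trans ((ht.add_le _ _ (hgap0 a c) (hgap0 b d)).trans ?_)
    calc _ ≤ K * (t 1 / m + t 1 / m) := mul_le_mul_of_nonneg_left (add_le_add hc hd) ht.const_nonneg
      _ = _ := by ring
  have hPn := hsum1 a c ha0 ha1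
  have hQn := hsum1 b d hb0 hb1
  rw [← hP] at hPn
  rw [← hQ] at hQn
  have hca : ∀ i ∈ I, Commute a (f i) := fun i _ =>
    (hasa.commute_cfc (Commute.refl a) _).symm.mul_right (hbsa.commute_cfc hab.symm _).symm
  have hcb : ∀ i ∈ I, Commute b (f i) := fun i _ =>
    (hasa.commute_cfc hab _).symm.mul_right (hbsa.commute_cfc (Commute.refl b) _).symm
  have hea : ‖a * (P * Q) - ∑ i ∈ I, tentPoint m c i.1 • f i‖ ≤ 2 / m := by
    have e : a * (P * Q) - ∑ i ∈ I, tentPoint m c i.1 • f i =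
        (a * P - ∑ r ∈ Finset.range (m ^ 2 + c + 1), tentPoint m c r • cfc (tentBlock m c r) a) *
          Q := by
      rw [sub_mul, mul_assoc]
      congr 1
      rw [hQ, Finset.sum_mul_sum, Finset.sum_product]
      simp only [f, smul_mul_assoc]
    rw [e]
    refine (norm_mul_le _ _).trans ?_
    calc _ ≤ (2 / m : ℝ) * 1 := mul_le_mul (happrox a c ha0 ha1) hQn (norm_nonneg _) (by positivity)
      _ = _ := mul_one _
  have heb : ‖b * (P * Q) - ∑ i ∈ I, tentPoint m d i.2 • f i‖ ≤ 2 / m := by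
    have e : b * (P * Q) - ∑ i ∈ I, tentPoint m d i.2 • f i = P *
        (b * Q - ∑ r ∈ Finset.range (m ^ 2 + d + 1), tentPoint m d r • cfc (tentBlock m d r) b) := by
      have hbP : Commute b P := Commute.sum_right _ _ _ fun r _ => (hasa.commute_cfc hab _).symm
      rw [mul_sub, ← mul_assoc, hbP.eq, mul_assoc]
      congr 1
      rw [hP, Finset.sum_mul_sum, Finset.sum_product]
      simp only [f, mul_smul_comm]
    rw [e]
    refine (norm_mul_le _ _).trans ?_
    calc _ ≤ (1 : ℝ) * (2 / m) := mul_le_mul hPn (happrox b d hb0 hb1) (norm_nonneg _) zero_le_one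
      _ = _ := one_mul _
  have hF1 : ∑ i ∈ I, f i ≤ 1 := hF ▸ hPQ1
  have ka := ht.abs_sub_sum_le I f hf0 hfo hF1 ha0 ha1 hca (fun i => tentPoint m c i.1)
    (fun i => tentPoint_mem _ _ _) (ε := 2 / m) (by rw [hF]; exact hea)
  have kb := ht.abs_sub_sum_le I f hf0 hfo hF1 hb0 hb1 hcb (fun i => tentPoint m d i.2)
    (fun i => tentPoint_mem _ _ _) (ε := 2 / m) (by rw [hF]; exact heb)
  have hhalf : (2⁻¹ : ℝ) • (a + b) ≤ 1 := by
    have : (2⁻¹ : ℝ) • (a + b) ≤ (2⁻¹ : ℝ) • ((1 : A) + 1) :=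
      smul_le_smul_of_nonneg_left (add_le_add ha1 hb1) (by norm_num)
    refine this.trans (le_of_eq ?_)
    rw [← two_smul ℝ (1 : A), smul_smul]
    norm_num
  have kab := ht.abs_sub_sum_le I f hf0 hfo hF1 (smul_nonneg (by norm_num) (add_nonneg ha0 hb0))
    hhalf (fun i hi => ((hca i hi).add_left (hcb i hi)).smul_left (2⁻¹ : ℝ))
    (fun i => 2⁻¹ * (tentPoint m c i.1 + tentPoint m d i.2))
    (fun i => by
      have h1 := tentPoint_mem m c i.1
      have h2 := tentPoint_mem m d i.2
      constructor <;> linarith [h1.1, h1.2, h2.1, h2.2]) (ε := 2 / m) (by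
      rw [hF]
      have e : (2⁻¹ : ℝ) • (a + b) * (P * Q) -
          ∑ i ∈ I, (2⁻¹ * (tentPoint m c i.1 + tentPoint m d i.2)) • f i =
          (2⁻¹ : ℝ) • ((a * (P * Q) - ∑ i ∈ I, tentPoint m c i.1 • f i) +
            (b * (P * Q) - ∑ i ∈ I, tentPoint m d i.2 • f i)) := by
        simp only [mul_smul, add_smul, Finset.sum_add_distrib, ← Finset.smul_sum, smul_mul_assoc,
          add_mul, smul_add, smul_sub]
        abel
      rw [e, norm_smul, Real.norm_of_nonneg (by norm_num)]
      have := norm_add_le (a * (P * Q) - ∑ i ∈ I, tentPoint m c i.1 • f i)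
        (b * (P * Q) - ∑ i ∈ I, tentPoint m d i.2 • f i)
      linarith)
  rw [hF] at ka kb kab
  have e : ∑ i ∈ I, 2⁻¹ * (tentPoint m c i.1 + tentPoint m d i.2) * t (f i) =
      2⁻¹ * (∑ i ∈ I, tentPoint m c i.1 * t (f i) + ∑ i ∈ I, tentPoint m d i.2 * t (f i)) := by
    rw [← Finset.sum_add_distrib, Finset.mul_sum]
    exact Finset.sum_congr rfl fun i _ => by ring
  rw [e] at kab
  rw [abs_le] at ka kb kab ⊢
  -- One error is spent on the half-sum and half an error on each of `a` and `b`.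
  have e2 : 4 * (1 + K) * t 1 / m = 2 * (2 / m * t 1 + 2 * K * t 1 / m) := by ring
  rw [e2]
  constructor <;> linarith [ka.1, ka.2, kb.1, kb.2, kab.1, kab.2]

/-- Local quasitraces are additive on commuting self-adjoint elements. -/
theorem add_of_commute (ht : IsLocalQuasitrace t K) {a b : A} (ha : IsSelfAdjoint a)
    (hb : IsSelfAdjoint b) (hab : Commute a b) : t (a + b) = t a + t b := by
  have key : ∀ a b : A, 0 ≤ a → a ≤ 1 → 0 ≤ b → b ≤ 1 → Commute a b →
      t (a + b) = t a + t b := by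
    intro a b ha0 ha1 hb0 hb1 hab
    have h1 : |t ((2⁻¹ : ℝ) • (a + b)) - 2⁻¹ * (t a + t b)| ≤ 0 := by
      refine ge_of_tendsto (tendsto_const_div_atTop_nhds_zero_nat (4 * (1 + K) * t 1)) ?_
      filter_upwards [eventually_gt_atTop 0] with m hm
      exact ht.abs_half_add_sub_le ha0 ha1 hb0 hb1 hab hm
    have h2 := abs_nonpos_iff.mp h1
    rw [ht.smul _ _ (.of_nonneg (add_nonneg ha0 hb0))] at h2
    linarith
  -- Shifting by `R` and dividing by `2R` moves both elements into the unit interval; scalar shifts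
  -- are respected by `t`.
  obtain ⟨R, hR0, hRa, hRb⟩ : ∃ R : ℝ, 0 < R ∧ ‖a‖ ≤ R ∧ ‖b‖ ≤ R :=
    ⟨max ‖a‖ ‖b‖ + 1, by positivity, by linarith [le_max_left ‖a‖ ‖b‖],
      by linarith [le_max_right ‖a‖ ‖b‖]⟩
  have hshift : ∀ x : A, IsSelfAdjoint x → ‖x‖ ≤ R →
      0 ≤ x + algebraMap ℝ A R ∧ x + algebraMap ℝ A R ≤ algebraMap ℝ A (2 * R) := by
    intro x hx hxR
    have h1 := hx.neg_algebraMap_norm_le_self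
    have h2 := hx.le_algebraMap_norm_self
    have h3 : algebraMap ℝ A ‖x‖ ≤ algebraMap ℝ A R := algebraMap_mono A hxR
    constructor
    · rw [← neg_le_iff_add_nonneg]
      exact (neg_le_neg h3).trans h1
    · rw [two_mul, map_add]
      exact add_le_add_left (h2.trans h3) _
  have hinv : ((2 * R)⁻¹ : ℝ) • algebraMap ℝ A (2 * R) = 1 := by
    rw [Algebra.algebraMap_eq_smul_one, smul_smul, inv_mul_cancel₀ (by positivity), one_smul]
  have h2R : 0 ≤ (2 * R)⁻¹ := by positivity
  obtain ⟨a0, a1⟩ := hshift a ha hRa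
  obtain ⟨b0, b1⟩ := hshift b hb hRb
  have a1' := smul_le_smul_of_nonneg_left a1 h2R
  have b1' := smul_le_smul_of_nonneg_left b1 h2R
  rw [hinv] at a1' b1'
  have hcm : Commute (a + algebraMap ℝ A R) (b + algebraMap ℝ A R) :=
    (hab.add_right (Algebra.commutes R a).symm).add_left
      (Commute.add_right (Algebra.commutes R b) (Commute.refl _))
  have k := key _ _ (smul_nonneg h2R a0) a1' (smul_nonneg h2R b0) b1'
    ((hcm.smul_left (2 * R)⁻¹).smul_right (2 * R)⁻¹)
  rw [← smul_add, ht.smul _ _ (.of_nonneg (add_nonneg a0 b0)), ht.smul _ _ (.of_nonneg a0),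
    ht.smul _ _ (.of_nonneg b0), ← mul_add] at k
  have k2 := mul_left_cancel₀ (by positivity : (2 * R)⁻¹ ≠ 0) k
  have e : a + algebraMap ℝ A R + (b + algebraMap ℝ A R) = a + b + algebraMap ℝ A (2 * R) := by
    rw [two_mul, map_add]; abel
  rw [e, ht.add_algebraMap (ha.add hb), ht.add_algebraMap ha, ht.add_algebraMap hb] at k2
  linarith

end IsLocalQuasitrace

/-! ### Asymptotic homomorphisms and polynomial functional calculus -/

/-- A sequence of positive linear maps, subunital and asymptotically multiplicative. -/
structure IsAsymptoticHom {B : Type v} {A : Type u} [CStarAlgebra B] [PartialOrder B]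
    [CStarAlgebra A] [PartialOrder A] (β : ℕ → B →ₗ[ℂ] A) : Prop where
  nonneg : ∀ n x, 0 ≤ x → 0 ≤ β n x
  map_one_le : ∀ n, β n 1 ≤ 1
  tendsto_mul : ∀ x y, Tendsto (fun n => β n (x * y) - β n x * β n y) atTop (𝓝 0)

namespace IsAsymptoticHom

variable {B : Type v} {A : Type u} [CStarAlgebra B] [PartialOrder B] [StarOrderedRing B]
    [CStarAlgebra A] [PartialOrder A] [StarOrderedRing A] {β : ℕ → B →ₗ[ℂ] A}

lemma map_real_smul (n : ℕ) (r : ℝ) (x : B) : β n (r • x) = r • β n x :=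
  (β n).map_smul_of_tower r x

lemma shift_nonneg {x : B} (hx : IsSelfAdjoint x) : 0 ≤ x + algebraMap ℝ B ‖x‖ := by
  have := hx.neg_algebraMap_norm_le_self
  rwa [neg_le_iff_add_nonneg] at this

lemma map_mono (hβ : IsAsymptoticHom β) (n : ℕ) {x y : B} (h : x ≤ y) : β n x ≤ β n y := by
  have := hβ.nonneg n _ (sub_nonneg.mpr h)
  rwa [map_sub, sub_nonneg] at this

lemma map_isSelfAdjoint (hβ : IsAsymptoticHom β) (n : ℕ) {x : B} (hx : IsSelfAdjoint x) :
    IsSelfAdjoint (β n x) := by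
  have h1 := IsSelfAdjoint.of_nonneg (hβ.nonneg n _ (shift_nonneg hx))
  have h2 := IsSelfAdjoint.of_nonneg
    (hβ.nonneg n _ (algebraMap_nonneg B (norm_nonneg x)))
  have := h1.sub h2
  rwa [← map_sub, add_sub_cancel_right] at this

lemma map_star (hβ : IsAsymptoticHom β) (n : ℕ) (x : B) : β n (star x) = star (β n x) := by
  conv_rhs => rw [← realPart_add_I_smul_imaginaryPart x]
  conv_lhs => rw [← realPart_add_I_smul_imaginaryPart x]
  rw [star_add, star_smul, (realPart x).2.star_eq, (imaginaryPart x).2.star_eq, map_add, map_add,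
    map_smul, map_smul, star_add, star_smul, (hβ.map_isSelfAdjoint n (realPart x).2).star_eq,
    (hβ.map_isSelfAdjoint n (imaginaryPart x).2).star_eq]

/-- On positive elements the map is contractive by `map_one_le`. Writing `x` as `(x + ‖x‖) - ‖x‖`
costs `2‖x‖ + ‖x‖`. -/
lemma norm_map_le (hβ : IsAsymptoticHom β) (n : ℕ) {x : B} (hx : IsSelfAdjoint x) :
    ‖β n x‖ ≤ 3 * ‖x‖ := by
  have h1 : ∀ y : B, 0 ≤ y → ‖β n y‖ ≤ ‖y‖ := by
    intro y hy
    rw [CStarAlgebra.norm_le_iff_le_algebraMap _ (norm_nonneg y) (hβ.nonneg n y hy)]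
    have h2 := hβ.map_mono n (IsSelfAdjoint.of_nonneg hy).le_algebraMap_norm_self
    refine h2.trans ?_
    rw [Algebra.algebraMap_eq_smul_one, Algebra.algebraMap_eq_smul_one, map_real_smul]
    exact smul_le_smul_of_nonneg_left (hβ.map_one_le n) (norm_nonneg y)
  have h2 := h1 _ (shift_nonneg hx)
  have h3 := h1 _ (algebraMap_nonneg B (norm_nonneg x))
  have h4 : ‖algebraMap ℝ B ‖x‖‖ ≤ ‖x‖ := by
    rw [CStarAlgebra.norm_le_iff_le_algebraMap _ (norm_nonneg x)
      (algebraMap_nonneg B (norm_nonneg x))]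
  have h5 : β n x = β n (x + algebraMap ℝ B ‖x‖) - β n (algebraMap ℝ B ‖x‖) := by
    rw [← map_sub, add_sub_cancel_right]
  rw [h5]
  linarith [norm_sub_le (β n (x + algebraMap ℝ B ‖x‖)) (β n (algebraMap ℝ B ‖x‖)),
    norm_add_le x (algebraMap ℝ B ‖x‖)]

lemma tendsto_pow (hβ : IsAsymptoticHom β) {k : B} (hk : IsSelfAdjoint k) (j : ℕ) :
    Tendsto (fun n => β n (k ^ (j + 1)) - β n k ^ (j + 1)) atTop (𝓝 0) := by
  induction j with
  | zero => simp
  | succ j ih =>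
    have h1 : Tendsto (fun n => β n k * (β n (k ^ (j + 1)) - β n k ^ (j + 1))) atTop (𝓝 0) := by
      refine squeeze_zero_norm (fun n => (norm_mul_le _ _).trans
        (mul_le_mul_of_nonneg_right (hβ.norm_map_le n hk) (norm_nonneg _))) ?_
      simpa using ih.norm.const_mul (3 * ‖k‖)
    have h2 := (hβ.tendsto_mul k (k ^ (j + 1))).add h1
    rw [add_zero] at h2
    refine h2.congr fun n => ?_
    rw [pow_succ' k (j + 1), pow_succ' (β n k) (j + 1), mul_sub]
    abel

open Polynomial in
-- The factor `X` excludes constant terms, because `β n 1` need not be close to 1.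
lemma tendsto_aeval (hβ : IsAsymptoticHom β) {k : B} (hk : IsSelfAdjoint k) (p : ℝ[X]) :
    Tendsto (fun n => β n (aeval k (X * p)) - aeval (β n k) (X * p)) atTop (𝓝 0) := by
  induction p using Polynomial.induction_on' with
  | add p q hp hq =>
    have := hp.add hq
    rw [add_zero] at this
    refine this.congr fun n => ?_
    simp only [mul_add, map_add]
    abel
  | monomial j r =>
    have := (hβ.tendsto_pow hk j).const_smul r
    rw [smul_zero] at this
    refine this.congr fun n => ?_
    simp only [X_mul_monomial, aeval_monomial, ← Algebra.smul_def, map_real_smul, smul_sub]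

end IsAsymptoticHom

open Polynomial in
lemma IsSelfAdjoint.aeval_real {B : Type v} [CStarAlgebra B] [PartialOrder B] [StarOrderedRing B]
    {x : B} (hx : IsSelfAdjoint x) (p : ℝ[X]) : IsSelfAdjoint (aeval x p) := by
  rw [← cfc_polynomial p x hx]
  exact IsSelfAdjoint.cfc_real _ _

open Polynomial in
-- Shifting by `‖x‖ + 1` puts the spectrum into `[1, 2‖x‖ + 1]`, away from 0. There the shifted `f`
-- may be divided by the variable before Weierstrass is applied, so the approximating polynomial has
-- no constant term.
lemma exists_aeval_near {B : Type v} [CStarAlgebra B] [PartialOrder B] [StarOrderedRing B] {x : B}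
    (hx : IsSelfAdjoint x) {f : ℝ → ℝ} (hf : Continuous f) {ε : ℝ} (hε : 0 < ε) :
    ∃ p : ℝ[X], ‖cfc f x - aeval (x + algebraMap ℝ B (‖x‖ + 1)) (X * p)‖ ≤ ε := by
  set c := ‖x‖ + 1
  set R := 2 * ‖x‖ + 1
  have hx0 := norm_nonneg x
  have hR : 0 < R := by positivity
  obtain ⟨p, hp⟩ := exists_polynomial_near_of_continuousOn 1 R (fun s => f (s - c) / s)
    ((by fun_prop : Continuous fun s => f (s - c)).continuousOn.div continuousOn_id
      fun s hs => (zero_lt_one.trans_le hs.1).ne') (ε / R) (by positivity)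
  refine ⟨p, ?_⟩
  have hc : Continuous (X * p).eval := Polynomial.continuous _
  have h1 : x + algebraMap ℝ B c = cfc (fun s : ℝ => s + c) x := by
    rw [cfc_add x (fun s => s) (fun _ => c) (by fun_prop) (by fun_prop), cfc_id' ℝ x, cfc_const c x]
  have h2 : aeval (x + algebraMap ℝ B c) (X * p) =
      cfc (fun s : ℝ => (X * p).eval (s + c)) x := by
    rw [h1]
    exact (cfc_map_polynomial (X * p) (fun s => s + c) x).symm
  have hc2 : Continuous fun s : ℝ => (X * p).eval (s + c) := hc.comp (by fun_prop)
  rw [h2, ← cfc_sub _ _ x hf.continuousOn hc2.continuousOn]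
  refine norm_cfc_le hε.le fun s hs => ?_
  have hs1 := abs_le.mp (abs_le_norm_of_mem_spectrum hs)
  have hsI : s + c ∈ Set.Icc 1 R := ⟨by simp only [c]; linarith, by simp only [c, R]; linarith⟩
  have h3 := hp (s + c) hsI
  have h4 : 0 < s + c := zero_lt_one.trans_le hsI.1
  rw [add_sub_cancel_right] at h3
  have h5 : f s - (X * p).eval (s + c) = -((s + c) * (p.eval (s + c) - f s / (s + c))) := by
    rw [eval_mul, eval_X]
    field_simp
    ring
  rw [h5, norm_neg, norm_mul, Real.norm_of_nonneg h4.le, Real.norm_eq_abs]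
  calc _ ≤ R * (ε / R) := mul_le_mul hsI.2 h3.le (abs_nonneg _) hR.le
    _ = ε := by field_simp

/-! ### Limits of quasitraces along asymptotic homomorphisms -/

namespace IsRealQuasitrace

variable {B : Type v} {A : Type u} [CStarAlgebra B] [PartialOrder B] [StarOrderedRing B]
    [CStarAlgebra A] [PartialOrder A] [StarOrderedRing A] {β : ℕ → B →ₗ[ℂ] A}
    {t : A → ℝ} {s : B → ℝ} {K : ℝ} {l : Filter ℕ} [l.NeBot]

lemma tendsto_sub_of_tendsto (ht : IsRealQuasitrace t) {x y : ℕ → A}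
    (hx : ∀ n, IsSelfAdjoint (x n)) (hy : ∀ n, IsSelfAdjoint (y n))
    (h : Tendsto (fun n => x n - y n) atTop (𝓝 0)) :
    Tendsto (fun n => t (x n) - t (y n)) atTop (𝓝 0) := by
  refine squeeze_zero_norm (fun n => ht.abs_sub_le (hx n) (hy n)) ?_
  simpa using h.norm.mul_const (t 1)

open Polynomial in
-- Images of a commuting pair need not commute, so additivity of `t` cannot be used on them. For two
-- polynomials in one element `k`, however, the images are asymptotic to polynomials in `β n k`,
-- which do commute. Density and the Lipschitz bound extend this to continuous functions.
lemma isLocalQuasitrace_limit (ht : IsRealQuasitrace t) (hK : 0 ≤ K)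
    (hadd : ∀ x y : A, 0 ≤ x → 0 ≤ y → t (x + y) ≤ K * (t x + t y)) (hβ : IsAsymptoticHom β)
    (hl : l ≤ atTop) (hs : ∀ x, IsSelfAdjoint x → Tendsto (fun n => t (β n x)) l (𝓝 (s x))) :
    IsLocalQuasitrace s K := by
  have hlip : ∀ x y, IsSelfAdjoint x → IsSelfAdjoint y →
      |s x - s y| ≤ 3 * t 1 * ‖x - y‖ := by
    intro x y hx hy
    refine le_of_tendsto ((hs x hx).sub (hs y hy)).abs (Eventually.of_forall fun n => ?_)
    refine (ht.abs_sub_le (hβ.map_isSelfAdjoint n hx) (hβ.map_isSelfAdjoint n hy)).trans ?_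
    rw [← map_sub]
    have := mul_le_mul_of_nonneg_right (hβ.norm_map_le n (hx.sub hy)) ht.one_nonneg
    linarith
  refine ⟨hK, fun x y hx hy hxy => ?_, fun r x hx => ?_, fun f g x hf hg hx => ?_,
    fun x y hx hy => ?_⟩
  · exact le_of_tendsto_of_tendsto' (hs x hx) (hs y hy) fun n =>
      ht.mono (hβ.map_isSelfAdjoint n hx) (hβ.map_isSelfAdjoint n hy) (hβ.map_mono n hxy)
  · refine tendsto_nhds_unique (hs _ ((IsSelfAdjoint.all r).smul hx))
      (((hs x hx).const_mul r).congr fun n => ?_)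
    rw [IsAsymptoticHom.map_real_smul, ht.smul _ _ (hβ.map_isSelfAdjoint n hx)]
  · set k := x + algebraMap ℝ B (‖x‖ + 1)
    have hk : IsSelfAdjoint k := hx.add (.algebraMap B (IsSelfAdjoint.all _))
    have hpq : ∀ p q : ℝ[X], s (aeval k (X * p) + aeval k (X * q)) =
        s (aeval k (X * p)) + s (aeval k (X * q)) := by
      intro p q
      have hP := hk.aeval_real (X * p)
      have hQ := hk.aeval_real (X * q)
      have hβP := fun n => hβ.map_isSelfAdjoint n hP
      have hβQ := fun n => hβ.map_isSelfAdjoint n hQ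
      have hPn := fun n => (hβ.map_isSelfAdjoint n hk).aeval_real (X * p)
      have hQn := fun n => (hβ.map_isSelfAdjoint n hk).aeval_real (X * q)
      have l1 := ht.tendsto_sub_of_tendsto hβP hPn (hβ.tendsto_aeval hk p)
      have l2 := ht.tendsto_sub_of_tendsto hβQ hQn (hβ.tendsto_aeval hk q)
      have l3 := ht.tendsto_sub_of_tendsto (x := fun n => β n (aeval k (X * p) + aeval k (X * q)))
        (y := fun n => aeval (β n k) (X * p) + aeval (β n k) (X * q))
        (fun n => hβ.map_isSelfAdjoint n (hP.add hQ)) (fun n => (hPn n).add (hQn n))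
        (by
          have := (hβ.tendsto_aeval hk p).add (hβ.tendsto_aeval hk q)
          rw [add_zero] at this
          refine this.congr fun n => ?_
          rw [map_add (β n) (aeval k (X * p))]
          abel)
      have l4 := ((l3.sub l1).sub l2).mono_left hl
      have l5 := ((hs _ (hP.add hQ)).sub (hs _ hP)).sub (hs _ hQ)
      have e := tendsto_nhds_unique l5 (by
        refine (l4.congr fun n => ?_)
        rw [ht.add_of_commute _ _ (hPn n) (hQn n)]
        · ring
        · rw [Commute, SemiconjBy, ← map_mul, ← map_mul, mul_comm])
      simp only [sub_zero] at e
      linarith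
    have hfsa := IsSelfAdjoint.cfc_real f x
    have hgsa := IsSelfAdjoint.cfc_real g x
    -- The Lipschitz constant `3 * t 1` is applied to errors `ε`, `ε` and `2ε`.
    have key : ∀ ε : ℝ, 0 < ε → |s (cfc f x + cfc g x) - (s (cfc f x) + s (cfc g x))| ≤
        12 * t 1 * ε := by
      intro ε hε
      obtain ⟨p, hp⟩ := exists_aeval_near hx hf hε
      obtain ⟨q, hq⟩ := exists_aeval_near hx hg hε
      have hP := hk.aeval_real (X * p)
      have hQ := hk.aeval_real (X * q)
      have h0 := ht.one_nonneg
      have h1 := (hlip _ _ hfsa hP).trans (mul_le_mul_of_nonneg_left hp (by positivity))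
      have h2 := (hlip _ _ hgsa hQ).trans (mul_le_mul_of_nonneg_left hq (by positivity))
      have h3 := (hlip _ _ (hfsa.add hgsa) (hP.add hQ)).trans (mul_le_mul_of_nonneg_left
        (a := 3 * t 1) (c := ε + ε) (by
          rw [add_sub_add_comm]
          exact (norm_add_le _ _).trans (add_le_add hp hq)) (by positivity))
      rw [hpq] at h3
      rw [_root_.abs_le] at h1 h2 h3 ⊢
      constructor <;> linarith [h1.1, h1.2, h2.1, h2.2, h3.1, h3.2]
    have h0 : |s (cfc f x + cfc g x) - (s (cfc f x) + s (cfc g x))| ≤ 0 := by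
      refine ge_of_tendsto (f := fun n : ℕ => 12 * t 1 * (1 / ((n : ℝ) + 1))) (x := atTop) ?_
        (Eventually.of_forall fun n => key _ Nat.one_div_pos_of_nat)
      simpa using tendsto_one_div_add_atTop_nhds_zero_nat.const_mul (12 * t 1)
    linarith [abs_nonpos_iff.mp h0]
  · refine le_of_tendsto_of_tendsto' (hs _ (.of_nonneg (add_nonneg hx hy)))
      (((hs x (.of_nonneg hx)).add (hs y (.of_nonneg hy))).const_mul K) fun n => ?_
    rw [map_add]
    exact hadd _ _ (hβ.nonneg n x hx) (hβ.nonneg n y hy)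

/-- Limits of quasitraces along asymptotic homomorphisms are quasitraces. -/
theorem limit (ht : IsRealQuasitrace t) (hK : 0 ≤ K)
    (hadd : ∀ x y : A, 0 ≤ x → 0 ≤ y → t (x + y) ≤ K * (t x + t y)) (hβ : IsAsymptoticHom β)
    (hl : l ≤ atTop) (hs : ∀ x, IsSelfAdjoint x → Tendsto (fun n => t (β n x)) l (𝓝 (s x))) :
    IsRealQuasitrace s := by
  have h := ht.isLocalQuasitrace_limit hK hadd hβ hl hs
  refine ⟨fun x y hx hy hxy => h.add_of_commute hx hy hxy, h.smul, fun x hx => h.nonneg hx,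
    fun x => ?_⟩
  have l1 := ht.tendsto_sub_of_tendsto
    (fun n => hβ.map_isSelfAdjoint n (IsSelfAdjoint.star_mul_self x))
    (fun n => IsSelfAdjoint.star_mul_self (β n x))
    ((hβ.tendsto_mul (star x) x).congr fun n => by rw [hβ.map_star])
  have l2 := ht.tendsto_sub_of_tendsto
    (fun n => hβ.map_isSelfAdjoint n (IsSelfAdjoint.mul_star_self x))
    (fun n => IsSelfAdjoint.mul_star_self (β n x))
    ((hβ.tendsto_mul x (star x)).congr fun n => by rw [hβ.map_star])
  have l3 := (l1.sub l2).mono_left hl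
  have l4 := (hs _ (IsSelfAdjoint.star_mul_self x)).sub (hs _ (IsSelfAdjoint.mul_star_self x))
  have e := tendsto_nhds_unique l4 (l3.congr fun n => by rw [ht.star_mul_comm (β n x)]; ring)
  linarith

lemma exists_tendsto (ht : IsRealQuasitrace t) (hβ : IsAsymptoticHom β) (ω : Ultrafilter ℕ) :
    ∃ s : B → ℝ, ∀ x, IsSelfAdjoint x → Tendsto (fun n => t (β n x)) ω (𝓝 (s x)) := by
  have : ∀ x : B, ∃ L : ℝ, IsSelfAdjoint x → Tendsto (fun n => t (β n x)) ω (𝓝 L) := by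
    intro x
    by_cases hx : IsSelfAdjoint x
    · have hb : ∀ n, t (β n x) ∈ Set.Icc (-(3 * ‖x‖ * t 1)) (3 * ‖x‖ * t 1) := by
        intro n
        rw [Set.mem_Icc, ← _root_.abs_le]
        exact (ht.abs_le (hβ.map_isSelfAdjoint n hx)).trans
          (mul_le_mul_of_nonneg_right (hβ.norm_map_le n hx) ht.one_nonneg)
      obtain ⟨L, -, hL⟩ := isCompact_Icc.ultrafilter_le_nhds' (ω.map fun n => t (β n x))
        (Filter.mem_map.mpr (Filter.univ_mem' hb))
      exact ⟨L, fun _ => hL⟩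
    · exact ⟨0, fun h => absurd h hx⟩
  choose s hs using this
  exact ⟨s, hs⟩

end IsRealQuasitrace

/-! ### Additive quasitraces are traces -/

section Trace

variable {A : Type u} [CStarAlgebra A] [PartialOrder A] [StarOrderedRing A]

lemma IsRealQuasitrace.exists_isQuasitrace {t : A → ℝ} (ht : IsRealQuasitrace t) :
    ∃ τ : A → ℂ, IsQuasitrace τ ∧ ∀ x, IsSelfAdjoint x → τ x = t x := by
  refine ⟨fun x => (t (realPart x : A) : ℂ) + Complex.I * (t (imaginaryPart x : A) : ℂ),
    ht.isQuasitrace fun _ => rfl, fun x hx => ?_⟩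
  simp only [hx.imaginaryPart, hx.coe_realPart]
  simp [ht.map_zero]

/-- A quasitrace which is additive on positive elements is a trace. -/
lemma IsQuasitrace.isTrace_of_add {τ : A → ℂ} (hτ : IsQuasitrace τ)
    (hadd : ∀ x y : A, 0 ≤ x → 0 ≤ y → (τ (x + y)).re = (τ x).re + (τ y).re) : IsTrace τ := by
  have ht := hτ.isRealQuasitrace
  have hsa : ∀ x y : A, IsSelfAdjoint x → IsSelfAdjoint y →
      (τ (x + y)).re = (τ x).re + (τ y).re := by
    intro x y hx hy
    have h := hadd _ _ (IsAsymptoticHom.shift_nonneg hx) (IsAsymptoticHom.shift_nonneg hy)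
    have e : x + algebraMap ℝ A ‖x‖ + (y + algebraMap ℝ A ‖y‖) =
        x + y + algebraMap ℝ A (‖x‖ + ‖y‖) := by rw [map_add]; abel
    have h1 := ht.add_algebraMap (hx.add hy) (‖x‖ + ‖y‖)
    have h2 := ht.add_algebraMap hx ‖x‖
    have h3 := ht.add_algebraMap hy ‖y‖
    simp only [e] at h h1 h2 h3
    linarith
  have hadd' : ∀ x y : A, τ (x + y) = τ x + τ y := by
    intro x y
    rw [hτ.eq_realPart_add, hτ.eq_realPart_add x, hτ.eq_realPart_add y, map_add, map_add,
      AddSubgroup.coe_add, AddSubgroup.coe_add, hsa _ _ (realPart x).2 (realPart y).2,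
      hsa _ _ (imaginaryPart x).2 (imaginaryPart y).2]
    push_cast
    ring
  have hsmul : ∀ (c : ℂ) (x : A), τ (c • x) = c * τ x := by
    intro c x
    conv_lhs => rw [← realPart_add_I_smul_imaginaryPart x]
    rw [smul_add, hadd', smul_smul, hτ.smul_of_isSelfAdjoint c (realPart x).2,
      hτ.smul_of_isSelfAdjoint _ (imaginaryPart x).2]
    conv_rhs => rw [← realPart_add_I_smul_imaginaryPart x]
    rw [hτ.map_add_I_smul _ _ (realPart x).2 (imaginaryPart x).2]
    ring
  refine ⟨⟨hadd', hsmul⟩, hτ.nonneg, ?_⟩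
  have key : ∀ x y : A, τ (star x * y) = τ (y * star x) := by
    intro x y
    have h1 := hτ.star_mul_comm (x + y)
    have h2 := hτ.star_mul_comm (x + Complex.I • y)
    have hx := hτ.star_mul_comm x
    have hy := hτ.star_mul_comm y
    simp only [star_add, star_smul, add_mul, mul_add, smul_mul_assoc, mul_smul_comm, hadd', hsmul,
      RCLike.star_def, Complex.conj_I] at h1 h2
    have hI : Complex.I ≠ 0 := Complex.I_ne_zero
    -- Polarization: the exchange identities for `x + y` and `x + iy` together isolate the
    -- commutator term.
    have h3 : 2 * Complex.I * (τ (star x * y) - τ (y * star x)) = 0 := by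
      linear_combination Complex.I * h1 + h2 - (Complex.I + 1) * hx - (Complex.I - Complex.I ^ 2) * hy
    have h4 : (2 : ℂ) * Complex.I ≠ 0 := mul_ne_zero two_ne_zero hI
    exact sub_eq_zero.mp ((mul_eq_zero.mp h3).resolve_left h4)
  intro x y
  simpa using key (star x) y

end Trace

/-! ### 2-quasitraces as limits along completely positive maps -/

section Decomposition

variable {A : Type u} {B : Type v} [CStarAlgebra A] [PartialOrder A] [StarOrderedRing A]
  [CStarAlgebra B] [PartialOrder B] [StarOrderedRing B]

lemma CompletelyPositiveMap.nonneg_of_nonneg (φ : B →CP A) {x : B} (hx : 0 ≤ x) : 0 ≤ φ x := by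
  simpa using OrderHomClass.mono φ hx

lemma CompletelyPositiveMap.map_one_le (φ : B →CP A) (h : ∀ x, ‖φ x‖ ≤ ‖x‖) : φ 1 ≤ 1 := by
  rw [← CStarAlgebra.norm_le_one_iff_of_nonneg _ (φ.nonneg_of_nonneg zero_le_one)]
  exact (h 1).trans ((CStarAlgebra.norm_le_one_iff_of_nonneg _ zero_le_one).mpr le_rfl)

lemma isAsymptoticHom_of_completelyPositive {β : ℕ → B →CP A} (h1 : ∀ n x, ‖β n x‖ ≤ ‖x‖)
    (hmul : ∀ x y : B, Tendsto (fun n => ‖β n (x * y) - β n x * β n y‖) atTop (𝓝 0)) :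
    IsAsymptoticHom fun n => (β n).toLinearMap where
  nonneg n _ hx := (β n).nonneg_of_nonneg hx
  map_one_le n := (β n).map_one_le (h1 n)
  tendsto_mul x y := tendsto_zero_iff_norm_tendsto_zero.mpr (hmul x y)

/-- The entrywise amplification of a linear map to `2 × 2` matrices. -/
noncomputable def amplification (φ : B →ₗ[ℂ] A) :
    CStarMatrix (Fin 2) (Fin 2) B →ₗ[ℂ] CStarMatrix (Fin 2) (Fin 2) A :=
  CStarMatrix.mapₗ φ

lemma amplification_mat2 (φ : B →ₗ[ℂ] A) (a b c d : B) :
    amplification φ (mat2 a b c d) = mat2 (φ a) (φ b) (φ c) (φ d) :=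
  mat2_ext rfl rfl rfl rfl

lemma one_eq_mat2 : (1 : CStarMatrix (Fin 2) (Fin 2) A) = mat2 1 0 0 1 :=
  mat2_ext (by simp [mat2]) (by simp [mat2]) (by simp [mat2]) (by simp [mat2])

/-- Complete positivity supplies positivity on matrices, and multiplicativity is checked entrywise.
This makes the limit theorem available for the extension to M₂, so that the limit is again a
2-quasitrace. -/
lemma isAsymptoticHom_amplification {β : ℕ → B →CP A} (h1 : ∀ n x, ‖β n x‖ ≤ ‖x‖)
    (hmul : ∀ x y : B, Tendsto (fun n => ‖β n (x * y) - β n x * β n y‖) atTop (𝓝 0)) :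
    IsAsymptoticHom fun n => amplification (β n).toLinearMap where
  nonneg n M hM := (β n).map_cstarMatrix_nonneg' 2 M hM
  map_one_le n := by
    have h := sub_nonneg.mpr ((β n).map_one_le (h1 n))
    rw [one_eq_mat2, amplification_mat2, one_eq_mat2, ← sub_nonneg, mat2_sub]
    simp only [map_zero, sub_self]
    exact mat2_diag_nonneg h h
  tendsto_mul M N := by
    have h := isAsymptoticHom_of_completelyPositive h1 hmul
    have hent : ∀ i j, Tendsto (fun n => (amplification (β n).toLinearMap (M * N) -
        amplification (β n).toLinearMap M * amplification (β n).toLinearMap N) i j) atTop (𝓝 0) := by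
      intro i j
      have := (h.tendsto_mul (M i 0) (N 0 j)).add (h.tendsto_mul (M i 1) (N 1 j))
      rw [add_zero] at this
      refine this.congr fun n => ?_
      have e1 : amplification (β n).toLinearMap (M * N) i j =
          (β n).toLinearMap (M i 0 * N 0 j + M i 1 * N 1 j) := by
        rw [← Fin.sum_univ_two (f := fun k => M i k * N k j), ← CStarMatrix.mul_apply]
        rfl
      have e2 : (amplification (β n).toLinearMap M * amplification (β n).toLinearMap N) i j =
          (β n).toLinearMap (M i 0) * (β n).toLinearMap (N 0 j) +
          (β n).toLinearMap (M i 1) * (β n).toLinearMap (N 1 j) := by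
        rw [CStarMatrix.mul_apply, Fin.sum_univ_two]
        rfl
      rw [CStarMatrix.sub_apply, e1, e2, map_add]
      abel
    exact tendsto_pi_nhds.mpr fun i => tendsto_pi_nhds.mpr fun j => hent i j

/-- The limit of a 2-quasitrace along asymptotically multiplicative completely positive maps is a
2-quasitrace. -/
lemma IsTwoQuasitrace.exists_limit {τ : A → ℂ} (hτ : IsTwoQuasitrace τ) {β : ℕ → B →CP A}
    (h1 : ∀ n x, ‖β n x‖ ≤ ‖x‖)
    (hmul : ∀ x y : B, Tendsto (fun n => ‖β n (x * y) - β n x * β n y‖) atTop (𝓝 0))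
    (ω : Ultrafilter ℕ) (hω : (ω : Filter ℕ) ≤ atTop) :
    ∃ σ : B → ℂ, IsTwoQuasitrace σ ∧
      ∀ x, IsSelfAdjoint x → Tendsto (fun n => (τ (β n x)).re) ω (𝓝 (σ x).re) := by
  obtain ⟨t₂, ht₂, hext⟩ := hτ.exists_extension
  have ht := hτ.1.isRealQuasitrace
  have hβ := isAsymptoticHom_of_completelyPositive h1 hmul
  have hβ₂ := isAsymptoticHom_amplification h1 hmul
  obtain ⟨s, hs⟩ := ht.exists_tendsto hβ ω
  obtain ⟨s₂, hs₂⟩ := ht₂.exists_tendsto hβ₂ ω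
  have hq := ht.limit (K := 2) (by norm_num) (fun x y hx hy => by
    have := ht.add_le_of_extension ht₂ hext hx hy one_pos
    rw [inv_one] at this
    linarith) hβ hω hs
  have hq₂ := ht₂.limit (K := 8) (by norm_num)
    (fun x y hx hy => ht.extension_add_le ht₂ hext hx hy) hβ₂ hω hs₂
  obtain ⟨σ, hσ, hσs⟩ := hq.exists_isQuasitrace
  obtain ⟨σ₂, hσ₂, hσs₂⟩ := hq₂.exists_isQuasitrace
  have hcorner : ∀ x : B, IsSelfAdjoint x → IsSelfAdjoint (mat2 x 0 0 0) := by
    intro x hx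
    rw [IsSelfAdjoint, mat2_star, hx.star_eq, star_zero]
  have hsa : ∀ x : B, IsSelfAdjoint x → σ₂ (mat2 x 0 0 0) = σ x := by
    intro x hx
    rw [hσs₂ _ (hcorner x hx), hσs x hx]
    congr 1
    refine tendsto_nhds_unique (hs₂ _ (hcorner x hx)) ((hs x hx).congr fun n => ?_)
    rw [amplification_mat2, map_zero, hext]
  refine ⟨σ, ⟨hσ, σ₂, hσ₂, fun x => ?_⟩, fun x hx => ?_⟩
  · rw [ofMatrix_single_eq_mat2]
    have e : mat2 x 0 0 0 = mat2 (realPart x : B) 0 0 0 +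
        Complex.I • mat2 (imaginaryPart x : B) 0 0 0 := by
      conv_lhs => rw [← realPart_add_I_smul_imaginaryPart x]
      exact mat2_ext rfl (by simp [mat2]) (by simp [mat2]) (by simp [mat2])
    have e2 := hσ₂.map_add_I_smul _ _ (hcorner _ (realPart x).2) (hcorner _ (imaginaryPart x).2)
    rw [e]
    refine e2.trans ?_
    rw [hsa _ (realPart x).2, hsa _ (imaginaryPart x).2,
      ← hσ.map_add_I_smul _ _ (realPart x).2 (imaginaryPart x).2,
      realPart_add_I_smul_imaginaryPart]
  · rw [hσs x hx, Complex.ofReal_re]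
    exact hs x hx

end Decomposition

/-! ### Approximation with small remainders -/

section Approximation

variable {A : Type u} [CStarAlgebra A] [PartialOrder A] [StarOrderedRing A]

/-- Condition (on a fixed functional) that `A` is approximated by algebras in `𝒯` with remainders of
small trace. -/
def HasSmallRemainders (τ : A → ℂ) : Prop :=
  ∀ ε : ℝ, 0 < ε → ∀ F : Finset A,
    ∃ (B : Type v) (_ : CStarAlgebra B) (_ : PartialOrder B) (_ : StarOrderedRing B)
      (α : A →CP B) (β : ℕ → B →CP A) (γ : ℕ → A →CP A),
      InT B ∧ IsApproxDecomposition (F : Set A) ε α β γ ∧ ∀ n, (τ (γ n 1)).re ≤ ε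

/-- Monotonicity gives `τ b ≤ τ (g + b)`. Conversely, Haagerup's inequality with parameter `e`
inflates `τ b` by the factor `1 + e` and `τ g` by `1 + 1/e`; since `τ g` has order `e²`, both errors
have order `e`. -/
lemma IsTwoQuasitrace.abs_sub_le_of_add {τ : A → ℂ} (hτ : IsTwoQuasitrace τ) {z b g : A}
    (hz : 0 ≤ z) (hb : 0 ≤ b) (hg : 0 ≤ g) {N e : ℝ} (he : 0 < e) (he1 : e ≤ 1)
    (hzN : ‖z‖ ≤ N) (hbz : ‖b‖ ≤ ‖z‖) (hg' : (τ g).re ≤ N * e ^ 2) (h : ‖z - (g + b)‖ ≤ e ^ 2) :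
    |(τ z).re - (τ b).re| ≤ e * ((1 + N) * (τ 1).re + 2 * N) := by
  obtain ⟨t₂, ht₂, hext⟩ := hτ.exists_extension
  have ht := hτ.1.isRealQuasitrace
  have h1 := ht.add_le_of_extension ht₂ hext hb hg he
  have h2 := ht.mono (.of_nonneg hb) (.of_nonneg (add_nonneg hb hg)) (le_add_of_nonneg_right hg)
  have h3 := ht.abs_sub_le (.of_nonneg hz) (.of_nonneg (add_nonneg hb hg))
  have h4 := ht.le_norm_mul (.of_nonneg hb)
  have h5 := ht.one_nonneg
  have hN : 0 ≤ N := (norm_nonneg z).trans hzN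
  rw [add_comm b g] at h1 h2 h3
  have h6 : ‖z - (g + b)‖ * (τ 1).re ≤ e * (τ 1).re := by
    refine mul_le_mul_of_nonneg_right (h.trans ?_) h5
    nlinarith
  have h7 : e * (τ b).re ≤ e * (N * (τ 1).re) :=
    mul_le_mul_of_nonneg_left (h4.trans (mul_le_mul_of_nonneg_right (hbz.trans hzN) h5)) he.le
  have h8 : (1 + e⁻¹) * (τ g).re ≤ e * (2 * N) := by
    calc _ ≤ (1 + e⁻¹) * (N * e ^ 2) := mul_le_mul_of_nonneg_left hg' (by positivity)
      _ = e * (N * (1 + e)) := by field_simp; ring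
      _ ≤ e * (2 * N) := by
        refine mul_le_mul_of_nonneg_left ?_ he.le
        nlinarith
  rw [abs_le] at h3 ⊢
  have h9 : 0 ≤ e * (2 * N) := by positivity
  have h10 : 0 ≤ e * (N * (τ 1).re) := by positivity
  constructor <;> linarith [h3.1, h3.2]

/-- A 2-quasitrace for which there are approximations by algebras in `𝒯` with small remainders is a
trace. -/
theorem IsTwoQuasitrace.isTrace_of_hasSmallRemainders {τ : A → ℂ} (hτ : IsTwoQuasitrace τ)
    (h : HasSmallRemainders.{u, v} τ) : IsTrace τ := by
  classical
  have ht := hτ.1.isRealQuasitrace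
  have h1 := ht.one_nonneg
  refine hτ.1.isTrace_of_add fun x y hx hy => ?_
  set N := ‖x‖ + ‖y‖
  have hN : 0 ≤ N := by positivity
  set C := 3 * ((1 + N) * (τ 1).re + 2 * N)
  have key : ∀ e : ℝ, 0 < e → e ≤ 1 → |(τ (x + y)).re - ((τ x).re + (τ y).re)| ≤ C * e := by
    intro e he he1
    -- Tolerance `e²` compensates for the factor `1/e` in Haagerup's inequality.
    obtain ⟨B, _, _, _, α, β, γ, hB, hd, hγ⟩ := h (e ^ 2) (by positivity) {x, y, x + y}
    obtain ⟨σ, hσ, hlim⟩ := hτ.exists_limit hd.contractive_β hd.tendsto_mul (hyperfilter ℕ)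
      Nat.hyperfilter_le_atTop
    have hest : ∀ z ∈ ({x, y, x + y} : Finset A), 0 ≤ z → ‖z‖ ≤ N →
        |(τ z).re - (σ (α z)).re| ≤ e * ((1 + N) * (τ 1).re + 2 * N) := by
      intro z hzF hz hzN
      have hα := α.nonneg_of_nonneg hz
      refine le_of_tendsto ((hlim (α z) (.of_nonneg hα)).const_sub _).abs
        (Eventually.of_forall fun n => ?_)
      have hg := (γ n).nonneg_of_nonneg hz
      refine hτ.abs_sub_le_of_add hz ((β n).nonneg_of_nonneg hα) hg he he1 hzN
        ((hd.contractive_β n _).trans (hd.contractive_α z)) ?_ (hd.approx z hzF n).le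
      have hγ1 := (γ n).nonneg_of_nonneg zero_le_one
      have h2 : γ n z ≤ ‖z‖ • γ n 1 := by
        have := OrderHomClass.mono (γ n) (IsSelfAdjoint.of_nonneg hz).le_algebraMap_norm_self
        rw [Algebra.algebraMap_eq_smul_one] at this
        rwa [← Complex.coe_smul, map_smul, Complex.coe_smul] at this
      have h3 := ht.mono (.of_nonneg hg) (.of_nonneg (smul_nonneg (norm_nonneg z) hγ1)) h2
      rw [ht.smul _ _ (.of_nonneg hγ1)] at h3
      refine h3.trans (mul_le_mul hzN (hγ n) (ht.nonneg _ hγ1) hN)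
    have hxF := hest x (by simp) hx (by simp only [N]; linarith [norm_nonneg y])
    have hyF := hest y (by simp) hy (by simp only [N]; linarith [norm_nonneg x])
    have hxyF := hest (x + y) (by simp) (add_nonneg hx hy) (norm_add_le x y)
    -- Membership of `B` in 𝒯 enters here.
    have hlin := (hB σ hσ).isLinear.map_add (α x) (α y)
    rw [map_add, hlin, Complex.add_re] at hxyF
    rw [abs_le] at hxF hyF hxyF ⊢
    simp only [C]
    constructor <;> linarith [hxF.1, hxF.2, hyF.1, hyF.2, hxyF.1, hxyF.2]
  have h0 : |(τ (x + y)).re - ((τ x).re + (τ y).re)| ≤ 0 := by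
    refine ge_of_tendsto (f := fun n : ℕ => C * (1 / ((n : ℝ) + 1))) (x := atTop) ?_
      (Eventually.of_forall fun n => key _ Nat.one_div_pos_of_nat ?_)
    · simpa using tendsto_one_div_add_atTop_nhds_zero_nat.const_mul C
    · rw [div_le_one (by positivity)]
      linarith [(Nat.cast_nonneg n : (0 : ℝ) ≤ n)]
  linarith [abs_nonpos_iff.mp h0]

/-- A 2-quasitrace is a trace if it vanishes at the unit. -/
lemma IsQuasitrace.isTrace_of_map_one_eq_zero {τ : A → ℂ} (hτ : IsQuasitrace τ)
    (h : (τ 1).re = 0) : IsTrace τ := by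
  have h0 : ∀ x : A, 0 ≤ x → (τ x).re = 0 := by
    intro x hx
    have := hτ.isRealQuasitrace.abs_le (.of_nonneg hx)
    simp only [h, mul_zero] at this
    exact abs_nonpos_iff.mp this
  exact hτ.isTrace_of_add fun x y hx hy => by
    rw [h0 _ (add_nonneg hx hy), h0 x hx, h0 y hy, add_zero]

lemma IsQuasitrace.const_mul {B : Type u} [CStarAlgebra B] {τ : B → ℂ} (hτ : IsQuasitrace τ)
    {r : ℝ} (hr : 0 ≤ r) : IsQuasitrace fun x => (r : ℂ) * τ x where
  nonneg x := mul_nonneg (by exact_mod_cast hr) (hτ.nonneg x)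
  star_mul_comm x := by rw [hτ.star_mul_comm]
  map_add_of_comm S hS hc x hx y hy := by rw [hτ.map_add_of_comm S hS hc x hx y hy, mul_add]
  map_smul_of_comm S hS hc c x hx := by rw [hτ.map_smul_of_comm S hS hc c x hx]; ring
  map_add_I_smul a b ha hb := by rw [hτ.map_add_I_smul a b ha hb]; ring

lemma IsTwoQuasitrace.const_mul {τ : A → ℂ} (hτ : IsTwoQuasitrace τ) {r : ℝ} (hr : 0 ≤ r) :
    IsTwoQuasitrace fun x => (r : ℂ) * τ x := by
  obtain ⟨h1, τ₂, h2, h3⟩ := hτ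
  exact ⟨h1.const_mul hr, fun x => (r : ℂ) * τ₂ x, h2.const_mul hr, fun x => congrArg (_ * ·) (h3 x)⟩

/-- It suffices to consider normalized 2-quasitraces. -/
lemma inT_of_forall_mem_QT (h : ∀ τ ∈ QT A, IsTrace τ) : InT A := by
  intro τ hτ
  have ht := hτ.1.isRealQuasitrace
  by_cases h0 : (τ 1).re = 0
  · exact hτ.1.isTrace_of_map_one_eq_zero h0
  have h1 : 0 < (τ 1).re := lt_of_le_of_ne ht.one_nonneg (Ne.symm h0)
  have h2 := h _ ⟨hτ.const_mul (inv_nonneg.mpr h1.le), by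
    have h2 := hτ.1.eq_re (.one A)
    change ((τ 1).re⁻¹ : ℝ) * τ 1 = 1
    generalize (τ 1).re = r at h0 h2
    rw [h2, ← Complex.ofReal_mul, inv_mul_cancel₀ h0, Complex.ofReal_one]⟩
  refine hτ.1.isTrace_of_add fun x y _ _ => ?_
  have h3 := congrArg Complex.re (h2.isLinear.map_add x y)
  simp only [Complex.add_re, Complex.re_ofReal_mul] at h3
  rw [← mul_add] at h3
  exact mul_left_cancel₀ (inv_ne_zero h0) h3

theorem inT_of_approximatedInQuasitraces
    (h : ApproximatedInQuasitraces (fun (B : Type v) [CStarAlgebra B] => InT B) A) : InT A := by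
  refine inT_of_forall_mem_QT fun τ hτ => hτ.1.isTrace_of_hasSmallRemainders fun ε hε F => ?_
  obtain ⟨B, i1, i2, i3, α, β, γ, hB, hd, hγ⟩ := h ε hε ε hε F
  refine ⟨B, i1, i2, i3, α, β, γ, hB, hd, fun n => (le_trans ?_ (hγ n).le)⟩
  -- An upper bound is required for the real supremum to dominate its members; `γ n 1 ≤ 1` and
  -- normalization give 1.
  refine le_csSup ⟨1, ?_⟩ (Set.mem_image_of_mem _ hτ)
  rintro _ ⟨τ', hτ', rfl⟩
  have hsa := IsSelfAdjoint.of_nonneg ((γ n).nonneg_of_nonneg (zero_le_one (α := A)))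
  have := hτ'.1.1.isRealQuasitrace.mono hsa (.one A) ((γ n).map_one_le (hd.contractive_γ n))
  simpa [hτ'.2] using this

end Approximation

/-! ### Cuntz subequivalence and quasitraces -/

section Comparison

variable {A : Type u} [CStarAlgebra A] [PartialOrder A] [StarOrderedRing A]

lemma mul_sqrt_eq_of_mul_eq {a g : A} (ha : 0 ≤ a) (h : g * a = a) :
    g * CFC.sqrt a = CFC.sqrt a := by
  have hr : IsSelfAdjoint (CFC.sqrt a) := .of_nonneg (CFC.sqrt_nonneg a)
  have h1 : ((1 - g) * CFC.sqrt a) * star ((1 - g) * CFC.sqrt a) = 0 := by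
    rw [star_mul, hr.star_eq, mul_assoc, ← mul_assoc (CFC.sqrt a), CFC.sqrt_mul_sqrt_self a ha,
      ← mul_assoc, sub_mul, one_mul, h, sub_self, zero_mul]
  rw [CStarRing.mul_star_self_eq_zero_iff, sub_mul, one_mul, sub_eq_zero] at h1
  exact h1.symm

/-- Up to small error `c` is `y⋆y` with `y = √a x`. The exchanged product `yy⋆` has `g` as a unit,
so its trace is at most `‖y‖² t g`. -/
lemma IsRealQuasitrace.le_of_cuntzLE {t : A → ℝ} (ht : IsRealQuasitrace t) {c a g : A}
    (hc : 0 ≤ c) (ha : 0 ≤ a) (hg : 0 ≤ g) (hg1 : g ≤ 1) (hga : g * a = a) (h : CuntzLE c a) :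
    t c ≤ ‖c‖ * t g := by
  obtain ⟨x, hx⟩ := h
  have hga' := mul_sqrt_eq_of_mul_eq ha hga
  have hr : IsSelfAdjoint (CFC.sqrt a) := .of_nonneg (CFC.sqrt_nonneg a)
  have key : ∀ i, t c ≤ (‖c‖ + ‖c - star (x i) * a * x i‖) * t g +
      ‖c - star (x i) * a * x i‖ * t 1 := by
    intro i
    set y := CFC.sqrt a * x i
    have e : star (x i) * a * x i = star y * y := by
      conv_lhs => rw [← CFC.sqrt_mul_sqrt_self a ha]
      simp only [y, star_mul, hr.star_eq, mul_assoc]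
    have h1 := ht.le_norm_mul_of_mul_eq (mul_star_self_nonneg y) hg hg1
      (by rw [← mul_assoc, ← mul_assoc, hga'])
    rw [← ht.star_mul_comm, CStarRing.norm_self_mul_star, ← CStarRing.norm_star_mul_self, ← e] at h1
    have h2 := ht.abs_sub_le (.of_nonneg hc) (e ▸ IsSelfAdjoint.star_mul_self y)
    have h3 : ‖star (x i) * a * x i‖ ≤ ‖c‖ + ‖c - star (x i) * a * x i‖ := by
      simpa using norm_sub_le c (c - star (x i) * a * x i)
    have h4 := mul_le_mul_of_nonneg_right h3 (ht.nonneg g hg)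
    linarith [(_root_.abs_le.mp h2).2]
  refine ge_of_tendsto (x := atTop) ?_ (Eventually.of_forall key)
  simpa using ((hx.const_add ‖c‖).mul_const (t g)).add (hx.mul_const (t 1))

lemma hasSmallRemainders_of_asymptoticallyTraciallyIn {τ : A → ℂ} (hτ : IsQuasitrace τ)
    (h : AsymptoticallyTraciallyIn (fun (B : Type v) [CStarAlgebra B] => InT B) A)
    (hs : ∀ ε : ℝ, 0 < ε → ∃ a g : A, 0 ≤ a ∧ a ≠ 0 ∧ 0 ≤ g ∧ g ≤ 1 ∧ g * a = a ∧ (τ g).re ≤ ε) :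
    HasSmallRemainders.{u, v} τ := by
  intro ε hε F
  obtain ⟨a, g, ha, ha0, hg, hg1, hga, hτg⟩ := hs ε hε
  obtain ⟨B, i1, i2, i3, α, β, γ, hB, hd, hγ⟩ := h F ε hε a ha ha0
  refine ⟨B, i1, i2, i3, α, β, γ, hB, hd, fun n => ?_⟩
  have h1 := (γ n).nonneg_of_nonneg (zero_le_one (α := A))
  have h2 := hτ.isRealQuasitrace.le_of_cuntzLE h1 ha hg hg1 hga (hγ n)
  have h3 : ‖γ n 1‖ ≤ 1 := CStarAlgebra.norm_le_one_iff_of_nonneg _ h1 |>.mpr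
    ((γ n).map_one_le (hd.contractive_γ n))
  exact (h2.trans (mul_le_of_le_one_left (hτ.isRealQuasitrace.nonneg g hg) h3)).trans hτg

end Comparison

/-! ### Bounding orthogonal families and spectra -/

section OrthogonalFamilies

variable {A : Type u} [CStarAlgebra A] [PartialOrder A] [StarOrderedRing A]

/-- Take `b = (a - ‖a‖/2)₊`, nonzero because `‖a‖` lies in the spectrum, and `g` the function of `a`
equal to 1 above `‖a‖/2` and linear below. That `g` is a multiple of `a` on both sides makes the
units of orthogonal elements orthogonal. -/
lemma exists_local_unit {a : A} (ha : 0 ≤ a) (ha0 : a ≠ 0) : ∃ b g k : A, 0 ≤ b ∧ b ≠ 0 ∧ 0 ≤ g ∧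
    g ≤ 1 ∧ g * b = b ∧ g = a * k ∧ g = k * a := by
  have hn : Nontrivial A := ⟨a, 0, ha0⟩
  have hsa := IsSelfAdjoint.of_nonneg ha
  have hpos : 0 < ‖a‖ / 2 := half_pos (norm_pos_iff.mpr ha0)
  have hm : ∀ s : ℝ, 0 < max s (‖a‖ / 2) := fun s => lt_max_of_lt_right hpos
  have hk : Continuous fun s : ℝ => (max s (‖a‖ / 2))⁻¹ :=
    Continuous.inv₀ (by fun_prop) fun s => (hm s).ne'
  have hgc : Continuous fun s : ℝ => s * (max s (‖a‖ / 2))⁻¹ := continuous_id.mul hk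
  refine ⟨cfc (fun s : ℝ => max 0 (s - ‖a‖ / 2)) a, cfc (fun s : ℝ => s * (max s (‖a‖ / 2))⁻¹) a,
    cfc (fun s : ℝ => (max s (‖a‖ / 2))⁻¹) a, cfc_nonneg fun s _ => le_max_left _ _, fun h => ?_,
    cfc_nonneg fun s hs => mul_nonneg (spectrum_nonneg_of_nonneg ha hs) (inv_nonneg.mpr (hm s).le),
    cfc_le_one _ _ fun s _ => ?_, ?_, ?_, ?_⟩
  · rw [← cfc_zero ℝ a] at h
    have := eqOn_of_cfc_eq_cfc h (by fun_prop) continuousOn_const hsa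
      (CStarAlgebra.norm_mem_spectrum_of_nonneg ha)
    simp only [Pi.zero_apply] at this
    have h2 := le_max_right 0 (‖a‖ - ‖a‖ / 2)
    linarith
  · rw [← div_eq_mul_inv, div_le_one (hm s)]
    exact le_max_left _ _
  · rw [← cfc_mul _ _ a hgc.continuousOn (by fun_prop)]
    refine cfc_congr fun s _ => ?_
    rcases le_total s (‖a‖ / 2) with h | h
    · simp [max_eq_left (by linarith : s - ‖a‖ / 2 ≤ 0)]
    · have : s ≠ 0 := (hpos.trans_le h).ne'
      simp only [max_eq_left h, mul_inv_cancel₀ this, one_mul]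
  · rw [cfc_mul (fun s => s) _ a (by fun_prop) hk.continuousOn, cfc_id' ℝ a]
  · rw [← cfc_congr (fun s _ => mul_comm ((max s (‖a‖ / 2))⁻¹) s),
      cfc_mul _ (fun s => s) a hk.continuousOn (by fun_prop), cfc_id' ℝ a]

lemma sum_le_one_of_orthogonal {ι : Type*} (s : Finset ι) (g : ι → A)
    (h1 : ∀ i, g i ≤ 1) (h : ∀ i ∈ s, ∀ j ∈ s, i ≠ j → g i * g j = 0) : ∑ i ∈ s, g i ≤ 1 := by
  classical
  induction s using Finset.induction_on with
  | empty => simp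
  | insert a s ha ih =>
    have ih' := ih fun i hi j hj => h i (Finset.mem_insert_of_mem hi) j (Finset.mem_insert_of_mem hj)
    have e1 : g a * ∑ i ∈ s, g i = 0 := by
      rw [Finset.mul_sum]
      exact Finset.sum_eq_zero fun i hi => h a (Finset.mem_insert_self a s) i
        (Finset.mem_insert_of_mem hi) (fun e => ha (e ▸ hi))
    have e2 : (∑ i ∈ s, g i) * g a = 0 := by
      rw [Finset.sum_mul]
      exact Finset.sum_eq_zero fun i hi => h i (Finset.mem_insert_of_mem hi) a
        (Finset.mem_insert_self a s) (fun e => ha (e ▸ hi))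
    have hc : Commute (g a) (∑ i ∈ s, g i) := e1.trans e2.symm
    have := Commute.mul_nonneg (sub_nonneg.mpr (h1 a)) (sub_nonneg.mpr ih')
      (((Commute.one_left _).sub_left (((Commute.one_right _).sub_right hc))))
    rw [sub_mul, mul_sub, mul_sub, e1] at this
    rw [Finset.sum_insert ha, ← sub_nonneg]
    convert this using 1
    simp only [mul_one, one_mul]
    abel

/-- Each member of the family dominates, up to a factor, a unit of trace greater than `ε`. These
units are orthogonal with sum at most 1, so their traces add up to at most `t 1`. -/
lemma IsRealQuasitrace.card_mul_le {t : A → ℝ} (ht : IsRealQuasitrace t) {ε : ℝ}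
    (hε : ∀ a g : A, 0 ≤ a → a ≠ 0 → 0 ≤ g → g ≤ 1 → g * a = a → ε < t g) (s : Finset A)
    (h0 : ∀ a ∈ s, 0 ≤ a ∧ a ≠ 0) (h : ∀ a ∈ s, ∀ b ∈ s, a ≠ b → a * b = 0) :
    s.card * ε ≤ t 1 := by
  have hex : ∀ a : s, ∃ g k : A, 0 ≤ g ∧ g ≤ 1 ∧ g = (a : A) * k ∧ g = k * a ∧ ε < t g := by
    intro a
    obtain ⟨b, g, k, hb, hb0, hg, hg1, hgb, e1, e2⟩ := exists_local_unit (h0 a a.2).1 (h0 a a.2).2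
    exact ⟨g, k, hg, hg1, e1, e2, hε b g hb hb0 hg hg1 hgb⟩
  choose g k hg hg1 e1 e2 hgε using hex
  have horth : ∀ i ∈ s.attach, ∀ j ∈ s.attach, i ≠ j → g i * g j = 0 := by
    intro i _ j _ hij
    rw [e2 i, e1 j, mul_assoc, ← mul_assoc (i : A),
      h i i.2 j j.2 (fun e => hij (Subtype.ext e)), zero_mul, mul_zero]
  have hsa : ∀ i, IsSelfAdjoint (g i) := fun i => .of_nonneg (hg i)
  calc s.card * ε = ∑ _i ∈ s.attach, ε := by simp
    _ ≤ ∑ i ∈ s.attach, t (g i) := Finset.sum_le_sum fun i _ => (hgε i).le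
    _ = t (∑ i ∈ s.attach, g i) := by
      refine (ht.sum_of_commute _ _ (fun i _ => hsa i) fun i hi j hj => ?_).symm
      by_cases e : i = j
      · rw [e]
      · exact (horth i hi j hj e).trans (horth j hj i hi (Ne.symm e)).symm
    _ ≤ t 1 := ht.mono (isSelfAdjoint_sum _ fun i _ => hsa i) (.one A)
      (sum_le_one_of_orthogonal _ g hg1 horth)

/-- If the number of elements of orthogonal families is bounded, spectra are finite. -/
lemma finite_spectrum_of_card_le {m : ℕ} (hm : ∀ s : Finset A, (∀ a ∈ s, 0 ≤ a ∧ a ≠ 0) →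
    (∀ a ∈ s, ∀ b ∈ s, a ≠ b → a * b = 0) → s.card ≤ m) {y : A} (hy : IsSelfAdjoint y) :
    (spectrum ℝ y).Finite := by
  classical
  by_contra hinf
  -- Two extra points rather than one, so that `S.erase l` is nonempty even when `m = 0`;
  -- `Metric.infDist` to the empty set would be 0.
  obtain ⟨S, hS, hcard⟩ := Set.Infinite.exists_subset_card_eq hinf (m + 2)
  -- This bump is supported where `s` is closer to `l` than to the rest of `S`, so bumps at
  -- different points are orthogonal.
  let f : ℝ → ℝ → ℝ := fun l s => max 0 (Metric.infDist s (S.erase l : Set ℝ) - |s - l|)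
  have hf : ∀ l, Continuous (f l) := fun l => continuous_const.max
    ((Metric.continuous_infDist_pt _).sub (continuous_id.sub continuous_const).abs)
  have hpos : ∀ l ∈ S, 0 < f l l := by
    intro l hl
    have hne : (S.erase l : Set ℝ).Nonempty := by
      rw [Finset.coe_nonempty, ← Finset.card_pos, Finset.card_erase_of_mem hl]
      omega
    have := (IsClosed.notMem_iff_infDist_pos (S.erase l).finite_toSet.isClosed hne (x := l)).mp
      (by simp)
    simp only [f, sub_self, abs_zero, sub_zero]
    exact lt_max_of_lt_right this
  have horth : ∀ l ∈ S, ∀ l' ∈ S, l ≠ l' → ∀ s, f l s * f l' s = 0 := by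
    intro l hl l' hl' hne s
    have h1 : Metric.infDist s (S.erase l : Set ℝ) ≤ |s - l'| := by
      rw [← Real.dist_eq]
      exact Metric.infDist_le_dist_of_mem (by simp [hl', hne.symm])
    have h2 : Metric.infDist s (S.erase l' : Set ℝ) ≤ |s - l| := by
      rw [← Real.dist_eq]
      exact Metric.infDist_le_dist_of_mem (by simp [hl, hne])
    rcases le_total |s - l| |s - l'| with h | h
    · have : f l' s = 0 := max_eq_left (by linarith)
      rw [this, mul_zero]
    · have : f l s = 0 := max_eq_left (by linarith)
      rw [this, zero_mul]
  have hne0 : ∀ l ∈ S, cfc (f l) y ≠ 0 := by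
    intro l hl h
    rw [← cfc_zero ℝ y] at h
    have := eqOn_of_cfc_eq_cfc h (hf l).continuousOn (continuousOn_const) hy (hS hl)
    exact (hpos l hl).ne' this
  have hmul : ∀ l ∈ S, ∀ l' ∈ S, l ≠ l' → cfc (f l) y * cfc (f l') y = 0 := by
    intro l hl l' hl' hne
    rw [← cfc_mul _ _ y (hf l).continuousOn (hf l').continuousOn,
      cfc_congr (g := fun _ => (0 : ℝ)) fun s _ => horth l hl l' hl' hne s, cfc_const_zero]
  have h0 : ∀ l, 0 ≤ cfc (f l) y := fun l => cfc_nonneg fun s _ => le_max_left _ _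
  have hinj : Set.InjOn (fun l => cfc (f l) y) S := by
    intro l hl l' hl' e
    by_contra hne
    have h1 := hmul l hl l' hl' hne
    simp only at e
    rw [← e] at h1
    refine hne0 l hl ?_
    rw [← CStarRing.star_mul_self_eq_zero_iff, (IsSelfAdjoint.of_nonneg (h0 l)).star_eq, h1]
  have := hm (S.image fun l => cfc (f l) y) (by
    intro a ha
    obtain ⟨l, hl, rfl⟩ := Finset.mem_image.mp ha
    exact ⟨h0 l, hne0 l hl⟩) (by
    intro a ha b hb hab
    obtain ⟨l, hl, rfl⟩ := Finset.mem_image.mp ha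
    obtain ⟨l', hl', rfl⟩ := Finset.mem_image.mp hb
    exact hmul l hl l' hl' fun e => hab (by rw [e]))
  rw [Finset.card_image_of_injOn hinj] at this
  omega

end OrthogonalFamilies

/-! ### Minimal projections and the finite-dimensional case -/

section MinimalProjections

variable {A : Type u} [CStarAlgebra A] [PartialOrder A] [StarOrderedRing A]

/-- A projection `p ≠ 0` is minimal if `pAp` consists of the scalar multiples of `p`. -/
structure IsMinimalProjection (p : A) : Prop where
  isStarProjection : IsStarProjection p
  ne_zero : p ≠ 0
  exists_smul : ∀ y : A, ∃ c : ℂ, p * y * p = c • p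

/-- A spectral projection of `z` under `p`, which is proper unless `z` is a multiple of `p`. -/
lemma eq_smul_or_exists_projection {z p : A} (hz : IsSelfAdjoint z) (hfin : (spectrum ℝ z).Finite)
    (hp : IsStarProjection p) (hp0 : p ≠ 0) (hzp : z * p = z) (hpz : p * z = z) :
    (∃ c : ℝ, z = c • p) ∨ ∃ q : A, ∃ c : ℝ, IsStarProjection q ∧ q ≠ 0 ∧ q ≠ p ∧ q * p = q ∧
      p * q = q ∧ z * q = c • q ∧ ∀ x : A, Commute z x → Commute p x → Commute q x := by
  classical
  let f : ℝ → ℝ → ℝ := fun l s => if s = l then 1 else 0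
  have hf : ∀ l, ContinuousOn (f l) (spectrum ℝ z) := fun l => hfin.continuousOn _
  -- The factor `p` matters for the eigenvalue 0, whose spectral projection in `A` also contains `1
  -- - p`.
  let q : ℝ → A := fun l => cfc (f l) z * p
  have hcomm : ∀ l, Commute (cfc (f l) z) p := fun l =>
    Commute.cfc_real (a := z) (b := p) (hzp.trans hpz.symm) (f l)
  have hχ : ∀ l, IsStarProjection (cfc (f l) z) := fun l =>
    ⟨by
      rw [IsIdempotentElem, ← cfc_mul _ _ z (hf l) (hf l)]
      exact cfc_congr fun s _ => by simp [f], IsSelfAdjoint.cfc_real _ _⟩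
  have hzq : ∀ l, z * q l = l • q l := by
    intro l
    have : z * cfc (f l) z = l • cfc (f l) z := by
      nth_rewrite 1 [← cfc_id' ℝ z]
      rw [← cfc_mul (fun s => s) (f l) z (by fun_prop) (hf l), ← cfc_smul l (f l) z (hf l)]
      refine cfc_congr fun s _ => ?_
      by_cases h : s = l <;> simp [f, h]
    simp only [q]
    rw [← mul_assoc, this, smul_mul_assoc]
  have hsum : ∑ l ∈ hfin.toFinset, q l = p := by
    simp only [q]
    rw [← Finset.sum_mul, ← cfc_sum _ _ _ (fun i _ => hf i)]
    have : cfc (∑ i ∈ hfin.toFinset, f i) z = 1 := by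
      rw [← cfc_one ℝ z]
      refine cfc_congr fun s hs => ?_
      simp [Finset.sum_apply, f, hs]
    rw [this, one_mul]
  obtain ⟨l, -, hl⟩ : ∃ l ∈ hfin.toFinset, q l ≠ 0 := by
    by_contra! h
    exact hp0 (hsum ▸ Finset.sum_eq_zero h)
  by_cases hlp : q l = p
  · exact .inl ⟨l, by rw [← hlp, ← hzq, hlp, hzp]⟩
  · refine .inr ⟨q l, l, (hχ l).mul hp (hcomm l), hl, hlp, ?_, ?_, hzq l, fun x hx hpx => ?_⟩
    · simp only [q]
      rw [mul_assoc, hp.isIdempotentElem.eq]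
    · simp only [q]
      rw [← mul_assoc, ← (hcomm l).eq, mul_assoc, hp.isIdempotentElem.eq]
    · exact (Commute.cfc_real hx (f l)).mul_left hpx

/-- A finite orthogonal family of nonzero projections commuting with `x`, with sum `1`. -/
structure IsProjectionFamily (x : A) (s : Finset A) : Prop where
  isStarProjection : ∀ p ∈ s, IsStarProjection p
  ne_zero : ∀ p ∈ s, p ≠ 0
  commute : ∀ p ∈ s, Commute p x
  orthogonal : ∀ p ∈ s, ∀ q ∈ s, p ≠ q → p * q = 0
  sum_eq : ∑ p ∈ s, p = 1

/-- A proper subprojection `q` of `p` commuting with `x` splits `p` into `q` and `p - q`. Hence in a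
family of maximal cardinality no member has such a `q`. -/
lemma IsProjectionFamily.exists_card_lt {x : A} {s : Finset A} (hs : IsProjectionFamily x s)
    {p q : A} (hp : p ∈ s) (hq : IsStarProjection q) (hq0 : q ≠ 0) (hqp : q ≠ p)
    (h1 : q * p = q) (h2 : p * q = q) (hqx : Commute q x) :
    ∃ s', IsProjectionFamily x s' ∧ s.card < s'.card := by
  classical
  have hpp := (hs.isStarProjection p hp).isIdempotentElem.eq
  have hqq := hq.isIdempotentElem.eq
  have hr0 : p - q ≠ 0 := fun e => hqp (sub_eq_zero.mp e).symm
  have horth : ∀ r ∈ s.erase p, p * r = 0 ∧ r * p = 0 := fun r hr =>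
    ⟨hs.orthogonal p hp r (Finset.mem_of_mem_erase hr) (Finset.ne_of_mem_erase hr).symm,
      hs.orthogonal r (Finset.mem_of_mem_erase hr) p hp (Finset.ne_of_mem_erase hr)⟩
  have hqr : ∀ r ∈ s.erase p, q * r = 0 ∧ r * q = 0 := fun r hr =>
    ⟨by rw [← h1, mul_assoc, (horth r hr).1, mul_zero],
      by rw [← h2, ← mul_assoc, (horth r hr).2, zero_mul]⟩
  have hn1 : p - q ∉ s.erase p := fun h => hr0 (by
    have := (horth _ h).1
    rwa [mul_sub, hpp, h2] at this)
  have hn2 : q ∉ insert (p - q) (s.erase p) := by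
    intro h
    rcases Finset.mem_insert.mp h with h | h
    · refine hq0 ?_
      have h3 : q * q = q * (p - q) := congrArg (q * ·) h
      rwa [mul_sub, h1, hqq, sub_self] at h3
    · have := (hqr _ h).1
      rw [hqq] at this
      exact hq0 this
  refine ⟨insert q (insert (p - q) (s.erase p)), ⟨?_, ?_, ?_, ?_, ?_⟩, ?_⟩
  · simp only [Finset.mem_insert]
    rintro r (rfl | rfl | hr)
    · exact hq
    · exact hq.sub_of_mul_eq_left (hs.isStarProjection p hp) h1
    · exact hs.isStarProjection r (Finset.mem_of_mem_erase hr)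
  · simp only [Finset.mem_insert]
    rintro r (rfl | rfl | hr)
    · exact hq0
    · exact hr0
    · exact hs.ne_zero r (Finset.mem_of_mem_erase hr)
  · simp only [Finset.mem_insert]
    rintro r (rfl | rfl | hr)
    · exact hqx
    · exact (hs.commute p hp).sub_left hqx
    · exact hs.commute r (Finset.mem_of_mem_erase hr)
  · have e1 : q * (p - q) = 0 := by rw [mul_sub, h1, hqq, sub_self]
    have e2 : (p - q) * q = 0 := by rw [sub_mul, h2, hqq, sub_self]
    have e3 : ∀ r ∈ s.erase p, (p - q) * r = 0 ∧ r * (p - q) = 0 := fun r hr =>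
      ⟨by rw [sub_mul, (horth r hr).1, (hqr r hr).1, sub_zero],
        by rw [mul_sub, (horth r hr).2, (hqr r hr).2, sub_zero]⟩
    intro a ha b hb hab
    rcases Finset.mem_insert.mp ha with rfl | ha'
    · rcases Finset.mem_insert.mp hb with rfl | hb'
      · exact absurd rfl hab
      rcases Finset.mem_insert.mp hb' with rfl | hb'
      · exact e1
      · exact (hqr b hb').1
    · rcases Finset.mem_insert.mp ha' with rfl | ha2
      · rcases Finset.mem_insert.mp hb with rfl | hb'
        · exact e2
        rcases Finset.mem_insert.mp hb' with rfl | hb2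
        · exact absurd rfl hab
        · exact (e3 b hb2).1
      · rcases Finset.mem_insert.mp hb with rfl | hb'
        · exact (hqr a ha2).2
        rcases Finset.mem_insert.mp hb' with rfl | hb2
        · exact (e3 a ha2).2
        · exact hs.orthogonal a (Finset.mem_of_mem_erase ha2) b (Finset.mem_of_mem_erase hb2) hab
  · rw [Finset.sum_insert hn2, Finset.sum_insert hn1, ← add_assoc, add_sub_cancel,
      Finset.add_sum_erase s (fun r => r) hp, hs.sum_eq]
  · rw [Finset.card_insert_of_notMem hn2, Finset.card_insert_of_notMem hn1,
      Finset.card_erase_of_mem hp]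
    have := Finset.card_pos.mpr ⟨p, hp⟩
    omega

/-- If the number of elements of orthogonal families is bounded, self-adjoint elements are
diagonalized by minimal projections. -/
lemma exists_minimal_projections [Nontrivial A] {m : ℕ}
    (hm : ∀ s : Finset A, (∀ a ∈ s, 0 ≤ a ∧ a ≠ 0) →
      (∀ a ∈ s, ∀ b ∈ s, a ≠ b → a * b = 0) → s.card ≤ m) {x : A} (hx : IsSelfAdjoint x) :
    ∃ s : Finset A, IsProjectionFamily x s ∧ (∀ p ∈ s, IsMinimalProjection p) ∧
      ∃ r : A → ℝ, x = ∑ p ∈ s, r p • p := by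
  let N : Set ℕ := {n | ∃ s : Finset A, IsProjectionFamily x s ∧ s.card = n}
  have hne : N.Nonempty := ⟨1, {1}, ⟨by simp [IsStarProjection.one], by simp, by simp, by simp,
    by simp⟩, by simp⟩
  have hbdd : BddAbove N := ⟨m, by
    rintro _ ⟨s, hs, rfl⟩
    exact hm s (fun a ha => ⟨(hs.isStarProjection a ha).nonneg, hs.ne_zero a ha⟩) hs.orthogonal⟩
  obtain ⟨s, hs, hcard⟩ := Nat.sSup_mem hne hbdd
  have hmax : ∀ s', IsProjectionFamily x s' → ¬ s.card < s'.card := fun s' hs' h =>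
    (h.trans_le (le_csSup hbdd ⟨s', hs', rfl⟩)).ne hcard
  -- A non-scalar `xp` would have a proper spectral projection under `p` that commutes with `x`,
  -- contradicting maximality.
  have hr : ∀ p ∈ s, ∃ r : ℝ, x * p = r • p := by
    intro p hp
    have hpp := hs.isStarProjection p hp
    have hc := hs.commute p hp
    have hz : IsSelfAdjoint (x * p) := (IsSelfAdjoint.commute_iff hx hpp.isSelfAdjoint).mp hc.symm
    rcases eq_smul_or_exists_projection hz (finite_spectrum_of_card_le hm hz) hpp
      (hs.ne_zero p hp) (by rw [mul_assoc, hpp.isIdempotentElem.eq])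
      (by rw [← mul_assoc, hc.eq, mul_assoc, hpp.isIdempotentElem.eq])
      with h | ⟨q, c, hq, hq0, hqp, h1, h2, -, h3⟩
    · exact h
    · obtain ⟨s', hs', h'⟩ := hs.exists_card_lt hp hq hq0 hqp h1 h2
        (h3 x ((Commute.refl x).mul_left hc) hc)
      exact absurd h' (hmax s' hs')
  -- Since `x` acts on `p` as a scalar, every projection under `p` commutes with `x`, so maximality
  -- now excludes all proper subprojections.
  have hmin : ∀ p ∈ s, ∀ y : A, IsSelfAdjoint y → ∃ c : ℝ, p * y * p = c • p := by
    intro p hp y hy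
    have hpp := hs.isStarProjection p hp
    have hz : IsSelfAdjoint (p * y * p) := by
      have := hy.conjugate p
      rwa [hpp.isSelfAdjoint.star_eq] at this
    rcases eq_smul_or_exists_projection hz (finite_spectrum_of_card_le hm hz) hpp
      (hs.ne_zero p hp) (by rw [mul_assoc, hpp.isIdempotentElem.eq])
      (by rw [← mul_assoc, ← mul_assoc, hpp.isIdempotentElem.eq])
      with h | ⟨q, c, hq, hq0, hqp, h1, h2, -, -⟩
    · exact h
    · obtain ⟨r, hr⟩ := hr p hp
      have e1 : x * q = r • q := by rw [← h2, ← mul_assoc, hr, smul_mul_assoc]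
      have e2 : q * x = r • q := by
        rw [← h1, mul_assoc, (hs.commute p hp).eq, hr, mul_smul_comm]
      obtain ⟨s', hs', h'⟩ := hs.exists_card_lt hp hq hq0 hqp h1 h2 (e2.trans e1.symm)
      exact absurd h' (hmax s' hs')
  refine ⟨s, hs, fun p hp => ⟨hs.isStarProjection p hp, hs.ne_zero p hp, fun y => ?_⟩, ?_⟩
  · obtain ⟨c, hc⟩ := hmin p hp _ (realPart y).2
    obtain ⟨d, hd⟩ := hmin p hp _ (imaginaryPart y).2
    refine ⟨c + Complex.I * d, ?_⟩
    conv_lhs => rw [← realPart_add_I_smul_imaginaryPart y]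
    rw [mul_add, add_mul, hc, mul_smul_comm, smul_mul_assoc, hd, add_smul, mul_smul,
      Complex.coe_smul, Complex.coe_smul]
  · choose! r hr' using hr
    refine ⟨r, ?_⟩
    rw [← Finset.sum_congr rfl hr', ← Finset.mul_sum, hs.sum_eq, mul_one]

/-- The elements annihilated by `pA` form a closed two-sided ideal. It does not contain 1 as `p ≠
0`, so by simplicity it is zero and does not contain `q`. -/
lemma IsSimpleCStarAlgebra.exists_mul_mul_ne_zero (hA : IsSimpleCStarAlgebra A) {p q : A}
    (hp : p ≠ 0) (hq : q ≠ 0) : ∃ a : A, p * a * q ≠ 0 := by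
  by_contra! h
  let J : TwoSidedIdeal A := .mk' {y | ∀ a : A, p * a * y = 0} (by simp)
    (fun {x y} hx hy a => by rw [mul_add, hx a, hy a, add_zero])
    (fun {x} hx a => by rw [mul_neg, hx a, neg_zero])
    (fun {x y} hy a => by rw [← mul_assoc, mul_assoc p a x]; exact hy _)
    (fun {x y} hx a => by rw [← mul_assoc, hx a, zero_mul])
  have hJ : ∀ y, y ∈ J ↔ ∀ a : A, p * a * y = 0 := fun y => TwoSidedIdeal.mem_mk' _ _ _ _ _ _ _
  have hcl : IsClosed (J : Set A) := by
    have : (J : Set A) = ⋂ a : A, {y | p * a * y = 0} := by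
      ext y
      simp [hJ]
    rw [this]
    exact isClosed_iInter fun a => isClosed_eq (by fun_prop) continuous_const
  rcases hA J hcl with e | e
  · have : q ∈ J := (hJ q).mpr h
    rw [e, TwoSidedIdeal.mem_bot] at this
    exact hq this
  · have : (1 : A) ∈ J := by rw [e]; trivial
    exact hp (by simpa using (hJ 1).mp this 1)

/-- In a simple algebra, quasitraces agree on minimal projections. -/
lemma IsQuasitrace.eq_of_isMinimalProjection {τ : A → ℂ} (hτ : IsQuasitrace τ)
    (hA : IsSimpleCStarAlgebra A) {p q : A} (hp : IsMinimalProjection p)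
    (hq : IsMinimalProjection q) : τ p = τ q := by
  obtain ⟨a, ha⟩ := IsSimpleCStarAlgebra.exists_mul_mul_ne_zero hA hp.ne_zero hq.ne_zero
  have hps := hp.isStarProjection
  have hqs := hq.isStarProjection
  set v := p * a * q
  have hpv : p * v = v := by
    simp only [v]; rw [← mul_assoc, ← mul_assoc, hps.isIdempotentElem.eq]
  have hvq : v * q = v := by simp only [v]; rw [mul_assoc, hqs.isIdempotentElem.eq]
  have hvp : star v * p = star v := by
    simpa [hps.isSelfAdjoint.star_eq] using congrArg star hpv
  have hqv : q * star v = star v := by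
    simpa [hqs.isSelfAdjoint.star_eq] using congrArg star hvq
  obtain ⟨c, hc⟩ := hp.exists_smul (v * star v)
  obtain ⟨d, hd⟩ := hq.exists_smul (star v * v)
  rw [← mul_assoc, hpv, mul_assoc, hvp] at hc
  rw [← mul_assoc, hqv, mul_assoc, hvq] at hd
  have hcd : c • v = d • v := by
    calc c • v = v * star v * v := by rw [hc, smul_mul_assoc, hpv]
      _ = d • v := by rw [mul_assoc, hd, mul_smul_comm, hvq]
  have hcd' : c = d := smul_left_injective ℂ ha hcd
  have hc0 : c ≠ 0 := by
    rintro rfl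
    rw [zero_smul, CStarRing.mul_star_self_eq_zero_iff] at hc
    exact ha hc
  have := hτ.star_mul_comm v
  rw [hc, hd, hτ.smul_of_isSelfAdjoint _ hps.isSelfAdjoint,
    hτ.smul_of_isSelfAdjoint _ hqs.isSelfAdjoint, ← hcd'] at this
  exact (mul_left_cancel₀ hc0 this).symm

/-- The scalar `c` with `p y p = c p`, for a minimal projection `p` (and `0` if there is none). -/
noncomputable def compressionCoeff (p y : A) : ℂ :=
  open scoped Classical in if h : ∃ c : ℂ, p * y * p = c • p then h.choose else 0

namespace IsMinimalProjection

variable {p q : A}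

lemma compressionCoeff_smul (hp : IsMinimalProjection p) (y : A) :
    p * y * p = compressionCoeff p y • p := by
  rw [compressionCoeff, dif_pos (hp.exists_smul y)]
  exact (hp.exists_smul y).choose_spec

lemma compressionCoeff_eq (hp : IsMinimalProjection p) {y : A} {c : ℂ} (h : p * y * p = c • p) :
    compressionCoeff p y = c :=
  smul_left_injective ℂ hp.ne_zero ((hp.compressionCoeff_smul y).symm.trans h)

lemma compressionCoeff_add (hp : IsMinimalProjection p) (x y : A) :
    compressionCoeff p (x + y) = compressionCoeff p x + compressionCoeff p y :=
  hp.compressionCoeff_eq (by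
    rw [mul_add, add_mul, hp.compressionCoeff_smul, hp.compressionCoeff_smul, add_smul])

lemma compressionCoeff_real_smul (hp : IsMinimalProjection p) (r : ℝ) (x : A) :
    compressionCoeff p (r • x) = r * compressionCoeff p x :=
  hp.compressionCoeff_eq (by
    rw [mul_smul_comm, smul_mul_assoc, hp.compressionCoeff_smul, mul_smul, Complex.coe_smul])

lemma compressionCoeff_zero (hp : IsMinimalProjection p) : compressionCoeff p 0 = 0 :=
  hp.compressionCoeff_eq (by simp)

lemma compressionCoeff_sum (hp : IsMinimalProjection p) (s : Finset A) (f : A → A) :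
    compressionCoeff p (∑ i ∈ s, f i) = ∑ i ∈ s, compressionCoeff p (f i) := by
  classical
  induction s using Finset.induction_on with
  | empty => simp [hp.compressionCoeff_zero]
  | insert a s ha ih => rw [Finset.sum_insert ha, Finset.sum_insert ha, hp.compressionCoeff_add, ih]

lemma compressionCoeff_one (hp : IsMinimalProjection p) : compressionCoeff p 1 = 1 :=
  hp.compressionCoeff_eq (by rw [mul_one, one_smul, hp.isStarProjection.isIdempotentElem.eq])

/-- Symmetry of transition probabilities: evaluating `(pq)(qp)(pq)` with either bracketing yields
both coefficients times `pq`. -/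
lemma compressionCoeff_comm (hp : IsMinimalProjection p) (hq : IsMinimalProjection q) :
    compressionCoeff p q = compressionCoeff q p := by
  have h1 : (p * q) * (q * p) = compressionCoeff p q • p := by
    rw [← hp.compressionCoeff_smul, mul_assoc, ← mul_assoc q q,
      hq.isStarProjection.isIdempotentElem.eq, mul_assoc]
  have h2 : (q * p) * (p * q) = compressionCoeff q p • q := by
    rw [← hq.compressionCoeff_smul, mul_assoc, ← mul_assoc p p,
      hp.isStarProjection.isIdempotentElem.eq, mul_assoc]
  have h3 : compressionCoeff p q • (p * q) = compressionCoeff q p • (p * q) := by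
    calc _ = (p * q) * (q * p) * (p * q) := by
          rw [h1, smul_mul_assoc, ← mul_assoc, hp.isStarProjection.isIdempotentElem.eq]
      _ = _ := by
          rw [mul_assoc, h2, mul_smul_comm, mul_assoc, hq.isStarProjection.isIdempotentElem.eq]
  by_cases h0 : p * q = 0
  · rw [hp.compressionCoeff_eq (c := 0) (by rw [h0, zero_mul, zero_smul]),
      hq.compressionCoeff_eq (c := 0) (by rw [mul_assoc, h0, mul_zero, zero_smul])]
  · exact smul_left_injective ℂ h0 h3

end IsMinimalProjection

/-- In a simple algebra with bounded orthogonal families (which is a matrix algebra), quasitraces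
are additive. -/
lemma IsQuasitrace.isTrace_of_card_le [Nontrivial A] {τ : A → ℂ} (hτ : IsQuasitrace τ)
    (hA : IsSimpleCStarAlgebra A) {m : ℕ}
    (hm : ∀ s : Finset A, (∀ a ∈ s, 0 ≤ a ∧ a ≠ 0) →
      (∀ a ∈ s, ∀ b ∈ s, a ≠ b → a * b = 0) → s.card ≤ m) : IsTrace τ := by
  have ht := hτ.isRealQuasitrace
  obtain ⟨s₀, hs₀, hmin₀, -⟩ := exists_minimal_projections hm (.one A)
  obtain ⟨p₀, hp₀⟩ : s₀.Nonempty := by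
    by_contra h
    have := hs₀.sum_eq
    rw [Finset.not_nonempty_iff_eq_empty.mp h, Finset.sum_empty] at this
    exact zero_ne_one this
  -- The sum of diagonal coefficients in a fixed resolution of the identity. By symmetry of the
  -- coefficients it is 1 on every minimal projection, whichever family diagonalizes the element
  -- considered.
  let L : A → ℂ := fun y => ∑ p ∈ s₀, compressionCoeff p y
  have hL : ∀ q : A, IsMinimalProjection q → L q = 1 := by
    intro q hq
    simp only [L]
    rw [Finset.sum_congr rfl fun p hp => (hmin₀ p hp).compressionCoeff_comm hq,
      ← hq.compressionCoeff_sum, hs₀.sum_eq, hq.compressionCoeff_one]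
  have key : ∀ x : A, 0 ≤ x → (τ x).re = (τ p₀).re * (L x).re := by
    intro x hx
    obtain ⟨s, hs, hmin, r, hr⟩ := exists_minimal_projections hm (.of_nonneg hx)
    have hsa : ∀ p ∈ s, IsSelfAdjoint p := fun p hp => (hs.isStarProjection p hp).isSelfAdjoint
    have e1 : (τ x).re = ∑ p ∈ s, r p * (τ p₀).re := by
      conv_lhs => rw [hr]
      refine (ht.sum_of_commute s (fun p => r p • p)
        (fun p hp => (IsSelfAdjoint.all _).smul (hsa p hp)) fun p hp q hq => ?_).trans ?_
      · refine Commute.smul_right (Commute.smul_left ?_ _) _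
        by_cases e : p = q
        · rw [e]
        · exact (hs.orthogonal p hp q hq e).trans (hs.orthogonal q hq p hp (Ne.symm e)).symm
      · refine Finset.sum_congr rfl fun p hp => ?_
        rw [ht.smul _ _ (hsa p hp), hτ.eq_of_isMinimalProjection hA (hmin p hp) (hmin₀ p₀ hp₀)]
    have e2 : L x = ∑ p ∈ s, (r p : ℂ) := by
      conv_lhs => rw [hr]
      simp only [L]
      rw [Finset.sum_congr rfl fun p hp => (hmin₀ p hp).compressionCoeff_sum s _, Finset.sum_comm]
      refine Finset.sum_congr rfl fun p hp => ?_
      rw [Finset.sum_congr rfl fun q hq => (hmin₀ q hq).compressionCoeff_real_smul (r p) p,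
        ← Finset.mul_sum]
      exact (congrArg _ (hL p (hmin p hp))).trans (mul_one _)
    rw [e1, e2, ← Finset.sum_mul, ← Complex.ofReal_sum, Complex.ofReal_re, mul_comm]
  refine hτ.isTrace_of_add fun x y hx hy => ?_
  rw [key _ (add_nonneg hx hy), key x hx, key y hy, ← mul_add, ← Complex.add_re]
  simp only [L]
  rw [Finset.sum_congr rfl fun p hp => (hmin₀ p hp).compressionCoeff_add x y,
    Finset.sum_add_distrib]

/-- Either units of nonzero positive elements have arbitrarily small trace, and Cuntz comparison
controls the remainders, or their traces are bounded below by some `ε > 0`, and orthogonal families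
have at most `τ(1)/ε` members. -/
theorem inT_of_asymptoticallyTraciallyIn (hA : IsSimpleCStarAlgebra A)
    (h : AsymptoticallyTraciallyIn (fun (B : Type v) [CStarAlgebra B] => InT B) A) : InT A := by
  refine inT_of_forall_mem_QT fun τ hτ => ?_
  have hq := hτ.1.1
  by_cases hs : ∀ ε : ℝ, 0 < ε →
      ∃ a g : A, 0 ≤ a ∧ a ≠ 0 ∧ 0 ≤ g ∧ g ≤ 1 ∧ g * a = a ∧ (τ g).re ≤ ε
  · exact hτ.1.isTrace_of_hasSmallRemainders
      (hasSmallRemainders_of_asymptoticallyTraciallyIn hq h hs)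
  push Not at hs
  obtain ⟨ε, hε, hs⟩ := hs
  have hn : Nontrivial A := by
    refine ⟨1, 0, fun e => ?_⟩
    have h1 := hτ.2
    have h0 := hq.isRealQuasitrace.map_zero
    rw [← e] at h0
    simp [h1] at h0
  refine hq.isTrace_of_card_le hA (m := ⌊(τ 1).re / ε⌋₊) fun s h0 h1 => Nat.le_floor ?_
  rw [le_div_iff₀ hε]
  exact hq.isRealQuasitrace.card_mul_le hs s h0 h1

end MinimalProjections

theorem mainTheorem9 {A : Type u} [CStarAlgebra A] [PartialOrder A] [StarOrderedRing A]
    [TopologicalSpace.SeparableSpace A] :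
    (ApproximatedInQuasitraces (fun (B : Type v) [CStarAlgebra B] => InT B) A → InT A) ∧
    (IsSimpleCStarAlgebra A →
      AsymptoticallyTraciallyIn (fun (B : Type v) [CStarAlgebra B] => InT B) A → InT A) :=
  ⟨inT_of_approximatedInQuasitraces, inT_of_asymptoticallyTraciallyIn⟩
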